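/- Let $(\widetilde M,g,J)$ be a Kähler manifold of real dimension $2m$ with Levi-Civita connection $\widetilde\nabla$ and constant holomorphic sectional curvature $\mu\in\mathbb R$, i.e. $g(\widetilde R(x,Jx)Jx,x)=\mu\,g(x,x)^2$ for all tangent vectors $x$, where curvature tensors are taken with the sign $R(X,Y)=\nabla_X\nabla_Y-\nabla_Y\nabla_X-\nabla_{[X,Y]}$. Let $M$ be an (immersed) $n$-dimensional submanifold of $\widetilde M$ with $n>1$. For tangent fields $X,Y$ and normal fields $\xi$ on $M$ write $\widetilde\nabla_XY=\nabla_XY+\sigma(X,Y)$ and $\widetilde\nabla_X\xi=-A_\xi X+D_X\xi$ for the decompositions into tangential and normal components, let $R$ and $R^\perp$ be the curvature tensors of the induced connection $\nabla$ and of the normal connection $D$, and let $f\xi$ be the normal component of $J\xi$. Assume that 1. $M$ is totally real: $J\,T_pM\subset (T_pM)^\perp$ for all $p\in M$; 2. $M$ is semiparallel: $R^\perp(X,Y)\sigma(Z,U)-\sigma(R(X,Y)Z,U)-\sigma(Z,R(X,Y)U)=0$ for all tangent fields $X,Y,Z,U$; 3. $M$ has commutative second fundamental forms: $A_\xi A_\eta=A_\eta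 A_\xi$ for all normal fields $\xi,\eta$; 4. the $f$-structure in the normal bundle is parallel: $D_X(f\xi)=f D_X\xi$ for all tangent fields $X$ and normal fields $\xi$ (the case $f=0$ is allowed). Then $M$ is totally geodesic ($\sigma=0$ on all of $M$) or flat ($R=0$ on all of $M$). -/

import Mathlib

open Bundle
open scoped Manifold ContDiff Topology

noncomputable section

namespace KaehlerSubmanifold

section Curvature

variable {E : Type*} [NormedAddCommGroup E] [NormedSpace ℝ E]
  {M : Type*} [TopologicalSpace M] [ChartedSpace E M] [IsManifold 𝓘(ℝ, E) ∞ M]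
  {V : M → Type*} [∀ p, AddCommGroup (V p)]

/-- The vector field `X` is smooth on a neighbourhood of `p`. -/
def SmoothNear (X : ∀ q : M, TangentSpace 𝓘(ℝ, E) q) (p : M) : Prop :=
  ∀ᶠ q in 𝓝 p, ContMDiffAt 𝓘(ℝ, E) 𝓘(ℝ, E).tangent ∞
    (fun r ↦ (⟨r, X r⟩ : TangentBundle 𝓘(ℝ, E) M)) q

/-- `D s q v` is the covariant derivative of the section `s` at `q` in the direction `v`; this is
`D_X (D_Y s) - D_Y (D_X s) - D_{[X, Y]} s` at the point `p`. -/
def curvature (D : (∀ q : M, V q) → ∀ q : M, TangentSpace 𝓘(ℝ, E) q → V q)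
    (X Y : ∀ q : M, TangentSpace 𝓘(ℝ, E) q) (s : ∀ q : M, V q) (p : M) : V p :=
  D (fun q ↦ D s q (Y q)) p (X p) - D (fun q ↦ D s q (X q)) p (Y p)
    - D s p (VectorField.mlieBracket 𝓘(ℝ, E) X Y p)

end Curvature

section Ambient

variable {F : Type*} [NormedAddCommGroup F] [NormedSpace ℝ F] [FiniteDimensional ℝ F]
  {N : Type*} [TopologicalSpace N] [ChartedSpace F N] [IsManifold 𝓘(ℝ, F) ∞ N]
  [RiemannianBundle (fun x : N ↦ TangentSpace 𝓘(ℝ, F) x)]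
  [IsContMDiffRiemannianBundle 𝓘(ℝ, F) ∞ F (fun x : N ↦ TangentSpace 𝓘(ℝ, F) x)]

/-- `(N, g, J, ∇)` is a Kähler manifold: `∇` is the Levi-Civita connection of the Riemannian metric
`g` of `N`, and `J` is a smooth, `g`-orthogonal and `∇`-parallel almost complex structure. -/
structure IsKaehler
    (cov : CovariantDerivative 𝓘(ℝ, F) F (fun x : N ↦ TangentSpace 𝓘(ℝ, F) x))
    (J : ∀ x : N, TangentSpace 𝓘(ℝ, F) x →L[ℝ] TangentSpace 𝓘(ℝ, F) x) : Prop where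
  /-- `∇` is a smooth connection: it maps smooth fields to smooth fields. -/
  smooth_cov : cov.ContMDiffCovariantDerivative ∞
  torsion_free : cov.torsion = 0
  metric : CovariantDerivative.IsMetricCompatible (F := F)
    (V := fun x : N ↦ TangentSpace 𝓘(ℝ, F) x) cov
  smooth_J : ContMDiff 𝓘(ℝ, F) (𝓘(ℝ, F).prod 𝓘(ℝ, F →L[ℝ] F)) ∞
    (fun x ↦ TotalSpace.mk' (F →L[ℝ] F)
      (E := fun x : N ↦ TangentSpace 𝓘(ℝ, F) x →L[ℝ] TangentSpace 𝓘(ℝ, F) x) x (J x))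
  J_sq : ∀ (x : N) (v : TangentSpace 𝓘(ℝ, F) x), J x (J x v) = -v
  J_orthogonal : ∀ (x : N) (v w : TangentSpace 𝓘(ℝ, F) x),
    inner ℝ (J x v) (J x w) = inner ℝ v w
  J_parallel : ∀ (x : N) (Y : ∀ y : N, TangentSpace 𝓘(ℝ, F) y), SmoothNear Y x →
    ∀ v : TangentSpace 𝓘(ℝ, F) x, cov (fun y ↦ J y (Y y)) x v = J x (cov Y x v)

/-- The holomorphic sectional curvature is the constant `μ`:
`g(R(X, JX)JX, X) = μ g(X, X)²` for every vector field `X`. -/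
def HasConstantHolomorphicCurvature
    (cov : CovariantDerivative 𝓘(ℝ, F) F (fun x : N ↦ TangentSpace 𝓘(ℝ, F) x))
    (J : ∀ x : N, TangentSpace 𝓘(ℝ, F) x →L[ℝ] TangentSpace 𝓘(ℝ, F) x) (μ : ℝ) : Prop :=
  ∀ (x : N) (X : ∀ y : N, TangentSpace 𝓘(ℝ, F) y), SmoothNear X x →
    inner ℝ (curvature (fun s y v ↦ cov s y v) X (fun y ↦ J y (X y)) (fun y ↦ J y (X y)) x) (X x)
      = μ * (inner ℝ (X x) (X x)) ^ 2

end Ambient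

section Submanifold

variable {E : Type*} [NormedAddCommGroup E] [NormedSpace ℝ E] [FiniteDimensional ℝ E]
  {M : Type*} [TopologicalSpace M] [ChartedSpace E M] [IsManifold 𝓘(ℝ, E) ∞ M]
  {F : Type*} [NormedAddCommGroup F] [NormedSpace ℝ F] [FiniteDimensional ℝ F]
  {N : Type*} [TopologicalSpace N] [ChartedSpace F N] [IsManifold 𝓘(ℝ, F) ∞ N]

variable (E F) in
/-- `ι : M → N` is a smooth immersion, i.e. it makes `M` an (immersed) submanifold of `N`. -/
structure IsSubmanifold (ι : M → N) : Prop where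
  smooth : ContMDiff 𝓘(ℝ, E) 𝓘(ℝ, F) ∞ ι
  injective : ∀ p : M, Function.Injective (mfderiv 𝓘(ℝ, E) 𝓘(ℝ, F) ι p)

/-- The vector field `V` along `ι` is smooth on a neighbourhood of `p`. -/
def SmoothAlongNear (ι : M → N) (V : ∀ q : M, TangentSpace 𝓘(ℝ, F) (ι q)) (p : M) : Prop :=
  ∀ᶠ q in 𝓝 p, ContMDiffAt 𝓘(ℝ, E) 𝓘(ℝ, F).tangent ∞
    (fun r ↦ (⟨ι r, V r⟩ : TangentBundle 𝓘(ℝ, F) N)) q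

/-- A vector field on `M`, regarded as a vector field along `ι`. -/
def push (ι : M → N) (X : ∀ q : M, TangentSpace 𝓘(ℝ, E) q) (q : M) :
    TangentSpace 𝓘(ℝ, F) (ι q) :=
  mfderiv 𝓘(ℝ, E) 𝓘(ℝ, F) ι q (X q)

/-- The covariant derivative of a vector field `V` along `ι` at `p` in the direction `v ∈ T_p M`.
Let `c` be the coordinates of `V` in a local trivialization of `TN` around `ι p`. The value is
the derivative of `c` in the direction `v`, plus the covariant derivative in the direction
`dι v` of the local vector field of `N` which has the constant coordinates `c p`.
In a local frame `e_i`: `∇_v (∑ c_i (e_i ∘ ι)) = ∑ dc_i(v) e_i + ∑ c_i ∇_{dι v} e_i`. -/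
def covAlong (cov : CovariantDerivative 𝓘(ℝ, F) F (fun x : N ↦ TangentSpace 𝓘(ℝ, F) x))
    (ι : M → N) (V : ∀ q : M, TangentSpace 𝓘(ℝ, F) (ι q)) (p : M) (v : TangentSpace 𝓘(ℝ, E) p) :
    TangentSpace 𝓘(ℝ, F) (ι p) :=
  let e := trivializationAt F (fun x : N ↦ TangentSpace 𝓘(ℝ, F) x) (ι p)
  let c : M → F := fun q ↦ (e ⟨ι q, V q⟩).2
  e.symm (ι p) (mfderiv 𝓘(ℝ, E) 𝓘(ℝ, F) c p v)
    + cov (fun y ↦ e.symm y (c p)) (ι p) (mfderiv 𝓘(ℝ, E) 𝓘(ℝ, F) ι p v)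

variable [RiemannianBundle (fun x : N ↦ TangentSpace 𝓘(ℝ, F) x)]

variable (E) in
/-- The tangent space of the submanifold at `p`, as a subspace of `T_{ι p} N`. -/
def tangentSubspace (ι : M → N) (p : M) : Submodule ℝ (TangentSpace 𝓘(ℝ, F) (ι p)) :=
  LinearMap.range (mfderiv 𝓘(ℝ, E) 𝓘(ℝ, F) ι p).toLinearMap

instance (ι : M → N) (p : M) : FiniteDimensional ℝ (tangentSubspace E (F := F) ι p) := by
  have : FiniteDimensional ℝ (TangentSpace 𝓘(ℝ, E) p) := inferInstanceAs (FiniteDimensional ℝ E)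
  unfold tangentSubspace
  infer_instance

variable (E) in
/-- The normal component of `w ∈ T_{ι p} N`. -/
def normalPart (ι : M → N) (p : M) (w : TangentSpace 𝓘(ℝ, F) (ι p)) :
    TangentSpace 𝓘(ℝ, F) (ι p) :=
  w - (tangentSubspace E ι p).starProjection w

variable (E) in
/-- The tangential component of `w ∈ T_{ι p} N`, as a vector of `T_p M`. -/
def tangentPart (ι : M → N) (p : M) (w : TangentSpace 𝓘(ℝ, F) (ι p)) : TangentSpace 𝓘(ℝ, E) p :=
  (mfderiv 𝓘(ℝ, E) 𝓘(ℝ, F) ι p).toLinearMap.leftInverse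
    ((tangentSubspace E ι p).starProjection w)

variable (E) in
/-- `ξ` is a normal vector field which is smooth on a neighbourhood of `p`. -/
def SmoothNormalNear (ι : M → N) (ξ : ∀ q : M, TangentSpace 𝓘(ℝ, F) (ι q)) (p : M) : Prop :=
  SmoothAlongNear (E := E) ι ξ p ∧ ∀ᶠ q in 𝓝 p, ξ q ∈ (tangentSubspace E ι q)ᗮ

variable (cov : CovariantDerivative 𝓘(ℝ, F) F (fun x : N ↦ TangentSpace 𝓘(ℝ, F) x))

/-- The induced covariant differentiation of `M`: `∇_v Y` is the tangential component of the
covariant derivative of `Y` in `N`. -/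
def inducedConnection (ι : M → N) (Y : ∀ q : M, TangentSpace 𝓘(ℝ, E) q) (p : M)
    (v : TangentSpace 𝓘(ℝ, E) p) : TangentSpace 𝓘(ℝ, E) p :=
  tangentPart E ι p (covAlong cov ι (push ι Y) p v)

/-- The second fundamental form: `σ(X, Y)` is the normal component of the covariant derivative
of `Y` in the direction of `X` in `N`. -/
def secondFundamentalForm (ι : M → N) (X Y : ∀ q : M, TangentSpace 𝓘(ℝ, E) q) (p : M) :
    TangentSpace 𝓘(ℝ, F) (ι p) :=
  normalPart E ι p (covAlong cov ι (push ι Y) p (X p))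

/-- The shape operator: `-A_ξ v` is the tangential component of the covariant derivative of `ξ`. -/
def shapeOperator (ι : M → N) (ξ : ∀ q : M, TangentSpace 𝓘(ℝ, F) (ι q)) (p : M)
    (v : TangentSpace 𝓘(ℝ, E) p) : TangentSpace 𝓘(ℝ, E) p :=
  -tangentPart E ι p (covAlong cov ι ξ p v)

/-- The normal connection: `D_v ξ` is the normal component of the covariant derivative of `ξ`. -/
def normalConnection (ι : M → N) (ξ : ∀ q : M, TangentSpace 𝓘(ℝ, F) (ι q)) (p : M)
    (v : TangentSpace 𝓘(ℝ, E) p) : TangentSpace 𝓘(ℝ, F) (ι p) :=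
  normalPart E ι p (covAlong cov ι ξ p v)

/-- The curvature tensor `R(X, Y)Z` of `M`. -/
def tangentCurvature (ι : M → N) (X Y Z : ∀ q : M, TangentSpace 𝓘(ℝ, E) q) (p : M) :
    TangentSpace 𝓘(ℝ, E) p :=
  curvature (inducedConnection cov ι) X Y Z p

/-- The curvature tensor `R^⊥(X, Y)ξ` of the normal connection. -/
def normalCurvature (ι : M → N) (X Y : ∀ q : M, TangentSpace 𝓘(ℝ, E) q)
    (ξ : ∀ q : M, TangentSpace 𝓘(ℝ, F) (ι q)) (p : M) : TangentSpace 𝓘(ℝ, F) (ι p) :=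
  curvature (V := fun q ↦ TangentSpace 𝓘(ℝ, F) (ι q)) (normalConnection cov ι) X Y ξ p

variable (E) in
/-- `J` maps the tangent spaces of `M` into the normal spaces. -/
def IsTotallyReal (J : ∀ x : N, TangentSpace 𝓘(ℝ, F) x →L[ℝ] TangentSpace 𝓘(ℝ, F) x)
    (ι : M → N) : Prop :=
  ∀ (p : M), ∀ w ∈ tangentSubspace E ι p, J (ι p) w ∈ (tangentSubspace E ι p)ᗮ

variable (E) in
/-- Commutative second fundamental forms: `[A_ξ, A_η] = 0` for all normal fields `ξ`, `η`. -/
def HasCommutativeSecondForms (ι : M → N) : Prop :=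
  ∀ (p : M) (ξ η : ∀ q : M, TangentSpace 𝓘(ℝ, F) (ι q)),
    SmoothNormalNear E ι ξ p → SmoothNormalNear E ι η p →
    ∀ v : TangentSpace 𝓘(ℝ, E) p,
      shapeOperator cov ι ξ p (shapeOperator cov ι η p v)
        = shapeOperator cov ι η p (shapeOperator cov ι ξ p v)

variable (E) in
/-- The endomorphism `f` of the normal bundle, `f ξ` being the normal component of `J ξ`. -/
def normalF (J : ∀ x : N, TangentSpace 𝓘(ℝ, F) x →L[ℝ] TangentSpace 𝓘(ℝ, F) x)
    (ι : M → N) (p : M) (ξ : TangentSpace 𝓘(ℝ, F) (ι p)) : TangentSpace 𝓘(ℝ, F) (ι p) :=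
  normalPart E ι p (J (ι p) ξ)

variable (E) in
/-- The `f`-structure in the normal bundle is parallel: `D_v (f ξ) = f (D_v ξ)`. -/
def HasParallelF (J : ∀ x : N, TangentSpace 𝓘(ℝ, F) x →L[ℝ] TangentSpace 𝓘(ℝ, F) x)
    (ι : M → N) : Prop :=
  ∀ (p : M) (ξ : ∀ q : M, TangentSpace 𝓘(ℝ, F) (ι q)), SmoothNormalNear E ι ξ p →
    ∀ v : TangentSpace 𝓘(ℝ, E) p,
      normalConnection cov ι (fun q ↦ normalF E J ι q (ξ q)) p v
        = normalF E J ι p (normalConnection cov ι ξ p v)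

variable (E) in
/-- `M` is semiparallel: `R^⊥(X, Y)σ(Z, U) - σ(R(X, Y)Z, U) - σ(Z, R(X, Y)U) = 0`. -/
def IsSemiparallel (ι : M → N) : Prop :=
  ∀ (p : M) (X Y Z U : ∀ q : M, TangentSpace 𝓘(ℝ, E) q),
    SmoothNear X p → SmoothNear Y p → SmoothNear Z p → SmoothNear U p →
    normalCurvature cov ι X Y (secondFundamentalForm cov ι Z U) p
      - secondFundamentalForm cov ι (tangentCurvature cov ι X Y Z) U p
      - secondFundamentalForm cov ι Z (tangentCurvature cov ι X Y U) p = 0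

variable (E) in
/-- `M` is totally geodesic: `σ = 0`. -/
def IsTotallyGeodesic (ι : M → N) : Prop :=
  ∀ (p : M) (X Y : ∀ q : M, TangentSpace 𝓘(ℝ, E) q),
    SmoothNear X p → SmoothNear Y p → secondFundamentalForm cov ι X Y p = 0

variable (E) in
/-- `M` is flat: its curvature tensor `R` vanishes. -/
def IsFlat (ι : M → N) : Prop :=
  ∀ (p : M) (X Y Z : ∀ q : M, TangentSpace 𝓘(ℝ, E) q),
    SmoothNear X p → SmoothNear Y p → SmoothNear Z p → tangentCurvature cov ι X Y Z p = 0

end Submanifold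

end KaehlerSubmanifold

end

/-! The holomorphic curvature determines the ambient curvature tensor, so by the Gauss equation and
commutativity of the second fundamental forms, `4 R(X, Y)Z = μ (⟨Y, Z⟩ X - ⟨X, Z⟩ Y)` on `M`; this
settles `μ = 0`. Since `f` is skew-adjoint and vanishes on `J(TM)`, parallelism of `f` forces
`fσ = 0`, so `σ` takes values in `J(TM)` and `J` carries `R` to `R^⊥` there. Semiparallelity then
becomes an algebraic identity for the symmetric cubic form `⟨σ(X, Y), JZ⟩`, which for `μ ≠ 0` and
`n > 1` only the zero form satisfies. -/

noncomputable section

namespace KaehlerSubmanifold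

section SmoothFunctions

variable {E : Type*} [NormedAddCommGroup E] [NormedSpace ℝ E]
  {M : Type*} [TopologicalSpace M] [ChartedSpace E M]

variable (E) in
/-- The function `c` is smooth on a neighbourhood of `p`; the scalar counterpart of `SmoothNear`. -/
def SmoothFnNear (c : M → ℝ) (p : M) : Prop :=
  ∀ᶠ q in 𝓝 p, ContMDiffAt 𝓘(ℝ, E) 𝓘(ℝ, ℝ) ∞ c q

namespace SmoothFnNear

variable {c d : M → ℝ} {p : M}

lemma contMDiffAt (hc : SmoothFnNear E c p) : ContMDiffAt 𝓘(ℝ, E) 𝓘(ℝ, ℝ) ∞ c p :=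
  Filter.Eventually.self_of_nhds hc

lemma mdifferentiableAt (hc : SmoothFnNear E c p) :
    MDifferentiableAt 𝓘(ℝ, E) 𝓘(ℝ, ℝ) c p :=
  hc.contMDiffAt.mdifferentiableAt (by simp)

lemma eventually (hc : SmoothFnNear E c p) : ∀ᶠ q in 𝓝 p, SmoothFnNear E c q :=
  eventually_eventually_nhds.2 hc

lemma const (a : ℝ) : SmoothFnNear E (fun _ : M ↦ a) p :=
  .of_forall fun _ ↦ contMDiffAt_const

lemma add (hc : SmoothFnNear E c p) (hd : SmoothFnNear E d p) :
    SmoothFnNear E (fun q ↦ c q + d q) p := by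
  filter_upwards [hc, hd] with q hcq hdq using hcq.add hdq

lemma sub (hc : SmoothFnNear E c p) (hd : SmoothFnNear E d p) :
    SmoothFnNear E (fun q ↦ c q - d q) p := by
  filter_upwards [hc, hd] with q hcq hdq using hcq.sub hdq

lemma mul (hc : SmoothFnNear E c p) (hd : SmoothFnNear E d p) :
    SmoothFnNear E (fun q ↦ c q * d q) p := by
  filter_upwards [hc, hd] with q hcq hdq using hcq.mul hdq

lemma sum {κ : Type*} (s : Finset κ) {f : κ → M → ℝ} (hf : ∀ i ∈ s, SmoothFnNear E (f i) p) :
    SmoothFnNear E (fun q ↦ ∑ i ∈ s, f i q) p := by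
  filter_upwards [(Filter.eventually_all_finset s).2 hf] with q hq using contMDiffAt_finsetSum hq

lemma prod {κ : Type*} (s : Finset κ) {f : κ → M → ℝ} (hf : ∀ i ∈ s, SmoothFnNear E (f i) p) :
    SmoothFnNear E (fun q ↦ ∏ i ∈ s, f i q) p := by
  filter_upwards [(Filter.eventually_all_finset s).2 hf] with q hq using contMDiffAt_finsetProd hq

lemma inv (hc : SmoothFnNear E c p) (h0 : c p ≠ 0) : SmoothFnNear E (fun q ↦ (c q)⁻¹) p := by
  filter_upwards [hc, hc.contMDiffAt.continuousAt.eventually_ne h0] with q hcq hq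
  exact (contDiffAt_inv ℝ hq).contMDiffAt.comp q hcq

lemma det {κ : Type*} [Fintype κ] [DecidableEq κ] {A : M → Matrix κ κ ℝ}
    (hA : ∀ i j, SmoothFnNear E (fun q ↦ A q i j) p) : SmoothFnNear E (fun q ↦ (A q).det) p := by
  simp only [Matrix.det_apply']
  exact sum _ fun _ _ ↦ (const _).mul (prod _ fun _ _ ↦ hA _ _)

lemma mvfderiv_add (hc : SmoothFnNear E c p) (hd : SmoothFnNear E d p)
    (v : TangentSpace 𝓘(ℝ, E) p) : mvfderiv 𝓘(ℝ, E) (fun q ↦ c q + d q) p v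
      = mvfderiv 𝓘(ℝ, E) c p v + mvfderiv 𝓘(ℝ, E) d p v :=
  congr($(_root_.mvfderiv_add hc.mdifferentiableAt hd.mdifferentiableAt) v)

lemma mvfderiv_mul (hc : SmoothFnNear E c p) (hd : SmoothFnNear E d p)
    (v : TangentSpace 𝓘(ℝ, E) p) : mvfderiv 𝓘(ℝ, E) (fun q ↦ c q * d q) p v
      = c p * mvfderiv 𝓘(ℝ, E) d p v + d p * mvfderiv 𝓘(ℝ, E) c p v := by
  simpa using! congr($(_root_.mvfderiv_mul hc.mdifferentiableAt hd.mdifferentiableAt) v)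

end SmoothFnNear

lemma mvfderiv_congr {c d : M → ℝ} {p : M} (h : ∀ᶠ q in 𝓝 p, c q = d q)
    (v : TangentSpace 𝓘(ℝ, E) p) : mvfderiv 𝓘(ℝ, E) c p v = mvfderiv 𝓘(ℝ, E) d p v := by
  have hcd := Filter.EventuallyEq.mfderiv_eq (I := 𝓘(ℝ, E)) (I' := 𝓘(ℝ, ℝ)) h
  exact congr($hcd v)

end SmoothFunctions

section Frames

variable {F : Type*} [NormedAddCommGroup F] [NormedSpace ℝ F]
  {N : Type*} [TopologicalSpace N] [ChartedSpace F N] [IsManifold 𝓘(ℝ, F) ∞ N]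
  {x y : N} {X : ∀ z : N, TangentSpace 𝓘(ℝ, F) z}

variable (F) in
/-- The domain of the preferred trivialization of the tangent bundle around `y`, on which the frame
`frame y` is defined. -/
def frameDomain (y : N) : Set N :=
  (trivializationAt F (fun x : N ↦ TangentSpace 𝓘(ℝ, F) x) y).baseSet

lemma mem_frameDomain (y : N) : y ∈ frameDomain F y :=
  FiberBundle.mem_baseSet_trivializationAt' y

lemma frameDomain_mem_nhds (hx : x ∈ frameDomain F y) : frameDomain F y ∈ 𝓝 x :=
  (trivializationAt F (fun x : N ↦ TangentSpace 𝓘(ℝ, F) x) y).open_baseSet.mem_nhds hx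

namespace SmoothNear

lemma contMDiffAt (hX : SmoothNear X x) :
    ContMDiffAt 𝓘(ℝ, F) 𝓘(ℝ, F).tangent ∞ (fun r ↦ (⟨r, X r⟩ : TangentBundle 𝓘(ℝ, F) N)) x :=
  Filter.Eventually.self_of_nhds hX

lemma mdifferentiableAt (hX : SmoothNear X x) :
    MDifferentiableAt 𝓘(ℝ, F) 𝓘(ℝ, F).tangent
      (fun r ↦ (⟨r, X r⟩ : TangentBundle 𝓘(ℝ, F) N)) x :=
  hX.contMDiffAt.mdifferentiableAt (by simp)

lemma eventually (hX : SmoothNear X x) : ∀ᶠ z in 𝓝 x, SmoothNear X z :=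
  eventually_eventually_nhds.2 hX

end SmoothNear

lemma smoothNear_extend (v : TangentSpace 𝓘(ℝ, F) x) : SmoothNear (FiberBundle.extend F v) x := by
  obtain ⟨s, hs, hsmooth⟩ := FiberBundle.exists_contMDiffOn_extend (k := ∞) 𝓘(ℝ, F) F v
  filter_upwards [eventually_mem_nhds_iff.2 hs] with z hz using hsmooth.contMDiffAt hz

variable [FiniteDimensional ℝ F] {i : Fin (Module.finrank ℝ F)}

/-- The local frame of the tangent bundle given by the preferred trivialization around `y`. -/
def frame (y : N) (i : Fin (Module.finrank ℝ F)) (x : N) : TangentSpace 𝓘(ℝ, F) x :=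
  (trivializationAt F (fun x : N ↦ TangentSpace 𝓘(ℝ, F) x) y).localFrame
    (Module.finBasis ℝ F) i x

/-- The coefficients of a tangent vector in the frame `frame y`. -/
def frameCoeff (y : N) (i : Fin (Module.finrank ℝ F)) (x : N) :
    TangentSpace 𝓘(ℝ, F) x →ₗ[ℝ] ℝ :=
  (trivializationAt F (fun x : N ↦ TangentSpace 𝓘(ℝ, F) x) y).localFrameCoeff 𝓘(ℝ, F)
    (Module.finBasis ℝ F) i x

lemma smoothNear_frame (hx : x ∈ frameDomain F y) (i : Fin (Module.finrank ℝ F)) :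
    SmoothNear (frame y i) x := by
  filter_upwards [frameDomain_mem_nhds hx] with z hz using contMDiffAt_localFrame_of_mem _ _ _ i hz

lemma frameCoeff_eq (hx : x ∈ frameDomain F y) (v : TangentSpace 𝓘(ℝ, F) x) :
    frameCoeff y i x v = (Module.finBasis ℝ F).repr
      (trivializationAt F (fun x : N ↦ TangentSpace 𝓘(ℝ, F) x) y ⟨x, v⟩).2 i := by
  classical
  simpa only [Function.update_self] using!
    (trivializationAt F (fun x : N ↦ TangentSpace 𝓘(ℝ, F) x) y).localFrameCoeff_eq_coeff
      (I := 𝓘(ℝ, F)) (b := Module.finBasis ℝ F) (s := Function.update 0 x v) hx (i := i)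

lemma symm_eq_sum_frame (hx : x ∈ frameDomain F y) (a : F) :
    (trivializationAt F (fun x : N ↦ TangentSpace 𝓘(ℝ, F) x) y).symm x a =
      ∑ i, (Module.finBasis ℝ F).repr a i • frame y i x := by
  set e := trivializationAt F (fun x : N ↦ TangentSpace 𝓘(ℝ, F) x) y
  have hframe (i) : frame y i x = (e.linearEquivAt (R := ℝ) x hx).symm (Module.finBasis ℝ F i) :=
    e.localFrame_apply_of_mem_baseSet _ hx
  simp_rw [hframe, ← map_smul, ← map_sum, (Module.finBasis ℝ F).sum_repr]
  rfl

lemma sum_frameCoeff_smul_frame (hx : x ∈ frameDomain F y) (v : TangentSpace 𝓘(ℝ, F) x) :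
    ∑ i, frameCoeff y i x v • frame y i x = v := by
  simp_rw [frameCoeff_eq hx, ← symm_eq_sum_frame hx]
  exact (trivializationAt F (fun x : N ↦ TangentSpace 𝓘(ℝ, F) x) y).symm_apply_apply_mk hx v

lemma map_eq_sum_frame {W Φ : Type*} [AddCommGroup W] [Module ℝ W]
    [FunLike Φ (TangentSpace 𝓘(ℝ, F) x) W] [LinearMapClass Φ ℝ (TangentSpace 𝓘(ℝ, F) x) W]
    (hx : x ∈ frameDomain F y) (L : Φ) (v : TangentSpace 𝓘(ℝ, F) x) :
    L v = ∑ i, frameCoeff y i x v • L (frame y i x) := by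
  conv_lhs => rw [← sum_frameCoeff_smul_frame hx v]
  simp only [map_sum, map_smul]

lemma frameCoeff_frame (hx : x ∈ frameDomain F y) (i j : Fin (Module.finrank ℝ F)) :
    frameCoeff y i x (frame y j x) = if j = i then 1 else 0 := by
  set e := trivializationAt F (fun x : N ↦ TangentSpace 𝓘(ℝ, F) x) y
  have hframe : frame y j x = e.basisAt (Module.finBasis ℝ F) hx j :=
    e.localFrame_apply_of_mem_baseSet _ hx
  refine (e.localFrameCoeff_apply_of_mem_baseSet (I := 𝓘(ℝ, F)) (Module.finBasis ℝ F) hx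
    (frame y j) i).trans ?_
  rw [hframe, Module.Basis.repr_self, Finsupp.single_apply]

lemma frameCoeff_ext (hx : x ∈ frameDomain F y) {v w : TangentSpace 𝓘(ℝ, F) x}
    (h : ∀ i, frameCoeff y i x v = frameCoeff y i x w) : v = w := by
  rw [← sum_frameCoeff_smul_frame hx v, ← sum_frameCoeff_smul_frame hx w]
  simp only [h]

lemma extend_eq_sum_frame (hx : x ∈ frameDomain F y) (v : TangentSpace 𝓘(ℝ, F) y) :
    FiberBundle.extend F v x = ∑ i, frameCoeff y i y v • frame y i x := by
  simp_rw [frameCoeff_eq (mem_frameDomain y)]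
  exact symm_eq_sum_frame hx _

lemma frameCoeff_extend (hx : x ∈ frameDomain F y) (v : TangentSpace 𝓘(ℝ, F) y) :
    frameCoeff y i x (FiberBundle.extend F v x) = frameCoeff y i y v := by
  simp [extend_eq_sum_frame hx, frameCoeff_frame hx]

end Frames

section AlongMaps

variable {E : Type*} [NormedAddCommGroup E] [NormedSpace ℝ E]
  {M : Type*} [TopologicalSpace M] [ChartedSpace E M]
  {F : Type*} [NormedAddCommGroup F] [NormedSpace ℝ F]
  {N : Type*} [TopologicalSpace N] [ChartedSpace F N] [IsManifold 𝓘(ℝ, F) ∞ N]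
  {ι : M → N} {V W : ∀ q : M, TangentSpace 𝓘(ℝ, F) (ι q)} {p : M} {y : N}

lemma eventually_mem_frameDomain (hι : ContMDiff 𝓘(ℝ, E) 𝓘(ℝ, F) ∞ ι)
    (hy : ι p ∈ frameDomain F y) : ∀ᶠ q in 𝓝 p, ι q ∈ frameDomain F y :=
  hι.continuous.continuousAt.eventually (frameDomain_mem_nhds hy)

namespace SmoothAlongNear

lemma contMDiffAt (hV : SmoothAlongNear (E := E) ι V p) : ContMDiffAt 𝓘(ℝ, E) 𝓘(ℝ, F).tangent ∞
    (fun r ↦ (⟨ι r, V r⟩ : TangentBundle 𝓘(ℝ, F) N)) p :=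
  Filter.Eventually.self_of_nhds hV

lemma eventually (hV : SmoothAlongNear (E := E) ι V p) :
    ∀ᶠ q in 𝓝 p, SmoothAlongNear (E := E) ι V q :=
  eventually_eventually_nhds.2 hV

lemma congr (hV : SmoothAlongNear (E := E) ι V p) (h : ∀ᶠ q in 𝓝 p, W q = V q) :
    SmoothAlongNear (E := E) ι W p := by
  filter_upwards [hV, eventually_eventually_nhds.2 h] with q hVq hq
  refine hVq.congr_of_eventuallyEq ?_
  filter_upwards [hq] with r hr
  rw [hr]

end SmoothAlongNear

variable [FiniteDimensional ℝ F]

lemma contMDiffAt_along_iff (hι : ContMDiff 𝓘(ℝ, E) 𝓘(ℝ, F) ∞ ι) (hy : ι p ∈ frameDomain F y) :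
    ContMDiffAt 𝓘(ℝ, E) 𝓘(ℝ, F).tangent ∞
      (fun r ↦ (⟨ι r, V r⟩ : TangentBundle 𝓘(ℝ, F) N)) p ↔
    ∀ i, ContMDiffAt 𝓘(ℝ, E) 𝓘(ℝ, ℝ) ∞ (fun q ↦ frameCoeff y i (ι q) (V q)) p := by
  set e := trivializationAt F (fun x : N ↦ TangentSpace 𝓘(ℝ, F) x) y
  let L := (Module.finBasis ℝ F).equivFunL.toDiffeomorph
  rw [e.contMDiffAt_iff (IM := 𝓘(ℝ, E)) (IB := 𝓘(ℝ, F)) (n := ∞) (x₀ := p)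
    (f := fun r ↦ (⟨ι r, V r⟩ : TangentBundle 𝓘(ℝ, F) N)) (e.mem_source.2 hy),
    and_iff_right (hι p), ← L.contMDiffAt_diffeomorph_comp_iff (by simp), contMDiffAt_pi_space]
  refine forall_congr' fun i ↦ Filter.EventuallyEq.contMDiffAt_iff ?_
  filter_upwards [eventually_mem_frameDomain hι hy] with q hq
  rw [frameCoeff_eq hq]
  rfl

lemma smoothAlongNear_iff (hι : ContMDiff 𝓘(ℝ, E) 𝓘(ℝ, F) ∞ ι) (hy : ι p ∈ frameDomain F y) :
    SmoothAlongNear (E := E) ι V p ↔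
      ∀ i, SmoothFnNear E (fun q ↦ frameCoeff y i (ι q) (V q)) p := by
  unfold SmoothAlongNear SmoothFnNear
  rw [← Filter.eventually_all]
  refine Filter.eventually_congr ?_
  filter_upwards [eventually_mem_frameDomain hι hy] with q hq using contMDiffAt_along_iff hι hq

namespace SmoothAlongNear

lemma smoothFnNear_frameCoeff (hι : ContMDiff 𝓘(ℝ, E) 𝓘(ℝ, F) ∞ ι)
    (hV : SmoothAlongNear (E := E) ι V p) (hy : ι p ∈ frameDomain F y)
    (i : Fin (Module.finrank ℝ F)) : SmoothFnNear E (fun q ↦ frameCoeff y i (ι q) (V q)) p :=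
  (smoothAlongNear_iff hι hy).1 hV i

lemma zero (hι : ContMDiff 𝓘(ℝ, E) 𝓘(ℝ, F) ∞ ι) :
    SmoothAlongNear (E := E) ι (fun q ↦ (0 : TangentSpace 𝓘(ℝ, F) (ι q))) p :=
  (smoothAlongNear_iff hι (mem_frameDomain _)).2 fun i ↦ by
    simpa only [map_zero] using .const 0

lemma add (hι : ContMDiff 𝓘(ℝ, E) 𝓘(ℝ, F) ∞ ι) (hV : SmoothAlongNear (E := E) ι V p)
    (hW : SmoothAlongNear (E := E) ι W p) : SmoothAlongNear (E := E) ι (fun q ↦ V q + W q) p := by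
  rw [smoothAlongNear_iff hι (mem_frameDomain _)] at *
  intro i
  simpa only [map_add] using (hV i).add (hW i)

lemma sub (hι : ContMDiff 𝓘(ℝ, E) 𝓘(ℝ, F) ∞ ι) (hV : SmoothAlongNear (E := E) ι V p)
    (hW : SmoothAlongNear (E := E) ι W p) : SmoothAlongNear (E := E) ι (fun q ↦ V q - W q) p := by
  rw [smoothAlongNear_iff hι (mem_frameDomain _)] at *
  intro i
  simpa only [map_sub] using (hV i).sub (hW i)

lemma smul (hι : ContMDiff 𝓘(ℝ, E) 𝓘(ℝ, F) ∞ ι) {c : M → ℝ} (hc : SmoothFnNear E c p)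
    (hV : SmoothAlongNear (E := E) ι V p) : SmoothAlongNear (E := E) ι (fun q ↦ c q • V q) p := by
  rw [smoothAlongNear_iff hι (mem_frameDomain _)] at *
  intro i
  simpa only [map_smul, smul_eq_mul] using hc.mul (hV i)

lemma sum (hι : ContMDiff 𝓘(ℝ, E) 𝓘(ℝ, F) ∞ ι) {κ : Type*} (s : Finset κ)
    {V : κ → ∀ q : M, TangentSpace 𝓘(ℝ, F) (ι q)}
    (hV : ∀ k ∈ s, SmoothAlongNear (E := E) ι (V k) p) :
    SmoothAlongNear (E := E) ι (fun q ↦ ∑ k ∈ s, V k q) p := by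
  refine (smoothAlongNear_iff hι (mem_frameDomain _)).2 fun i ↦ ?_
  simpa only [map_sum] using
    .sum s fun k hk ↦ (hV k hk).smoothFnNear_frameCoeff hι (mem_frameDomain _) i

end SmoothAlongNear

end AlongMaps

section VectorFields

variable {F : Type*} [NormedAddCommGroup F] [NormedSpace ℝ F]
  {N : Type*} [TopologicalSpace N] [ChartedSpace F N] [IsManifold 𝓘(ℝ, F) ∞ N] {x : N}
  {X Y : ∀ z : N, TangentSpace 𝓘(ℝ, F) z}

namespace SmoothNear

lemma congr (hX : SmoothNear X x) (h : ∀ᶠ z in 𝓝 x, Y z = X z) : SmoothNear Y x :=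
  SmoothAlongNear.congr (ι := fun z : N ↦ z) hX h

variable [FiniteDimensional ℝ F]

lemma zero : SmoothNear (fun z : N ↦ (0 : TangentSpace 𝓘(ℝ, F) z)) x :=
  SmoothAlongNear.zero (ι := fun z : N ↦ z) contMDiff_id

lemma sub (hX : SmoothNear X x) (hY : SmoothNear Y x) : SmoothNear (fun z ↦ X z - Y z) x :=
  SmoothAlongNear.sub (ι := fun z : N ↦ z) contMDiff_id hX hY

lemma smul {c : N → ℝ} (hc : SmoothFnNear F c x) (hX : SmoothNear X x) :
    SmoothNear (fun z ↦ c z • X z) x :=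
  SmoothAlongNear.smul (ι := fun z : N ↦ z) contMDiff_id hc hX

lemma sum {κ : Type*} (s : Finset κ) {X : κ → ∀ z : N, TangentSpace 𝓘(ℝ, F) z}
    (hX : ∀ k ∈ s, SmoothNear (X k) x) : SmoothNear (fun z ↦ ∑ k ∈ s, X k z) x :=
  SmoothAlongNear.sum (ι := fun z : N ↦ z) contMDiff_id s hX

lemma smoothFnNear_frameCoeff {y : N} (hX : SmoothNear X x) (hx : x ∈ frameDomain F y)
    (i : Fin (Module.finrank ℝ F)) : SmoothFnNear F (fun z ↦ frameCoeff y i z (X z)) x :=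
  SmoothAlongNear.smoothFnNear_frameCoeff (ι := fun z : N ↦ z) contMDiff_id hX hx i

end SmoothNear

end VectorFields

section Pullback

variable {E : Type*} [NormedAddCommGroup E] [NormedSpace ℝ E]
  {M : Type*} [TopologicalSpace M] [ChartedSpace E M]
  {F : Type*} [NormedAddCommGroup F] [NormedSpace ℝ F]
  {N : Type*} [TopologicalSpace N] [ChartedSpace F N]
  {ι : M → N} {p : M}

lemma SmoothFnNear.comp (hι : ContMDiff 𝓘(ℝ, E) 𝓘(ℝ, F) ∞ ι) {c : N → ℝ}
    (hc : SmoothFnNear F c (ι p)) : SmoothFnNear E (fun q ↦ c (ι q)) p := by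
  filter_upwards [hι.continuous.continuousAt.eventually hc] with q hq using
    ContMDiffAt.comp q hq (hι q)

lemma SmoothFnNear.mvfderiv_comp (hι : ContMDiff 𝓘(ℝ, E) 𝓘(ℝ, F) ∞ ι) {c : N → ℝ}
    (hc : SmoothFnNear F c (ι p)) (v : TangentSpace 𝓘(ℝ, E) p) :
    _root_.mvfderiv 𝓘(ℝ, E) (fun q ↦ c (ι q)) p v
      = _root_.mvfderiv 𝓘(ℝ, F) c (ι p) (mfderiv 𝓘(ℝ, E) 𝓘(ℝ, F) ι p v) :=
  mvfderiv_comp_apply p hc.mdifferentiableAt ((hι p).mdifferentiableAt (by simp)) v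

lemma SmoothNear.comp [IsManifold 𝓘(ℝ, F) ∞ N] (hι : ContMDiff 𝓘(ℝ, E) 𝓘(ℝ, F) ∞ ι)
    {Z : ∀ x : N, TangentSpace 𝓘(ℝ, F) x} (hZ : SmoothNear Z (ι p)) :
    SmoothAlongNear (E := E) ι (fun q ↦ Z (ι q)) p := by
  filter_upwards [hι.continuous.continuousAt.eventually hZ] with q hq using
    ContMDiffAt.comp q hq (hι q)

variable [IsManifold 𝓘(ℝ, E) ∞ M] {X : ∀ q : M, TangentSpace 𝓘(ℝ, E) q}

lemma SmoothFnNear.mvfderiv {c : M → ℝ} (hc : SmoothFnNear E c p) (hX : SmoothNear X p) :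
    SmoothFnNear E (fun q ↦ mvfderiv 𝓘(ℝ, E) c q (X q)) p := by
  obtain ⟨U, hU, hUo, hpU⟩ := eventually_nhds_iff.1 hc
  have hcU : ContMDiffOn 𝓘(ℝ, E) 𝓘(ℝ, ℝ) ∞ c U := fun z hz ↦ (hU z hz).contMDiffWithinAt
  filter_upwards [hX, hUo.mem_nhds hpU] with q hXq hq
  have hopen : IsOpen ((TotalSpace.proj : TangentBundle 𝓘(ℝ, E) M → M) ⁻¹' U) :=
    hUo.preimage (FiberBundle.continuous_proj E (fun x : M ↦ TangentSpace 𝓘(ℝ, E) x))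
  have htangent : ContMDiffAt 𝓘(ℝ, E).tangent 𝓘(ℝ, ℝ).tangent ∞
      (tangentMap 𝓘(ℝ, E) 𝓘(ℝ, ℝ) c) (⟨q, X q⟩ : TangentBundle 𝓘(ℝ, E) M) := by
    refine ((hcU.contMDiffOn_tangentMapWithin (m := ∞) (by simp)
      hUo.uniqueMDiffOn).contMDiffAt (hopen.mem_nhds hq)).congr_of_eventuallyEq ?_
    filter_upwards [hopen.mem_nhds (x := (⟨q, X q⟩ : TangentBundle 𝓘(ℝ, E) M)) hq] with z hz
    exact (tangentMapWithin_eq_tangentMap (hUo.uniqueMDiffOn _ hz)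
      ((hU _ hz).mdifferentiableAt (by simp))).symm
  refine (contMDiffAt_totalSpace.1 (htangent.comp q hXq)).2.congr_of_eventuallyEq
    (.of_forall fun z ↦ ?_)
  simp only [Function.comp_apply, tangentMap, trivializationAt_model_space_apply]
  rfl

variable [IsManifold 𝓘(ℝ, F) ∞ N]

lemma SmoothNear.push (hι : ContMDiff 𝓘(ℝ, E) 𝓘(ℝ, F) ∞ ι) (hX : SmoothNear X p) :
    SmoothAlongNear (E := E) (F := F) ι (push ι X) p := by
  filter_upwards [hX] with q hq
  have htangent := (hι.contMDiff_tangentMap (m := ∞) (by simp)).contMDiffAt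
    (x := (⟨q, X q⟩ : TangentBundle 𝓘(ℝ, E) M))
  exact htangent.comp q hq

end Pullback

section CovariantDerivative

variable {F : Type*} [NormedAddCommGroup F] [NormedSpace ℝ F]
  {N : Type*} [TopologicalSpace N] [ChartedSpace F N] [IsManifold 𝓘(ℝ, F) ∞ N]
  (cov : CovariantDerivative 𝓘(ℝ, F) F (fun x : N ↦ TangentSpace 𝓘(ℝ, F) x))
  {x y : N} {Y Z : ∀ z : N, TangentSpace 𝓘(ℝ, F) z}

lemma cov_add (hY : SmoothNear Y x) (hZ : SmoothNear Z x) :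
    cov (fun z ↦ Y z + Z z) x = cov Y x + cov Z x :=
  cov.isCovariantDerivativeOn.add hY.mdifferentiableAt hZ.mdifferentiableAt

lemma cov_smul {c : N → ℝ} (hc : SmoothFnNear F c x) (hY : SmoothNear Y x)
    (v : TangentSpace 𝓘(ℝ, F) x) :
    cov (fun z ↦ c z • Y z) x v = mvfderiv 𝓘(ℝ, F) c x v • Y x + c x • cov Y x v :=
  congr($(cov.isCovariantDerivativeOn.leibniz (s := Set.univ) hY.mdifferentiableAt
    hc.mdifferentiableAt) v).trans (add_comm _ _)

lemma cov_congr (hY : SmoothNear Y x) (h : ∀ᶠ z in 𝓝 x, Z z = Y z) : cov Z x = cov Y x :=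
  cov.isCovariantDerivativeOn.congr_of_eventuallyEq (s := Set.univ)
    (hY.congr h).mdifferentiableAt hY.mdifferentiableAt Filter.univ_mem h

variable [FiniteDimensional ℝ F]

lemma cov_sum {κ : Type*} (s : Finset κ) {Y : κ → ∀ z : N, TangentSpace 𝓘(ℝ, F) z}
    (hY : ∀ k ∈ s, SmoothNear (Y k) x) :
    cov (fun z ↦ ∑ k ∈ s, Y k z) x = ∑ k ∈ s, cov (Y k) x := by
  classical
  induction s using Finset.induction_on with
  | empty =>
    simp only [Finset.sum_empty]
    exact congr($(cov.zero) x)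
  | insert a s ha ih =>
    have hs : ∀ k ∈ s, SmoothNear (Y k) x := fun k hk ↦ hY k (Finset.mem_insert_of_mem hk)
    simp only [Finset.sum_insert ha]
    rw [← ih hs]
    exact cov_add cov (hY a (Finset.mem_insert_self a s)) (.sum s hs)

lemma cov_eq_sum (hY : SmoothNear Y x) (hx : x ∈ frameDomain F y) (v : TangentSpace 𝓘(ℝ, F) x) :
    cov Y x v = ∑ i, (mvfderiv 𝓘(ℝ, F) (fun z ↦ frameCoeff y i z (Y z)) x v • frame y i x +
      frameCoeff y i x (Y x) • cov (frame y i) x v) := by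
  have hframe := smoothNear_frame hx
  have hcoeff := hY.smoothFnNear_frameCoeff hx
  rw [← cov_congr cov (Z := fun z ↦ ∑ i, frameCoeff y i z (Y z) • frame y i z) hY
      (Filter.mem_of_superset (frameDomain_mem_nhds hx) fun z hz ↦ sum_frameCoeff_smul_frame hz _),
    cov_sum cov _ fun i _ ↦ (hframe i).smul (hcoeff i), sum_apply]
  exact Finset.sum_congr rfl fun i _ ↦ cov_smul cov (hcoeff i) (hframe i) v

lemma cov_extend (w v : TangentSpace 𝓘(ℝ, F) x) :
    cov (FiberBundle.extend F w) x v = ∑ i, frameCoeff x i x w • cov (frame x i) x v := by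
  rw [cov_eq_sum cov (smoothNear_extend w) (mem_frameDomain x)]
  refine Finset.sum_congr rfl fun i _ ↦ ?_
  have hconst : ∀ᶠ z in 𝓝 x, frameCoeff x i z (FiberBundle.extend F w z) = frameCoeff x i x w :=
    Filter.mem_of_superset (frameDomain_mem_nhds (mem_frameDomain x)) fun z hz ↦
      frameCoeff_extend hz w
  rw [mvfderiv_congr hconst, mvfderiv_const]
  simp

end CovariantDerivative

section CovariantDerivativeAlong

variable {E : Type*} [NormedAddCommGroup E] [NormedSpace ℝ E]
  {M : Type*} [TopologicalSpace M] [ChartedSpace E M]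
  {F : Type*} [NormedAddCommGroup F] [NormedSpace ℝ F]
  {N : Type*} [TopologicalSpace N] [ChartedSpace F N] [IsManifold 𝓘(ℝ, F) ∞ N]
  (cov : CovariantDerivative 𝓘(ℝ, F) F (fun x : N ↦ TangentSpace 𝓘(ℝ, F) x))
  {ι : M → N} {V W : ∀ q : M, TangentSpace 𝓘(ℝ, F) (ι q)} {p : M} {y : N}

lemma covAlong_congr (h : ∀ᶠ q in 𝓝 p, W q = V q) (v : TangentSpace 𝓘(ℝ, E) p) :
    covAlong cov ι W p v = covAlong cov ι V p v := by
  have hcoord : (fun q ↦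
        (trivializationAt F (fun x : N ↦ TangentSpace 𝓘(ℝ, F) x) (ι p) ⟨ι q, W q⟩).2)
      =ᶠ[𝓝 p] fun q ↦
        (trivializationAt F (fun x : N ↦ TangentSpace 𝓘(ℝ, F) x) (ι p) ⟨ι q, V q⟩).2 := by
    filter_upwards [h] with q hq
    rw [hq]
  simp only [covAlong, hcoord.mfderiv_eq, h.self_of_nhds]
  rfl

variable [FiniteDimensional ℝ F]

lemma repr_mfderiv_trivializationAt (hι : ContMDiff 𝓘(ℝ, E) 𝓘(ℝ, F) ∞ ι)
    (hV : SmoothAlongNear (E := E) ι V p) (v : TangentSpace 𝓘(ℝ, E) p)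
    (i : Fin (Module.finrank ℝ F)) :
    (Module.finBasis ℝ F).repr (mfderiv 𝓘(ℝ, E) 𝓘(ℝ, F) (fun q ↦
        (trivializationAt F (fun x : N ↦ TangentSpace 𝓘(ℝ, F) x) (ι p) ⟨ι q, V q⟩).2) p v) i
      = mvfderiv 𝓘(ℝ, E) (fun q ↦ frameCoeff (ι p) i (ι q) (V q)) p v := by
  set c : M → F := fun q ↦
    (trivializationAt F (fun x : N ↦ TangentSpace 𝓘(ℝ, F) x) (ι p) ⟨ι q, V q⟩).2
  have hc : MDifferentiableAt 𝓘(ℝ, E) 𝓘(ℝ, F) c p :=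
    (contMDiffAt_totalSpace.1 hV.contMDiffAt).2.mdifferentiableAt (by simp)
  let L : F →L[ℝ] ℝ := ((Module.finBasis ℝ F).coord i).toContinuousLinearMap
  have hcoeff : ∀ᶠ q in 𝓝 p, frameCoeff (ι p) i (ι q) (V q) = L (c q) :=
    (eventually_mem_frameDomain hι (mem_frameDomain (ι p))).mono fun q hq ↦ frameCoeff_eq hq _
  have hLc : HasMFDerivAt 𝓘(ℝ, E) 𝓘(ℝ, ℝ) (fun q ↦ L (c q)) p
      (L.comp (mfderiv 𝓘(ℝ, E) 𝓘(ℝ, F) c p)) :=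
    HasMFDerivAt.comp p L.hasMFDerivAt hc.hasMFDerivAt
  rw [mvfderiv_congr hcoeff, mvfderiv, hLc.mfderiv]
  rfl

lemma covAlong_eq_sum (hι : ContMDiff 𝓘(ℝ, E) 𝓘(ℝ, F) ∞ ι) (hV : SmoothAlongNear (E := E) ι V p)
    (v : TangentSpace 𝓘(ℝ, E) p) :
    covAlong cov ι V p v = ∑ i,
      (mvfderiv 𝓘(ℝ, E) (fun q ↦ frameCoeff (ι p) i (ι q) (V q)) p v • frame (ι p) i (ι p) +
        frameCoeff (ι p) i (ι p) (V p) •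
          cov (frame (ι p) i) (ι p) (mfderiv 𝓘(ℝ, E) 𝓘(ℝ, F) ι p v)) := by
  rw [Finset.sum_add_distrib, ← cov_extend]
  simp_rw [← repr_mfderiv_trivializationAt hι hV]
  exact congr($(symm_eq_sum_frame (mem_frameDomain (ι p)) _) + _)

lemma covAlong_add (hι : ContMDiff 𝓘(ℝ, E) 𝓘(ℝ, F) ∞ ι) (hV : SmoothAlongNear (E := E) ι V p)
    (hW : SmoothAlongNear (E := E) ι W p) (v : TangentSpace 𝓘(ℝ, E) p) :
    covAlong cov ι (fun q ↦ V q + W q) p v = covAlong cov ι V p v + covAlong cov ι W p v := by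
  rw [covAlong_eq_sum cov hι hV, covAlong_eq_sum cov hι hW, covAlong_eq_sum cov hι (hV.add hι hW),
    ← Finset.sum_add_distrib]
  refine Finset.sum_congr rfl fun i _ ↦ ?_
  simp only [map_add]
  rw [(hV.smoothFnNear_frameCoeff hι (mem_frameDomain _) i).mvfderiv_add
    (hW.smoothFnNear_frameCoeff hι (mem_frameDomain _) i)]
  module

lemma covAlong_smul (hι : ContMDiff 𝓘(ℝ, E) 𝓘(ℝ, F) ∞ ι) {c : M → ℝ} (hc : SmoothFnNear E c p)
    (hV : SmoothAlongNear (E := E) ι V p) (v : TangentSpace 𝓘(ℝ, E) p) :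
    covAlong cov ι (fun q ↦ c q • V q) p v =
      mvfderiv 𝓘(ℝ, E) c p v • V p + c p • covAlong cov ι V p v := by
  conv_rhs => rw [← sum_frameCoeff_smul_frame (mem_frameDomain (ι p)) (V p)]
  rw [covAlong_eq_sum cov hι hV, covAlong_eq_sum cov hι (hV.smul hι hc), Finset.smul_sum,
    Finset.smul_sum, ← Finset.sum_add_distrib]
  refine Finset.sum_congr rfl fun i _ ↦ ?_
  simp only [map_smul, smul_eq_mul]
  rw [hc.mvfderiv_mul (hV.smoothFnNear_frameCoeff hι (mem_frameDomain _) i)]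
  module

lemma covAlong_zero (hι : ContMDiff 𝓘(ℝ, E) 𝓘(ℝ, F) ∞ ι) (v : TangentSpace 𝓘(ℝ, E) p) :
    covAlong cov ι (fun _ ↦ 0) p v = 0 := by
  simpa using covAlong_add cov hι (.zero hι) (.zero hι) v

lemma covAlong_sum (hι : ContMDiff 𝓘(ℝ, E) 𝓘(ℝ, F) ∞ ι) {κ : Type*} (s : Finset κ)
    {V : κ → ∀ q : M, TangentSpace 𝓘(ℝ, F) (ι q)}
    (hV : ∀ k ∈ s, SmoothAlongNear (E := E) ι (V k) p) (v : TangentSpace 𝓘(ℝ, E) p) :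
    covAlong cov ι (fun q ↦ ∑ k ∈ s, V k q) p v = ∑ k ∈ s, covAlong cov ι (V k) p v := by
  classical
  induction s using Finset.induction_on with
  | empty => simpa using covAlong_zero cov hι v
  | insert a s ha ih =>
    have hs : ∀ k ∈ s, SmoothAlongNear (E := E) ι (V k) p :=
      fun k hk ↦ hV k (Finset.mem_insert_of_mem hk)
    simp only [Finset.sum_insert ha]
    rw [← ih hs]
    exact covAlong_add cov hι (hV a (Finset.mem_insert_self a s)) (.sum hι s hs) v

lemma covAlong_vec_add (hι : ContMDiff 𝓘(ℝ, E) 𝓘(ℝ, F) ∞ ι) (hV : SmoothAlongNear (E := E) ι V p)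
    (v w : TangentSpace 𝓘(ℝ, E) p) :
    covAlong cov ι V p (v + w) = covAlong cov ι V p v + covAlong cov ι V p w := by
  simp only [covAlong_eq_sum cov hι hV, ← Finset.sum_add_distrib, map_add]
  exact Finset.sum_congr rfl fun i _ ↦ by module

lemma covAlong_vec_smul (hι : ContMDiff 𝓘(ℝ, E) 𝓘(ℝ, F) ∞ ι)
    (hV : SmoothAlongNear (E := E) ι V p) (c : ℝ) (v : TangentSpace 𝓘(ℝ, E) p) :
    covAlong cov ι V p (c • v) = c • covAlong cov ι V p v := by
  simp only [covAlong_eq_sum cov hι hV, Finset.smul_sum, map_smul, smul_eq_mul]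
  exact Finset.sum_congr rfl fun i _ ↦ by module

lemma covAlong_comp (hι : ContMDiff 𝓘(ℝ, E) 𝓘(ℝ, F) ∞ ι) {Y : ∀ x : N, TangentSpace 𝓘(ℝ, F) x}
    (hY : SmoothNear Y (ι p)) (v : TangentSpace 𝓘(ℝ, E) p) :
    covAlong cov ι (fun q ↦ Y (ι q)) p v = cov Y (ι p) (mfderiv 𝓘(ℝ, E) 𝓘(ℝ, F) ι p v) := by
  rw [covAlong_eq_sum cov hι (hY.comp hι), cov_eq_sum cov hY (mem_frameDomain _)]
  refine Finset.sum_congr rfl fun i _ ↦ ?_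
  rw [(hY.smoothFnNear_frameCoeff (mem_frameDomain _) i).mvfderiv_comp hι]

lemma covAlong_eq_sum_frame (hι : ContMDiff 𝓘(ℝ, E) 𝓘(ℝ, F) ∞ ι)
    (hV : SmoothAlongNear (E := E) ι V p) (hy : ι p ∈ frameDomain F y)
    (v : TangentSpace 𝓘(ℝ, E) p) :
    covAlong cov ι V p v = ∑ i,
      (mvfderiv 𝓘(ℝ, E) (fun q ↦ frameCoeff y i (ι q) (V q)) p v • frame y i (ι p) +
        frameCoeff y i (ι p) (V p) •
          cov (frame y i) (ι p) (mfderiv 𝓘(ℝ, E) 𝓘(ℝ, F) ι p v)) := by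
  have hcoeff := hV.smoothFnNear_frameCoeff hι hy
  have hframe := smoothNear_frame hy
  rw [covAlong_congr cov (W := V) (V := fun q ↦ ∑ i, frameCoeff y i (ι q) (V q) • frame y i (ι q))
      ((eventually_mem_frameDomain hι hy).mono fun q hq ↦ (sum_frameCoeff_smul_frame hq _).symm),
    covAlong_sum cov hι _ fun i _ ↦ ((hframe i).comp hι).smul hι (hcoeff i)]
  refine Finset.sum_congr rfl fun i _ ↦ ?_
  rw [covAlong_smul cov hι (hcoeff i) ((hframe i).comp hι), covAlong_comp cov hι (hframe i)]

lemma covAlong_id {Y : ∀ x : N, TangentSpace 𝓘(ℝ, F) x} {x : N}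
    (hY : SmoothNear Y x) (v : TangentSpace 𝓘(ℝ, F) x) :
    covAlong cov (fun z : N ↦ z) Y x v = cov Y x v := by
  rw [covAlong_comp cov (ι := fun z : N ↦ z) contMDiff_id hY]
  exact congr(cov Y x ($(mfderiv_id) v))

end CovariantDerivativeAlong

section LieBracket

variable {E : Type*} [NormedAddCommGroup E] [NormedSpace ℝ E]
  {M : Type*} [TopologicalSpace M] [ChartedSpace E M] [IsManifold 𝓘(ℝ, E) ∞ M]
  {p : M} {f : M → ℝ} {X Y W : ∀ q : M, TangentSpace 𝓘(ℝ, E) q}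

lemma isManifold_minSmoothness {n : WithTop ℕ∞} (hn : n ≤ ∞) :
    IsManifold 𝓘(ℝ, E) (minSmoothness ℝ n) M :=
  .of_le (minSmoothness_of_isRCLikeNormedField.trans_le hn)

variable [FiniteDimensional ℝ E]

lemma SmoothNear.mlieBracket (hX : SmoothNear X p) (hY : SmoothNear Y p) :
    SmoothNear (VectorField.mlieBracket 𝓘(ℝ, E) X Y) p := by
  have : IsManifold 𝓘(ℝ, E) (minSmoothness ℝ 2) M := isManifold_minSmoothness ENat.LEInfty.out
  have : IsManifold 𝓘(ℝ, E) (((⊤ : ℕ∞) : WithTop ℕ∞) + 1) M := inferInstanceAs (IsManifold _ ∞ M)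
  filter_upwards [hX, hY] with q hXq hYq
  exact ContMDiffAt.mlieBracket_vectorField (m := ⊤) (n := ⊤) hXq hYq (by simp)

lemma mlieBracket_smul_of_smoothNear (hf : SmoothFnNear E f p) (hW : SmoothNear W p) :
    VectorField.mlieBracket 𝓘(ℝ, E) X (fun q ↦ f q • W q) p =
      mvfderiv 𝓘(ℝ, E) f p (X p) • W p + f p • VectorField.mlieBracket 𝓘(ℝ, E) X W p :=
  VectorField.mlieBracket_smul_right hf.mdifferentiableAt hW.mdifferentiableAt

lemma mlieBracket_mlieBracket_smul (hf : SmoothFnNear E f p) (hY : SmoothNear Y p)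
    (hW : SmoothNear W p) :
    VectorField.mlieBracket 𝓘(ℝ, E) X
        (VectorField.mlieBracket 𝓘(ℝ, E) Y (fun q ↦ f q • W q)) p =
      mvfderiv 𝓘(ℝ, E) (fun q ↦ mvfderiv 𝓘(ℝ, E) f q (Y q)) p (X p) • W p
        + mvfderiv 𝓘(ℝ, E) f p (Y p) • VectorField.mlieBracket 𝓘(ℝ, E) X W p
        + (mvfderiv 𝓘(ℝ, E) f p (X p) • VectorField.mlieBracket 𝓘(ℝ, E) Y W p
          + f p • VectorField.mlieBracket 𝓘(ℝ, E) X (VectorField.mlieBracket 𝓘(ℝ, E) Y W) p) := by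
  have hinner : VectorField.mlieBracket 𝓘(ℝ, E) Y (fun q ↦ f q • W q) =ᶠ[𝓝 p]
      (fun q ↦ mvfderiv 𝓘(ℝ, E) f q (Y q) • W q)
        + fun q ↦ f q • VectorField.mlieBracket 𝓘(ℝ, E) Y W q := by
    filter_upwards [hf.eventually, hW.eventually] with q hfq hWq using
      mlieBracket_smul_of_smoothNear hfq hWq
  have hYW := hY.mlieBracket hW
  rw [Filter.EventuallyEq.mlieBracket_vectorField_eq (V := X) .rfl hinner,
    VectorField.mlieBracket_add_right (hW.smul (hf.mvfderiv hY)).mdifferentiableAt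
      (hYW.smul hf).mdifferentiableAt,
    mlieBracket_smul_of_smoothNear (hf.mvfderiv hY) hW, mlieBracket_smul_of_smoothNear hf hYW]

-- Compare the Jacobi identity for `X`, `Y`, `f • W` with the one for `X`, `Y`, `W`, where
-- `W p ≠ 0`.
lemma SmoothFnNear.mvfderiv_mlieBracket (hf : SmoothFnNear E f p) (hX : SmoothNear X p)
    (hY : SmoothNear Y p) :
    _root_.mvfderiv 𝓘(ℝ, E) f p (VectorField.mlieBracket 𝓘(ℝ, E) X Y p) =
      _root_.mvfderiv 𝓘(ℝ, E) (fun q ↦ _root_.mvfderiv 𝓘(ℝ, E) f q (Y q)) p (X p) -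
        _root_.mvfderiv 𝓘(ℝ, E) (fun q ↦ _root_.mvfderiv 𝓘(ℝ, E) f q (X q)) p (Y p) := by
  have : IsManifold 𝓘(ℝ, E) (minSmoothness ℝ 3) M := isManifold_minSmoothness ENat.LEInfty.out
  have htwo : minSmoothness ℝ 2 ≤ (∞ : WithTop ℕ∞) :=
    minSmoothness_of_isRCLikeNormedField.trans_le ENat.LEInfty.out
  have jacobi {W : ∀ q : M, TangentSpace 𝓘(ℝ, E) q} (hW : SmoothNear W p) :=
    VectorField.leibniz_identity_mlieBracket_apply (hX.contMDiffAt.of_le htwo)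
      (hY.contMDiffAt.of_le htwo) (hW.contMDiffAt.of_le htwo)
  rcases subsingleton_or_nontrivial (TangentSpace 𝓘(ℝ, E) p) with _ | _
  · simp [Subsingleton.elim _ (0 : TangentSpace 𝓘(ℝ, E) p)]
  · obtain ⟨w, hw⟩ := exists_ne (0 : TangentSpace 𝓘(ℝ, E) p)
    set W := FiberBundle.extend E w
    have hW : SmoothNear W p := smoothNear_extend w
    have hjacobi := jacobi (hW.smul hf)
    rw [mlieBracket_mlieBracket_smul hf hY hW, mlieBracket_mlieBracket_smul hf hX hW,
      mlieBracket_smul_of_smoothNear hf hW, jacobi hW] at hjacobi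
    have hsmul : (_root_.mvfderiv 𝓘(ℝ, E) f p (VectorField.mlieBracket 𝓘(ℝ, E) X Y p) -
        (_root_.mvfderiv 𝓘(ℝ, E) (fun q ↦ _root_.mvfderiv 𝓘(ℝ, E) f q (Y q)) p (X p) -
          _root_.mvfderiv 𝓘(ℝ, E) (fun q ↦ _root_.mvfderiv 𝓘(ℝ, E) f q (X q)) p (Y p))) •
        W p = 0 := by
      rw [← sub_eq_zero] at hjacobi
      rw [← neg_eq_zero, ← hjacobi]
      module
    exact sub_eq_zero.1 ((smul_eq_zero.1 hsmul).resolve_right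
      ((FiberBundle.extend_apply_self (F := E) w).trans_ne hw))

end LieBracket

section SmoothConnection

variable {F : Type*} [NormedAddCommGroup F] [NormedSpace ℝ F] [FiniteDimensional ℝ F]
  {N : Type*} [TopologicalSpace N] [T2Space N] [ChartedSpace F N] [IsManifold 𝓘(ℝ, F) ∞ N]
  {cov : CovariantDerivative 𝓘(ℝ, F) F (fun x : N ↦ TangentSpace 𝓘(ℝ, F) x)}

-- Smoothness of `cov` is a statement about globally smooth fields, so `Y` is multiplied by a bump
-- function.
lemma SmoothNear.cov_apply (hcov : cov.ContMDiffCovariantDerivative ∞) {x : N}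
    {X Y : ∀ z : N, TangentSpace 𝓘(ℝ, F) z} (hY : SmoothNear Y x) (hX : SmoothNear X x) :
    SmoothNear (fun z ↦ cov Y z (X z)) x := by
  obtain ⟨U, hU, hUo, hxU⟩ := eventually_nhds_iff.1 hY
  obtain ⟨ρ, -, hρ⟩ := (SmoothBumpFunction.nhds_basis_tsupport (I := 𝓘(ℝ, F)) x).mem_iff.1
    (hUo.mem_nhds hxU)
  have hYU : ContMDiffOn 𝓘(ℝ, F) (𝓘(ℝ, F).prod 𝓘(ℝ, F)) ∞
      (fun z ↦ (⟨z, Y z⟩ : TangentBundle 𝓘(ℝ, F) N)) U := fun z hz ↦ (hU z hz).contMDiffWithinAt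
  have hρY : ContMDiff 𝓘(ℝ, F) (𝓘(ℝ, F).prod 𝓘(ℝ, F)) ∞
      (fun z ↦ (⟨z, ρ z • Y z⟩ : TangentBundle 𝓘(ℝ, F) N)) :=
    ContMDiffOn.smul_section_of_tsupport (ρ.contMDiff.contMDiffOn) hUo hρ hYU
  have hcovρY := hcov.contMDiff.contMDiff (σ := fun z ↦ ρ z • Y z)
    (hρY.contMDiffOn (s := Set.univ))
  have hsmooth : SmoothNear (fun z ↦ cov (fun w ↦ ρ w • Y w) z (X z)) x := by
    filter_upwards [hX] with z hXz
    exact ContMDiffAt.clm_bundle_apply (hcovρY.contMDiffAt Filter.univ_mem) hXz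
  refine hsmooth.congr ?_
  filter_upwards [eventually_eventually_nhds.2 ρ.eventuallyEq_one, hY.eventually] with z hz hYz
  have hρz : ∀ᶠ w in 𝓝 z, ρ w • Y w = Y w := hz.mono fun w hw ↦ by simp [hw]
  rw [cov_congr cov hYz hρz]

variable {E : Type*} [NormedAddCommGroup E] [NormedSpace ℝ E]
  {M : Type*} [TopologicalSpace M] [ChartedSpace E M] [IsManifold 𝓘(ℝ, E) ∞ M]
  {ι : M → N} {p : M} {X : ∀ q : M, TangentSpace 𝓘(ℝ, E) q}

lemma smoothAlongNear_cov_push (hcov : cov.ContMDiffCovariantDerivative ∞)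
    (hι : ContMDiff 𝓘(ℝ, E) 𝓘(ℝ, F) ∞ ι) (hX : SmoothNear X p)
    {Y : ∀ x : N, TangentSpace 𝓘(ℝ, F) x} (hY : SmoothNear Y (ι p)) :
    SmoothAlongNear (E := E) ι (fun q ↦ cov Y (ι q) (push ι X q)) p := by
  have hdom := mem_frameDomain (F := F) (ι p)
  refine SmoothAlongNear.congr (.sum hι Finset.univ fun i _ ↦
    .smul hι ((hX.push hι).smoothFnNear_frameCoeff hι hdom i)
      ((hY.cov_apply hcov (smoothNear_frame hdom i)).comp hι)) ?_
  filter_upwards [eventually_mem_frameDomain hι hdom] with q hq using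
    map_eq_sum_frame hq _ _

lemma SmoothAlongNear.covAlong (hcov : cov.ContMDiffCovariantDerivative ∞)
    (hι : ContMDiff 𝓘(ℝ, E) 𝓘(ℝ, F) ∞ ι) (hX : SmoothNear X p)
    {V : ∀ q : M, TangentSpace 𝓘(ℝ, F) (ι q)} (hV : SmoothAlongNear (E := E) ι V p) :
    SmoothAlongNear (E := E) ι (fun q ↦ covAlong cov ι V q (X q)) p := by
  have hdom := mem_frameDomain (F := F) (ι p)
  have hframe := smoothNear_frame hdom
  have hcoeff := hV.smoothFnNear_frameCoeff hι hdom
  refine SmoothAlongNear.congr (.sum hι Finset.univ fun i _ ↦ .add hι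
    (.smul hι ((hcoeff i).mvfderiv hX) ((hframe i).comp hι))
    (.smul hι (hcoeff i) (smoothAlongNear_cov_push hcov hι hX (hframe i)))) ?_
  filter_upwards [eventually_mem_frameDomain hι hdom, hV.eventually] with q hq hVq
  exact covAlong_eq_sum_frame cov hι hVq hq (X q)

end SmoothConnection

section CoordinateFields

variable {F : Type*} [NormedAddCommGroup F] [NormedSpace ℝ F] [FiniteDimensional ℝ F]
  {N : Type*} [TopologicalSpace N] [ChartedSpace F N] {x y : N}

/-- The `i`-th coordinate function of the preferred chart around `y`. -/
def chartCoord (y : N) (i : Fin (Module.finrank ℝ F)) (x : N) : ℝ :=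
  (Module.finBasis ℝ F).coord i (extChartAt 𝓘(ℝ, F) y x)

variable [IsManifold 𝓘(ℝ, F) ∞ N]

lemma smoothFnNear_chartCoord (hx : x ∈ frameDomain F y) (i : Fin (Module.finrank ℝ F)) :
    SmoothFnNear F (chartCoord y i) x := by
  filter_upwards [frameDomain_mem_nhds hx] with z hz
  exact (((Module.finBasis ℝ F).coord i).toContinuousLinearMap.contDiff
    (n := ∞)).contMDiff.contMDiffAt.comp z (contMDiffAt_extChartAt' hz)

lemma frameCoeff_eq_mvfderiv (hx : x ∈ frameDomain F y) (i : Fin (Module.finrank ℝ F))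
    (v : TangentSpace 𝓘(ℝ, F) x) :
    frameCoeff y i x v = mvfderiv 𝓘(ℝ, F) (chartCoord y i) x v := by
  have hsource : x ∈ (chartAt F y).source := hx
  set e := trivializationAt F (fun x : N ↦ TangentSpace 𝓘(ℝ, F) x) y
  have hchart : HasMFDerivAt 𝓘(ℝ, F) 𝓘(ℝ, F) (extChartAt 𝓘(ℝ, F) y) x _ :=
    (mdifferentiableAt_extChartAt hsource).hasMFDerivAt
  have hcoord : HasMFDerivAt 𝓘(ℝ, F) 𝓘(ℝ, ℝ) (chartCoord y i) x _ :=
    ((Module.finBasis ℝ F).coord i).toContinuousLinearMap.hasMFDerivAt.comp x hchart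
  have he : e.continuousLinearMapAt ℝ x v = (e ⟨x, v⟩).2 :=
    congr($(e.coe_linearMapAt_of_mem (R := ℝ) hx) v)
  rw [frameCoeff_eq hx, ← he]
  unfold mvfderiv
  rw [hcoord.mfderiv, ← TangentBundle.continuousLinearMapAt_trivializationAt hsource]
  rfl

lemma mlieBracket_eq_zero_of_frameCoeff (hx : x ∈ frameDomain F y)
    {X Y : ∀ z : N, TangentSpace 𝓘(ℝ, F) z} (hX : SmoothNear X x) (hY : SmoothNear Y x)
    {a b : Fin (Module.finrank ℝ F) → ℝ} (ha : ∀ᶠ z in 𝓝 x, ∀ i, frameCoeff y i z (X z) = a i)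
    (hb : ∀ᶠ z in 𝓝 x, ∀ i, frameCoeff y i z (Y z) = b i) :
    VectorField.mlieBracket 𝓘(ℝ, F) X Y x = 0 := by
  have hderiv {Z : ∀ z : N, TangentSpace 𝓘(ℝ, F) z} {c : Fin (Module.finrank ℝ F) → ℝ}
      (hc : ∀ᶠ z in 𝓝 x, ∀ i, frameCoeff y i z (Z z) = c i) (i : Fin (Module.finrank ℝ F))
      (v : TangentSpace 𝓘(ℝ, F) x) :
      mvfderiv 𝓘(ℝ, F) (fun z ↦ mvfderiv 𝓘(ℝ, F) (chartCoord y i) z (Z z)) x v = 0 := by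
    rw [mvfderiv_congr (d := fun _ ↦ c i), mvfderiv_const]
    · rfl
    · filter_upwards [hc, frameDomain_mem_nhds hx] with z hz hzy
      rw [← frameCoeff_eq_mvfderiv hzy, hz i]
  refine frameCoeff_ext hx fun i ↦ ?_
  rw [frameCoeff_eq_mvfderiv hx, (smoothFnNear_chartCoord hx i).mvfderiv_mlieBracket hX hY,
    hderiv ha, hderiv hb, sub_zero, map_zero]

lemma smoothNear_extend_of_mem (hx : x ∈ frameDomain F y) (v : TangentSpace 𝓘(ℝ, F) y) :
    SmoothNear (FiberBundle.extend F v) x :=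
  (SmoothNear.sum _ fun i _ ↦ .smul (.const _) (smoothNear_frame hx i)).congr <| by
    filter_upwards [frameDomain_mem_nhds hx] with z hz using extend_eq_sum_frame hz v

lemma mlieBracket_extend (hx : x ∈ frameDomain F y) (v w : TangentSpace 𝓘(ℝ, F) y) :
    VectorField.mlieBracket 𝓘(ℝ, F) (FiberBundle.extend F v) (FiberBundle.extend F w) x = 0 :=
  mlieBracket_eq_zero_of_frameCoeff hx (smoothNear_extend_of_mem hx v)
    (smoothNear_extend_of_mem hx w)
    (Filter.mem_of_superset (frameDomain_mem_nhds hx) fun _ hz _ ↦ frameCoeff_extend hz v)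
    (Filter.mem_of_superset (frameDomain_mem_nhds hx) fun _ hz _ ↦ frameCoeff_extend hz w)

lemma mlieBracket_frame (hx : x ∈ frameDomain F y) (i j : Fin (Module.finrank ℝ F)) :
    VectorField.mlieBracket 𝓘(ℝ, F) (frame y i) (frame y j) x = 0 :=
  mlieBracket_eq_zero_of_frameCoeff hx (smoothNear_frame hx i) (smoothNear_frame hx j)
    (Filter.mem_of_superset (frameDomain_mem_nhds hx) fun _ hz k ↦ frameCoeff_frame hz k i)
    (Filter.mem_of_superset (frameDomain_mem_nhds hx) fun _ hz k ↦ frameCoeff_frame hz k j)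

lemma cov_comm {cov : CovariantDerivative 𝓘(ℝ, F) F (fun x : N ↦ TangentSpace 𝓘(ℝ, F) x)}
    (htorsion : cov.torsion = 0) {X Y : ∀ z : N, TangentSpace 𝓘(ℝ, F) z} (hX : SmoothNear X x)
    (hY : SmoothNear Y x) (hXY : VectorField.mlieBracket 𝓘(ℝ, F) X Y x = 0) :
    cov X x (Y x) = cov Y x (X x) := by
  have hsub := cov.torsion_eq_zero_iff.1 htorsion hX.mdifferentiableAt hY.mdifferentiableAt
  rw [hXY, sub_eq_zero] at hsub
  exact hsub.symm

end CoordinateFields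

section TorsionFree

variable {E : Type*} [NormedAddCommGroup E] [NormedSpace ℝ E] [FiniteDimensional ℝ E]
  {M : Type*} [TopologicalSpace M] [ChartedSpace E M] [IsManifold 𝓘(ℝ, E) ∞ M]
  {F : Type*} [NormedAddCommGroup F] [NormedSpace ℝ F] [FiniteDimensional ℝ F]
  {N : Type*} [TopologicalSpace N] [ChartedSpace F N] [IsManifold 𝓘(ℝ, F) ∞ N]
  {cov : CovariantDerivative 𝓘(ℝ, F) F (fun x : N ↦ TangentSpace 𝓘(ℝ, F) x)}
  {ι : M → N} {p : M} {y : N} {X Y : ∀ q : M, TangentSpace 𝓘(ℝ, E) q}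

lemma frameCoeff_mlieBracket_push (hι : ContMDiff 𝓘(ℝ, E) 𝓘(ℝ, F) ∞ ι) (hX : SmoothNear X p)
    (hY : SmoothNear Y p) (hy : ι p ∈ frameDomain F y) (i : Fin (Module.finrank ℝ F)) :
    frameCoeff y i (ι p)
        (mfderiv 𝓘(ℝ, E) 𝓘(ℝ, F) ι p (VectorField.mlieBracket 𝓘(ℝ, E) X Y p)) =
      mvfderiv 𝓘(ℝ, E) (fun q ↦ frameCoeff y i (ι q) (push ι Y q)) p (X p) -
        mvfderiv 𝓘(ℝ, E) (fun q ↦ frameCoeff y i (ι q) (push ι X q)) p (Y p) := by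
  have hderiv (q) (hq : ι q ∈ frameDomain F y) (v : TangentSpace 𝓘(ℝ, E) q) :
      mvfderiv 𝓘(ℝ, E) (fun q ↦ chartCoord y i (ι q)) q v =
        frameCoeff y i (ι q) (mfderiv 𝓘(ℝ, E) 𝓘(ℝ, F) ι q v) := by
    rw [(smoothFnNear_chartCoord hq i).mvfderiv_comp hι, frameCoeff_eq_mvfderiv hq]
  have hmem := eventually_mem_frameDomain hι hy
  rw [← hderiv p hy, ((smoothFnNear_chartCoord hy i).comp hι).mvfderiv_mlieBracket hX hY]
  congr 1 <;> exact mvfderiv_congr (hmem.mono fun q hq ↦ hderiv q hq _) _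

lemma covAlong_push_sub (htorsion : cov.torsion = 0) (hι : ContMDiff 𝓘(ℝ, E) 𝓘(ℝ, F) ∞ ι)
    (hX : SmoothNear X p) (hY : SmoothNear Y p) :
    covAlong cov ι (push ι Y) p (X p) - covAlong cov ι (push ι X) p (Y p) =
      mfderiv 𝓘(ℝ, E) 𝓘(ℝ, F) ι p (VectorField.mlieBracket 𝓘(ℝ, E) X Y p) := by
  have hdom := mem_frameDomain (F := F) (ι p)
  have hsymm (v w : TangentSpace 𝓘(ℝ, F) (ι p)) :
      ∑ i, frameCoeff (ι p) i (ι p) v • cov (frame (ι p) i) (ι p) w =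
        ∑ i, frameCoeff (ι p) i (ι p) w • cov (frame (ι p) i) (ι p) v := by
    simp_rw [map_eq_sum_frame hdom (cov (frame (ι p) _) (ι p)) v,
      map_eq_sum_frame hdom (cov (frame (ι p) _) (ι p)) w, Finset.smul_sum]
    rw [Finset.sum_comm]
    refine Finset.sum_congr rfl fun i _ ↦ Finset.sum_congr rfl fun j _ ↦ ?_
    rw [cov_comm htorsion (smoothNear_frame hdom i) (smoothNear_frame hdom j)
      (mlieBracket_frame hdom i j), smul_comm]
  rw [covAlong_eq_sum cov hι (hX.push hι), covAlong_eq_sum cov hι (hY.push hι),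
    Finset.sum_add_distrib, Finset.sum_add_distrib]
  change _ + ∑ i, _ • cov (frame (ι p) i) (ι p) (push ι X p) -
    (_ + ∑ i, _ • cov (frame (ι p) i) (ι p) (push ι Y p)) = _
  rw [hsymm (push ι Y p), add_sub_add_right_eq_sub, ← Finset.sum_sub_distrib]
  refine .trans ?_ (sum_frameCoeff_smul_frame hdom _)
  refine Finset.sum_congr rfl fun i _ ↦ ?_
  rw [← sub_smul, frameCoeff_mlieBracket_push hι hX hY hdom]

end TorsionFree

section Generators

variable {E : Type*} [NormedAddCommGroup E] [NormedSpace ℝ E]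
  {M : Type*} [TopologicalSpace M] [ChartedSpace E M]
  {F : Type*} [NormedAddCommGroup F] [NormedSpace ℝ F] [FiniteDimensional ℝ F]
  {N : Type*} [TopologicalSpace N] [ChartedSpace F N] [IsManifold 𝓘(ℝ, F) ∞ N]
  {ι : M → N} {p : M}

lemma SmoothAlongNear.induction (hι : ContMDiff 𝓘(ℝ, E) 𝓘(ℝ, F) ∞ ι)
    {P : ∀ V : ∀ q : M, TangentSpace 𝓘(ℝ, F) (ι q), SmoothAlongNear (E := E) ι V p → Prop}
    (comp : ∀ (Y : ∀ x : N, TangentSpace 𝓘(ℝ, F) x) (hY : SmoothNear Y (ι p)), P _ (hY.comp hι))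
    (smul : ∀ (c : M → ℝ) V (hc : SmoothFnNear E c p) (hV : SmoothAlongNear (E := E) ι V p),
      P V hV → P _ (hV.smul hι hc))
    (add : ∀ V W (hV : SmoothAlongNear (E := E) ι V p) (hW : SmoothAlongNear (E := E) ι W p),
      P V hV → P W hW → P _ (hV.add hι hW))
    (congr : ∀ V W (hV : SmoothAlongNear (E := E) ι V p) (hVW : ∀ᶠ q in 𝓝 p, W q = V q),
      P V hV → P W (hV.congr hVW))
    {V : ∀ q : M, TangentSpace 𝓘(ℝ, F) (ι q)} (hV : SmoothAlongNear (E := E) ι V p) : P V hV := by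
  classical
  have hdom := mem_frameDomain (F := F) (ι p)
  have hframe := smoothNear_frame hdom
  have hcoeff := hV.smoothFnNear_frameCoeff hι hdom
  have hterm (i) := ((hframe i).comp hι).smul hι (hcoeff i)
  have hsum (s : Finset (Fin (Module.finrank ℝ F))) :
      ∃ h, P (fun q ↦ ∑ i ∈ s, frameCoeff (ι p) i (ι q) (V q) • frame (ι p) i (ι q)) h := by
    induction s using Finset.induction_on with
    | empty =>
      simp only [Finset.sum_empty]
      exact ⟨SmoothAlongNear.zero hι, comp (fun _ ↦ 0) .zero⟩
    | insert a s ha ih =>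
      obtain ⟨hs, ih⟩ := ih
      simp only [Finset.sum_insert ha]
      exact ⟨(hterm a).add hι hs, add _ _ (hterm a) hs
        (smul _ _ (hcoeff a) ((hframe a).comp hι) (comp _ (hframe a))) ih⟩
  obtain ⟨_, hexpand⟩ := hsum Finset.univ
  exact congr _ V _ ((eventually_mem_frameDomain hι hdom).mono fun q hq ↦
    (sum_frameCoeff_smul_frame hq _).symm) hexpand

end Generators

section Curvature

variable {E : Type*} [NormedAddCommGroup E] [NormedSpace ℝ E]
  {M : Type*} [TopologicalSpace M] [ChartedSpace E M]
  {F : Type*} [NormedAddCommGroup F] [NormedSpace ℝ F]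
  {N : Type*} [TopologicalSpace N] [ChartedSpace F N] [IsManifold 𝓘(ℝ, F) ∞ N]
  {cov : CovariantDerivative 𝓘(ℝ, F) F (fun x : N ↦ TangentSpace 𝓘(ℝ, F) x)}
  {ι : M → N} {p : M} {X Y : ∀ q : M, TangentSpace 𝓘(ℝ, E) q}
  {V W : ∀ q : M, TangentSpace 𝓘(ℝ, F) (ι q)}

lemma curvature_covAlong_congr (h : ∀ᶠ q in 𝓝 p, W q = V q) :
    curvature (covAlong cov ι) X Y W p = curvature (covAlong cov ι) X Y V p := by
  have hfield (Z : ∀ q : M, TangentSpace 𝓘(ℝ, E) q) :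
      ∀ᶠ q in 𝓝 p, covAlong cov ι W q (Z q) = covAlong cov ι V q (Z q) :=
    (eventually_eventually_nhds.2 h).mono fun q hq ↦ covAlong_congr cov hq _
  unfold curvature
  rw [covAlong_congr cov (hfield Y), covAlong_congr cov (hfield X), covAlong_congr cov h]

variable [FiniteDimensional ℝ F]

lemma curvature_covAlong_zero (hι : ContMDiff 𝓘(ℝ, E) 𝓘(ℝ, F) ∞ ι) :
    curvature (covAlong cov ι) X Y (fun q ↦ (0 : TangentSpace 𝓘(ℝ, F) (ι q))) p = 0 := by
  simp only [curvature, covAlong_zero cov hι, sub_zero]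

variable [IsManifold 𝓘(ℝ, E) ∞ M] [T2Space N]

lemma curvature_covAlong_add (hcov : cov.ContMDiffCovariantDerivative ∞)
    (hι : ContMDiff 𝓘(ℝ, E) 𝓘(ℝ, F) ∞ ι) (hX : SmoothNear X p) (hY : SmoothNear Y p)
    (hV : SmoothAlongNear (E := E) ι V p) (hW : SmoothAlongNear (E := E) ι W p) :
    curvature (covAlong cov ι) X Y (fun q ↦ V q + W q) p =
      curvature (covAlong cov ι) X Y V p + curvature (covAlong cov ι) X Y W p := by
  have hsecond {Z : ∀ q : M, TangentSpace 𝓘(ℝ, E) q} (hZ : SmoothNear Z p)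
      (v : TangentSpace 𝓘(ℝ, E) p) :
      covAlong cov ι (fun q ↦ covAlong cov ι (fun r ↦ V r + W r) q (Z q)) p v =
        covAlong cov ι (fun q ↦ covAlong cov ι V q (Z q)) p v
          + covAlong cov ι (fun q ↦ covAlong cov ι W q (Z q)) p v := by
    rw [← covAlong_add cov hι (hV.covAlong hcov hι hZ) (hW.covAlong hcov hι hZ)]
    refine covAlong_congr cov ?_ v
    filter_upwards [hV.eventually, hW.eventually] with q hVq hWq using covAlong_add cov hι hVq hWq _
  unfold curvature
  rw [hsecond hY, hsecond hX, covAlong_add cov hι hV hW]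
  abel

lemma covAlong_cov_push (hcov : cov.ContMDiffCovariantDerivative ∞)
    (hι : ContMDiff 𝓘(ℝ, E) 𝓘(ℝ, F) ∞ ι) (hY : SmoothNear Y p)
    {Z : ∀ x : N, TangentSpace 𝓘(ℝ, F) x} (hZ : SmoothNear Z (ι p))
    (v : TangentSpace 𝓘(ℝ, E) p) :
    covAlong cov ι (fun q ↦ cov Z (ι q) (push ι Y q)) p v = ∑ j,
      (mvfderiv 𝓘(ℝ, E) (fun q ↦ frameCoeff (ι p) j (ι q) (push ι Y q)) p v •
          cov Z (ι p) (frame (ι p) j (ι p)) +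
        frameCoeff (ι p) j (ι p) (push ι Y p) •
          cov (fun x ↦ cov Z x (frame (ι p) j x)) (ι p) (mfderiv 𝓘(ℝ, E) 𝓘(ℝ, F) ι p v)) := by
  have hdom := mem_frameDomain (F := F) (ι p)
  have hcoeff := (hY.push (F := F) hι).smoothFnNear_frameCoeff hι hdom
  have hZframe (j) := hZ.cov_apply hcov (smoothNear_frame hdom j)
  have hexpand : ∀ᶠ q in 𝓝 p, cov Z (ι q) (push ι Y q) =
      ∑ j, frameCoeff (ι p) j (ι q) (push ι Y q) • cov Z (ι q) (frame (ι p) j (ι q)) :=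
    (eventually_mem_frameDomain hι hdom).mono fun q hq ↦ map_eq_sum_frame hq _ _
  rw [covAlong_congr cov hexpand,
    covAlong_sum cov hι _ fun j _ ↦ ((hZframe j).comp hι).smul hι (hcoeff j)]
  refine Finset.sum_congr rfl fun j _ ↦ ?_
  rw [covAlong_smul cov hι (hcoeff j) ((hZframe j).comp hι), covAlong_comp cov hι (hZframe j)]

variable [FiniteDimensional ℝ E]

lemma curvature_covAlong_smul (hcov : cov.ContMDiffCovariantDerivative ∞)
    (hι : ContMDiff 𝓘(ℝ, E) 𝓘(ℝ, F) ∞ ι) (hX : SmoothNear X p) (hY : SmoothNear Y p) {c : M → ℝ}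
    (hc : SmoothFnNear E c p) (hV : SmoothAlongNear (E := E) ι V p) :
    curvature (covAlong cov ι) X Y (fun q ↦ c q • V q) p =
      c p • curvature (covAlong cov ι) X Y V p := by
  have hsecond {Z : ∀ q : M, TangentSpace 𝓘(ℝ, E) q} (hZ : SmoothNear Z p)
      (v : TangentSpace 𝓘(ℝ, E) p) :
      covAlong cov ι (fun q ↦ covAlong cov ι (fun r ↦ c r • V r) q (Z q)) p v =
        (mvfderiv 𝓘(ℝ, E) (fun q ↦ mvfderiv 𝓘(ℝ, E) c q (Z q)) p v • V p
            + mvfderiv 𝓘(ℝ, E) c p (Z p) • covAlong cov ι V p v)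
          + (mvfderiv 𝓘(ℝ, E) c p v • covAlong cov ι V p (Z p)
            + c p • covAlong cov ι (fun q ↦ covAlong cov ι V q (Z q)) p v) := by
    have hcZ := hc.mvfderiv hZ
    have hVZ := hV.covAlong hcov hι hZ
    rw [← covAlong_smul cov hι hcZ hV, ← covAlong_smul cov hι hc hVZ,
      ← covAlong_add cov hι (hV.smul hι hcZ) (hVZ.smul hι hc)]
    refine covAlong_congr cov ?_ v
    filter_upwards [hc.eventually, hV.eventually] with q hcq hVq
    exact covAlong_smul cov hι hcq hVq _
  unfold curvature
  rw [hsecond hY, hsecond hX, covAlong_smul cov hι hc hV, hc.mvfderiv_mlieBracket hX hY]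
  module

lemma curvature_covAlong_sum_smul (hcov : cov.ContMDiffCovariantDerivative ∞)
    (hι : ContMDiff 𝓘(ℝ, E) 𝓘(ℝ, F) ∞ ι) (hX : SmoothNear X p) (hY : SmoothNear Y p)
    {κ : Type*} (s : Finset κ) {c : κ → M → ℝ} {V : κ → ∀ q : M, TangentSpace 𝓘(ℝ, F) (ι q)}
    (hc : ∀ k, SmoothFnNear E (c k) p) (hV : ∀ k, SmoothAlongNear (E := E) ι (V k) p) :
    curvature (covAlong cov ι) X Y (fun q ↦ ∑ k ∈ s, c k q • V k q) p =
      ∑ k ∈ s, c k p • curvature (covAlong cov ι) X Y (V k) p := by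
  classical
  induction s using Finset.induction_on with
  | empty => simpa only [Finset.sum_empty] using curvature_covAlong_zero hι
  | insert a s ha ih =>
    simp only [Finset.sum_insert ha]
    rw [curvature_covAlong_add hcov hι hX hY ((hV a).smul hι (hc a))
      (.sum hι s fun k _ ↦ (hV k).smul hι (hc k)), curvature_covAlong_smul hcov hι hX hY (hc a)
      (hV a), ih]

lemma curvature_covAlong_comp (hcov : cov.ContMDiffCovariantDerivative ∞)
    (hι : ContMDiff 𝓘(ℝ, E) 𝓘(ℝ, F) ∞ ι) (hX : SmoothNear X p) (hY : SmoothNear Y p)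
    {Z : ∀ x : N, TangentSpace 𝓘(ℝ, F) x} (hZ : SmoothNear Z (ι p)) :
    curvature (covAlong cov ι) X Y (fun q ↦ Z (ι q)) p =
      ∑ j, ∑ k, (frameCoeff (ι p) j (ι p) (push ι Y p) * frameCoeff (ι p) k (ι p) (push ι X p)) •
        curvature (fun s x v ↦ cov s x v) (frame (ι p) k) (frame (ι p) j) Z (ι p) := by
  have hdom := mem_frameDomain (F := F) (ι p)
  have hfirst (Z' : ∀ q : M, TangentSpace 𝓘(ℝ, E) q) : ∀ᶠ q in 𝓝 p,
      covAlong cov ι (fun r ↦ Z (ι r)) q (Z' q) = cov Z (ι q) (push ι Z' q) :=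
    (hι.continuous.continuousAt.eventually hZ.eventually).mono fun q hq ↦ covAlong_comp cov hι hq _
  have hframe (j k) : curvature (fun s x v ↦ cov s x v) (frame (ι p) k) (frame (ι p) j) Z (ι p) =
      cov (fun x ↦ cov Z x (frame (ι p) j x)) (ι p) (frame (ι p) k (ι p)) -
        cov (fun x ↦ cov Z x (frame (ι p) k x)) (ι p) (frame (ι p) j (ι p)) := by
    rw [curvature, mlieBracket_frame hdom, map_zero, sub_zero]
  have hquad (v w : TangentSpace 𝓘(ℝ, F) (ι p)) : ∑ j, frameCoeff (ι p) j (ι p) w •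
        cov (fun x ↦ cov Z x (frame (ι p) j x)) (ι p) v =
      ∑ j, ∑ k, (frameCoeff (ι p) j (ι p) w * frameCoeff (ι p) k (ι p) v) •
        cov (fun x ↦ cov Z x (frame (ι p) j x)) (ι p) (frame (ι p) k (ι p)) := by
    refine Finset.sum_congr rfl fun j _ ↦ ?_
    simp only [map_eq_sum_frame hdom (cov (fun x ↦ cov Z x (frame (ι p) j x)) (ι p)) v,
      Finset.smul_sum, smul_smul]
  have hquad_swap := hquad (push ι Y p) (push ι X p)
  simp_rw [mul_comm (frameCoeff (ι p) _ (ι p) (push ι X p))] at hquad_swap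
  rw [Finset.sum_comm] at hquad_swap
  simp_rw [hframe, smul_sub, Finset.sum_sub_distrib]
  unfold curvature
  rw [covAlong_congr cov (hfirst Y), covAlong_congr cov (hfirst X), covAlong_comp cov hι hZ,
    covAlong_cov_push hcov hι hY hZ, covAlong_cov_push hcov hι hX hZ,
    map_eq_sum_frame hdom (cov Z (ι p)) (mfderiv 𝓘(ℝ, E) 𝓘(ℝ, F) ι p _)]
  simp_rw [frameCoeff_mlieBracket_push hι hX hY hdom]
  rw [← hquad, ← hquad_swap]
  simp_rw [sub_smul, Finset.sum_add_distrib, Finset.sum_sub_distrib]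
  simp only [push]
  abel

lemma curvature_covAlong_eq_sum (hcov : cov.ContMDiffCovariantDerivative ∞)
    (hι : ContMDiff 𝓘(ℝ, E) 𝓘(ℝ, F) ∞ ι) (hX : SmoothNear X p) (hY : SmoothNear Y p)
    (hV : SmoothAlongNear (E := E) ι V p) :
    curvature (covAlong cov ι) X Y V p = ∑ i, frameCoeff (ι p) i (ι p) (V p) • ∑ j, ∑ k,
      (frameCoeff (ι p) j (ι p) (push ι Y p) * frameCoeff (ι p) k (ι p) (push ι X p)) •
        curvature (fun s x v ↦ cov s x v) (frame (ι p) k) (frame (ι p) j) (frame (ι p) i)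
          (ι p) := by
  have hdom := mem_frameDomain (F := F) (ι p)
  have hframe (i) : SmoothNear (frame (ι p) i) (ι p) := smoothNear_frame hdom i
  have hexpand : ∀ᶠ q in 𝓝 p,
      V q = ∑ i, frameCoeff (ι p) i (ι q) (V q) • frame (ι p) i (ι q) :=
    (eventually_mem_frameDomain hι hdom).mono fun q hq ↦ (sum_frameCoeff_smul_frame hq _).symm
  rw [curvature_covAlong_congr hexpand, curvature_covAlong_sum_smul hcov hι hX hY _
    (hV.smoothFnNear_frameCoeff hι hdom) fun i ↦ (hframe i).comp hι]
  simp_rw [curvature_covAlong_comp hcov hι hX hY (hframe _)]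

end Curvature

section CurvatureTensor

variable {F : Type*} [NormedAddCommGroup F] [NormedSpace ℝ F] [FiniteDimensional ℝ F]
  {N : Type*} [TopologicalSpace N] [T2Space N] [ChartedSpace F N] [IsManifold 𝓘(ℝ, F) ∞ N]

/-- The curvature tensor `R(u, v)w` of tangent vectors at `x`, computed from arbitrary extensions
of `u`, `v`, `w` to vector fields which are smooth near `x`. -/
def curvatureTensor (cov : CovariantDerivative 𝓘(ℝ, F) F (fun x : N ↦ TangentSpace 𝓘(ℝ, F) x))
    (x : N) (u v w : TangentSpace 𝓘(ℝ, F) x) : TangentSpace 𝓘(ℝ, F) x :=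
  curvature (fun s y v ↦ cov s y v) (FiberBundle.extend F u) (FiberBundle.extend F v)
    (FiberBundle.extend F w) x

variable {cov : CovariantDerivative 𝓘(ℝ, F) F (fun x : N ↦ TangentSpace 𝓘(ℝ, F) x)}
  {x : N} {X Y Z : ∀ y : N, TangentSpace 𝓘(ℝ, F) y}

lemma curvature_covAlong_id (hcov : cov.ContMDiffCovariantDerivative ∞)
    (hX : SmoothNear X x) (hY : SmoothNear Y x) (hZ : SmoothNear Z x) :
    curvature (covAlong cov fun y : N ↦ y) X Y Z x = curvature (fun s y v ↦ cov s y v) X Y Z x := by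
  have hsecond {W : ∀ y : N, TangentSpace 𝓘(ℝ, F) y} (hW : SmoothNear W x)
      (v : TangentSpace 𝓘(ℝ, F) x) :
      covAlong cov (fun y : N ↦ y) (fun q ↦ covAlong cov (fun y : N ↦ y) Z q (W q)) x v =
        cov (fun q ↦ cov Z q (W q)) x v := by
    rw [← covAlong_id cov (hZ.cov_apply hcov hW)]
    exact covAlong_congr cov (hZ.eventually.mono fun q hq ↦ covAlong_id cov hq _) v
  unfold curvature
  rw [hsecond hX, hsecond hY, covAlong_id cov hZ]

lemma curvature_eq_sum (hcov : cov.ContMDiffCovariantDerivative ∞)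
    (hX : SmoothNear X x) (hY : SmoothNear Y x) (hZ : SmoothNear Z x) :
    curvature (fun s y v ↦ cov s y v) X Y Z x = ∑ i, frameCoeff x i x (Z x) • ∑ j, ∑ k,
      (frameCoeff x j x (Y x) * frameCoeff x k x (X x)) •
        curvature (fun s y v ↦ cov s y v) (frame x k) (frame x j) (frame x i) x := by
  have hpush (W : ∀ y : N, TangentSpace 𝓘(ℝ, F) y) : push (fun y : N ↦ y) W x = W x :=
    congr($(mfderiv_id) (W x))
  rw [← curvature_covAlong_id hcov hX hY hZ,
    curvature_covAlong_eq_sum (ι := fun y : N ↦ y) hcov contMDiff_id hX hY hZ, hpush, hpush]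

lemma curvatureTensor_eq_sum (hcov : cov.ContMDiffCovariantDerivative ∞)
    (u v w : TangentSpace 𝓘(ℝ, F) x) :
    curvatureTensor cov x u v w = ∑ i, frameCoeff x i x w • ∑ j, ∑ k,
      (frameCoeff x j x v * frameCoeff x k x u) •
        curvature (fun s y v ↦ cov s y v) (frame x k) (frame x j) (frame x i) x := by
  rw [curvatureTensor, curvature_eq_sum hcov (smoothNear_extend u) (smoothNear_extend v)
    (smoothNear_extend w)]
  simp only [FiberBundle.extend_apply_self]

lemma curvature_eq (hcov : cov.ContMDiffCovariantDerivative ∞)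
    (hX : SmoothNear X x) (hY : SmoothNear Y x) (hZ : SmoothNear Z x) :
    curvature (fun s y v ↦ cov s y v) X Y Z x = curvatureTensor cov x (X x) (Y x) (Z x) := by
  rw [curvature_eq_sum hcov hX hY hZ, curvatureTensor_eq_sum hcov]

variable {E : Type*} [NormedAddCommGroup E] [NormedSpace ℝ E] [FiniteDimensional ℝ E]
  {M : Type*} [TopologicalSpace M] [ChartedSpace E M] [IsManifold 𝓘(ℝ, E) ∞ M]

lemma curvature_covAlong (hcov : cov.ContMDiffCovariantDerivative ∞) {ι : M → N}
    (hι : ContMDiff 𝓘(ℝ, E) 𝓘(ℝ, F) ∞ ι) {p : M} {X Y : ∀ q : M, TangentSpace 𝓘(ℝ, E) q}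
    {V : ∀ q : M, TangentSpace 𝓘(ℝ, F) (ι q)} (hX : SmoothNear X p) (hY : SmoothNear Y p)
    (hV : SmoothAlongNear (E := E) ι V p) :
    curvature (covAlong cov ι) X Y V p =
      curvatureTensor cov (ι p) (push ι X p) (push ι Y p) (V p) := by
  rw [curvature_covAlong_eq_sum hcov hι hX hY hV, curvatureTensor_eq_sum hcov]

end CurvatureTensor

section CurvatureForms

variable {V : Type*} [AddCommGroup V]

/-- `B x y z w` has the symmetries of `g(R(x, y)z, w)` for a Riemannian curvature tensor `R`.
Only additivity is required, since homogeneity plays no role in polarization arguments. -/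
structure IsCurvatureForm (B : V → V → V → V → ℝ) : Prop where
  add_first : ∀ x x' y z w, B (x + x') y z w = B x y z w + B x' y z w
  skew_left : ∀ x y z w, B x y z w = -B y x z w
  skew_right : ∀ x y z w, B x y z w = -B x y w z
  bianchi : ∀ x y z w, B x y z w + B y z x w + B z x y w = 0

namespace IsCurvatureForm

variable {B : V → V → V → V → ℝ} (hB : IsCurvatureForm B)

include hB

lemma pair_symm (x y z w : V) : B x y z w = B z w x y := by
  linarith [hB.bianchi y z x w, hB.bianchi z x w y, hB.bianchi x w y z, hB.bianchi w y z x,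
    hB.skew_right y z x w, hB.skew_right z x y w, hB.skew_right x w z y, hB.skew_right w y x z,
    hB.skew_right y x w z, hB.skew_left y x z w, hB.skew_left w z x y, hB.skew_right z w y x]

lemma add_second (x y y' z w : V) : B x (y + y') z w = B x y z w + B x y' z w := by
  rw [hB.skew_left, hB.add_first, hB.skew_left x y, hB.skew_left x y', neg_add]

lemma add_third (x y z z' w : V) : B x y (z + z') w = B x y z w + B x y z' w := by
  rw [hB.pair_symm, hB.add_first, hB.pair_symm z, hB.pair_symm z']

lemma add_fourth (x y z w w' : V) : B x y z (w + w') = B x y z w + B x y z w' := by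
  rw [hB.pair_symm, hB.add_second, hB.pair_symm z, hB.pair_symm z w']

lemma neg_first (x y z w : V) : B (-x) y z w = -B x y z w :=
  map_neg (AddMonoidHom.mk' (B · y z w) fun x x' ↦ hB.add_first x x' y z w) x

lemma neg_second (x y z w : V) : B x (-y) z w = -B x y z w := by
  rw [hB.skew_left, hB.neg_first, hB.skew_left x y]

lemma neg_third (x y z w : V) : B x y (-z) w = -B x y z w := by
  rw [hB.pair_symm, hB.neg_first, hB.pair_symm z]

lemma neg_fourth (x y z w : V) : B x y z (-w) = -B x y z w := by
  rw [hB.pair_symm, hB.neg_second, hB.pair_symm z]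

lemma swap_ends (x y z : V) : B z y y x = B x y y z := by
  rw [hB.pair_symm, hB.skew_left, hB.skew_right, neg_neg]

lemma eq_zero_of_sectional (hsec : ∀ x y, B x y y x = 0) (x y z w : V) : B x y z w = 0 := by
  have hmiddle (x y z : V) : B x y y z = 0 := by
    have hpol := hsec (x + z) y
    rw [hB.add_first, hB.add_fourth, hB.add_fourth, hsec x y, hsec z y, hB.swap_ends x] at hpol
    linarith
  have hswap (x y z w : V) : B x y z w = -B x z y w := by
    have hpol := hmiddle x (y + z) w
    rw [hB.add_second, hB.add_third, hB.add_third, hmiddle, hmiddle] at hpol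
    linarith
  -- `B` is now alternating in its first three slots, so the Bianchi sum is `3 B x y z w`.
  linarith [hB.bianchi x y z w, hswap y z x w, hB.skew_left y x z w, hB.skew_left z x y w,
    hswap x z y w]

end IsCurvatureForm

variable [Module ℝ V]

/-- `B x y z w` has the symmetries of `g(R(x, y)z, w)` for the curvature tensor `R` of a Kähler
metric with complex structure `J`. -/
structure IsKaehlerCurvatureForm (J : V →ₗ[ℝ] V) (B : V → V → V → V → ℝ) : Prop
    extends IsCurvatureForm B where
  J_right : ∀ x y z w, B x y (J z) (J w) = B x y z w

namespace IsKaehlerCurvatureForm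

variable {J : V →ₗ[ℝ] V} {B B' : V → V → V → V → ℝ}

lemma sub_const_mul (hB : IsKaehlerCurvatureForm J B) (hB' : IsKaehlerCurvatureForm J B')
    (c : ℝ) : IsKaehlerCurvatureForm J fun x y z w ↦ B x y z w - c * B' x y z w where
  add_first x x' y z w := by rw [hB.add_first, hB'.add_first]; ring
  skew_left x y z w := by rw [hB.skew_left, hB'.skew_left]; ring
  skew_right x y z w := by rw [hB.skew_right, hB'.skew_right]; ring
  bianchi x y z w := by linear_combination hB.bianchi x y z w - c * hB'.bianchi x y z w
  J_right x y z w := by rw [hB.J_right, hB'.J_right]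

variable (hB : IsKaehlerCurvatureForm J B) (hJ : ∀ x, J (J x) = -x)

include hB

lemma J_left (x y z w : V) : B (J x) (J y) z w = B x y z w := by
  rw [hB.pair_symm, hB.J_right, hB.pair_symm]

include hJ

lemma apply_J_J_swap (x y : V) : B x (J y) (J x) y = B x (J y) (J y) x := by
  rw [← hB.J_right x (J y) (J x) y, hJ, hB.neg_third, hB.skew_right, neg_neg]

lemma apply_J_comm (x y : V) : B y (J x) (J x) y = B x (J y) (J y) x := by
  rw [← hB.J_left y, hJ, hB.neg_second, ← hB.J_right, hJ, hB.neg_third, hB.pair_symm,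
    hB.skew_left, hB.skew_right, neg_neg, neg_neg]

lemma apply_J_J (x y : V) : B x (J x) (J y) y = B x y y x + B x (J y) (J y) x := by
  linarith [hB.bianchi x (J x) (J y) y, hB.J_left x y x y, hB.skew_right x y x y,
    hB.skew_left (J y) x (J x) y, hB.apply_J_J_swap hJ x y]

lemma sectional_add_three_mul (hhol : ∀ x, B x (J x) (J x) x = 0) (x y : V) :
    B x y y x + 3 * B x (J y) (J y) x = 0 := by
  have hadd := hhol (x + y)
  have hsub := hhol (x + -y)
  simp only [map_add, map_neg, hB.add_first, hB.add_second, hB.add_third, hB.add_fourth,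
    hB.neg_first, hB.neg_second, hB.neg_third, hB.neg_fourth] at hadd hsub
  have hyyxx : B y (J y) (J x) x = B x (J x) (J y) y := by
    rw [hB.pair_symm, hB.skew_left, hB.skew_right, neg_neg]
  linarith [hhol x, hhol y, hB.apply_J_J_swap hJ x y, hB.apply_J_J_swap hJ y x,
    hB.apply_J_comm hJ x y, hB.apply_J_J hJ x y]

lemma eq_zero_of_holomorphic (hhol : ∀ x, B x (J x) (J x) x = 0) (x y z w : V) :
    B x y z w = 0 := by
  refine hB.eq_zero_of_sectional (fun x y ↦ ?_) x y z w
  have hJy := hB.sectional_add_three_mul hJ hhol x (J y)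
  rw [hJ, hB.neg_second, hB.neg_third] at hJy
  linarith [hB.sectional_add_three_mul hJ hhol x y]

end IsKaehlerCurvatureForm

end CurvatureForms

section ComplexSpaceForm

variable {V : Type*} [NormedAddCommGroup V] [InnerProductSpace ℝ V] {J : V →ₗ[ℝ] V}

/-- The curvature form `g(R(x, y)z, w)` of constant holomorphic sectional curvature `4`. -/
def complexSpaceForm (J : V →ₗ[ℝ] V) (x y z w : V) : ℝ :=
  inner ℝ y z * inner ℝ x w - inner ℝ x z * inner ℝ y w + inner ℝ (J y) z * inner ℝ (J x) w
    - inner ℝ (J x) z * inner ℝ (J y) w - 2 * inner ℝ (J x) y * inner ℝ (J z) w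

section

variable (hJ : ∀ x, J (J x) = -x) (hortho : ∀ x y, inner ℝ (J x) (J y) = inner ℝ x y)

include hJ hortho

lemma inner_J_right (x y : V) : inner ℝ x (J y) = -inner ℝ (J x) y := by
  rw [← hortho x, hJ, inner_neg_right]

lemma inner_J_left (x y : V) : inner ℝ (J x) y = -inner ℝ (J y) x := by
  rw [real_inner_comm, inner_J_right hJ hortho]

lemma inner_J_self (x : V) : inner ℝ (J x) x = 0 := by
  linarith [inner_J_left hJ hortho x x]

lemma isKaehlerCurvatureForm_complexSpaceForm :
    IsKaehlerCurvatureForm J (complexSpaceForm J) where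
  add_first x x' y z w := by
    simp only [complexSpaceForm, inner_add_left, map_add]
    ring
  skew_left x y z w := by
    rw [complexSpaceForm, complexSpaceForm, inner_J_left hJ hortho x y]
    ring
  skew_right x y z w := by
    rw [complexSpaceForm, complexSpaceForm, inner_J_left hJ hortho z w]
    ring
  bianchi x y z w := by
    simp only [complexSpaceForm]
    rw [inner_J_left hJ hortho x y, inner_J_left hJ hortho x z, inner_J_left hJ hortho y z,
      real_inner_comm y x, real_inner_comm z x, real_inner_comm z y]
    ring
  J_right x y z w := by
    simp only [complexSpaceForm, hortho, hJ, inner_neg_left, inner_J_right hJ hortho y z,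
      inner_J_right hJ hortho x z, inner_J_right hJ hortho x w, inner_J_right hJ hortho y w,
      inner_J_right hJ hortho z w]
    ring

lemma complexSpaceForm_holomorphic (x : V) :
    complexSpaceForm J x (J x) (J x) x = 4 * inner ℝ x x ^ 2 := by
  simp only [complexSpaceForm, hortho, hJ, inner_neg_left, inner_J_right hJ hortho,
    inner_J_self hJ hortho]
  ring

lemma IsKaehlerCurvatureForm.eq_complexSpaceForm {B : V → V → V → V → ℝ}
    (hB : IsKaehlerCurvatureForm J B) {μ : ℝ}
    (hhol : ∀ x, B x (J x) (J x) x = μ * inner ℝ x x ^ 2) (x y z w : V) :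
    B x y z w = μ / 4 * complexSpaceForm J x y z w := by
  refine sub_eq_zero.1 ((hB.sub_const_mul (isKaehlerCurvatureForm_complexSpaceForm hJ hortho)
    (μ / 4)).eq_zero_of_holomorphic hJ (fun x ↦ ?_) x y z w)
  rw [hhol, complexSpaceForm_holomorphic hJ hortho]
  ring

end

lemma complexSpaceForm_of_totallyReal {x y z : V} (hxy : inner ℝ (J x) y = 0)
    (hxz : inner ℝ (J x) z = 0) (hyz : inner ℝ (J y) z = 0) (w : V) :
    complexSpaceForm J x y z w = inner ℝ y z * inner ℝ x w - inner ℝ x z * inner ℝ y w := by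
  rw [complexSpaceForm, hxy, hxz, hyz]
  ring

end ComplexSpaceForm

section MetricConnection

variable {E : Type*} [NormedAddCommGroup E] [NormedSpace ℝ E]
  {M : Type*} [TopologicalSpace M] [ChartedSpace E M]
  {F : Type*} [NormedAddCommGroup F] [NormedSpace ℝ F]
  {N : Type*} [TopologicalSpace N] [ChartedSpace F N] [IsManifold 𝓘(ℝ, F) ∞ N]
  [RiemannianBundle (fun x : N ↦ TangentSpace 𝓘(ℝ, F) x)]
  [IsContMDiffRiemannianBundle 𝓘(ℝ, F) ∞ F (fun x : N ↦ TangentSpace 𝓘(ℝ, F) x)]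
  {cov : CovariantDerivative 𝓘(ℝ, F) F (fun x : N ↦ TangentSpace 𝓘(ℝ, F) x)}
  {ι : M → N} {p : M} {V W : ∀ q : M, TangentSpace 𝓘(ℝ, F) (ι q)}
  {x : N} {Y Z : ∀ y : N, TangentSpace 𝓘(ℝ, F) y}

lemma SmoothAlongNear.smoothFnNear_inner (hV : SmoothAlongNear (E := E) ι V p)
    (hW : SmoothAlongNear (E := E) ι W p) : SmoothFnNear E (fun q ↦ inner ℝ (V q) (W q)) p := by
  filter_upwards [hV, hW] with q hVq hWq using ContMDiffAt.inner_bundle hVq hWq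

lemma SmoothNear.smoothFnNear_inner (hY : SmoothNear Y x) (hZ : SmoothNear Z x) :
    SmoothFnNear F (fun y ↦ inner ℝ (Y y) (Z y)) x :=
  SmoothAlongNear.smoothFnNear_inner (ι := fun y : N ↦ y) hY hZ

variable [FiniteDimensional ℝ F]

lemma mvfderiv_inner (hmetric : CovariantDerivative.IsMetricCompatible (F := F)
      (V := fun x : N ↦ TangentSpace 𝓘(ℝ, F) x) cov) (hY : SmoothNear Y x) (hZ : SmoothNear Z x)
    (v : TangentSpace 𝓘(ℝ, F) x) :
    mvfderiv 𝓘(ℝ, F) (fun y ↦ inner ℝ (Y y) (Z y)) x v =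
      inner ℝ (cov Y x v) (Z x) + inner ℝ (Y x) (cov Z x v) := by
  have hextend := hmetric.mvfderiv_inner_eq (FiberBundle.extend F v) hY.mdifferentiableAt
    hZ.mdifferentiableAt
  simp only [FiberBundle.extend_apply_self] at hextend
  exact hextend

lemma mvfderiv_inner_along_of_comp (hι : ContMDiff 𝓘(ℝ, E) 𝓘(ℝ, F) ∞ ι)
    (hW : SmoothAlongNear (E := E) ι W p) {v : TangentSpace 𝓘(ℝ, E) p}
    (hcomp : ∀ Y : ∀ x : N, TangentSpace 𝓘(ℝ, F) x, SmoothNear Y (ι p) →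
      mvfderiv 𝓘(ℝ, E) (fun q ↦ inner ℝ (Y (ι q)) (W q)) p v =
        inner ℝ (covAlong cov ι (fun q ↦ Y (ι q)) p v) (W p) +
          inner ℝ (Y (ι p)) (covAlong cov ι W p v))
    (hV : SmoothAlongNear (E := E) ι V p) :
    mvfderiv 𝓘(ℝ, E) (fun q ↦ inner ℝ (V q) (W q)) p v =
      inner ℝ (covAlong cov ι V p v) (W p) + inner ℝ (V p) (covAlong cov ι W p v) := by
  induction hV using SmoothAlongNear.induction hι with
  | comp Y hY => exact hcomp Y hY
  | smul c V hc hV ih =>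
    simp only [real_inner_smul_left]
    rw [hc.mvfderiv_mul (hV.smoothFnNear_inner hW), covAlong_smul cov hι hc hV, ih,
      inner_add_left, real_inner_smul_left, real_inner_smul_left]
    ring
  | add V V' hV hV' ih ih' =>
    simp only [inner_add_left]
    rw [(hV.smoothFnNear_inner hW).mvfderiv_add (hV'.smoothFnNear_inner hW), ih, ih',
      covAlong_add cov hι hV hV', inner_add_left]
    ring
  | congr V V' hV hVV' ih =>
    rw [covAlong_congr cov hVV', hVV'.self_of_nhds, ← ih]
    exact mvfderiv_congr (hVV'.mono fun q hq ↦ by rw [hq]) v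

lemma mvfderiv_inner_along (hmetric : CovariantDerivative.IsMetricCompatible (F := F)
      (V := fun x : N ↦ TangentSpace 𝓘(ℝ, F) x) cov)
    (hι : ContMDiff 𝓘(ℝ, E) 𝓘(ℝ, F) ∞ ι) (hV : SmoothAlongNear (E := E) ι V p)
    (hW : SmoothAlongNear (E := E) ι W p) (v : TangentSpace 𝓘(ℝ, E) p) :
    mvfderiv 𝓘(ℝ, E) (fun q ↦ inner ℝ (V q) (W q)) p v =
      inner ℝ (covAlong cov ι V p v) (W p) + inner ℝ (V p) (covAlong cov ι W p v) := by
  refine mvfderiv_inner_along_of_comp hι hW (fun Y hY ↦ ?_) hV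
  have hswap := mvfderiv_inner_along_of_comp (cov := cov) (v := v) hι (hY.comp hι)
    (fun Z hZ ↦ ?_) hW
  · simp_rw [real_inner_comm (W _)]
    rw [hswap, add_comm, real_inner_comm (covAlong cov ι W p v)]
  · rw [(hZ.smoothFnNear_inner hY).mvfderiv_comp hι, covAlong_comp cov hι hY,
      covAlong_comp cov hι hZ, mvfderiv_inner hmetric hZ hY]

end MetricConnection

section ParallelComplexStructure

variable {E : Type*} [NormedAddCommGroup E] [NormedSpace ℝ E]
  {M : Type*} [TopologicalSpace M] [ChartedSpace E M]
  {F : Type*} [NormedAddCommGroup F] [NormedSpace ℝ F] [FiniteDimensional ℝ F]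
  {N : Type*} [TopologicalSpace N] [ChartedSpace F N] [IsManifold 𝓘(ℝ, F) ∞ N]
  [RiemannianBundle (fun x : N ↦ TangentSpace 𝓘(ℝ, F) x)]
  [IsContMDiffRiemannianBundle 𝓘(ℝ, F) ∞ F (fun x : N ↦ TangentSpace 𝓘(ℝ, F) x)]
  {cov : CovariantDerivative 𝓘(ℝ, F) F (fun x : N ↦ TangentSpace 𝓘(ℝ, F) x)}
  {J : ∀ x : N, TangentSpace 𝓘(ℝ, F) x →L[ℝ] TangentSpace 𝓘(ℝ, F) x}
  {ι : M → N} {p : M} {V : ∀ q : M, TangentSpace 𝓘(ℝ, F) (ι q)}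

lemma SmoothAlongNear.complexStructure (hN : IsKaehler cov J)
    (hι : ContMDiff 𝓘(ℝ, E) 𝓘(ℝ, F) ∞ ι) (hV : SmoothAlongNear (E := E) ι V p) :
    SmoothAlongNear (E := E) ι (fun q ↦ J (ι q) (V q)) p := by
  filter_upwards [hV] with q hq
  exact ContMDiffAt.clm_bundle_apply ((hN.smooth_J.comp hι).contMDiffAt) hq

lemma SmoothNear.complexStructure (hN : IsKaehler cov J) {x : N}
    {Y : ∀ y : N, TangentSpace 𝓘(ℝ, F) y} (hY : SmoothNear Y x) :
    SmoothNear (fun y ↦ J y (Y y)) x :=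
  SmoothAlongNear.complexStructure (ι := fun y : N ↦ y) hN contMDiff_id hY

lemma covAlong_complexStructure (hN : IsKaehler cov J) (hι : ContMDiff 𝓘(ℝ, E) 𝓘(ℝ, F) ∞ ι)
    (hV : SmoothAlongNear (E := E) ι V p) (v : TangentSpace 𝓘(ℝ, E) p) :
    covAlong cov ι (fun q ↦ J (ι q) (V q)) p v = J (ι p) (covAlong cov ι V p v) := by
  induction hV using SmoothAlongNear.induction hι with
  | comp Y hY =>
    rw [covAlong_comp cov hι hY, covAlong_comp cov hι (hY.complexStructure hN),
      hN.J_parallel _ _ hY]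
  | smul c V hc hV ih =>
    simp only [map_smul]
    rw [covAlong_smul cov hι hc (hV.complexStructure hN hι), ih, covAlong_smul cov hι hc hV,
      map_add, map_smul, map_smul]
  | add V W hV hW ih ih' =>
    simp only [map_add]
    rw [covAlong_add cov hι (hV.complexStructure hN hι) (hW.complexStructure hN hι), ih, ih',
      covAlong_add cov hι hV hW, map_add]
  | congr V W hV hVW ih =>
    rw [covAlong_congr cov hVW, ← ih]
    exact covAlong_congr cov (hVW.mono fun q hq ↦ by rw [hq]) v

end ParallelComplexStructure

section CurvatureSymmetries

variable {F : Type*} [NormedAddCommGroup F] [NormedSpace ℝ F] [FiniteDimensional ℝ F]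
  {N : Type*} [TopologicalSpace N] [ChartedSpace F N] [IsManifold 𝓘(ℝ, F) ∞ N]
  {cov : CovariantDerivative 𝓘(ℝ, F) F (fun x : N ↦ TangentSpace 𝓘(ℝ, F) x)}

lemma curvatureTensor_extend (x : N) (u v w : TangentSpace 𝓘(ℝ, F) x) :
    curvatureTensor cov x u v w =
      cov (fun y ↦ cov (FiberBundle.extend F w) y (FiberBundle.extend F v y)) x u -
        cov (fun y ↦ cov (FiberBundle.extend F w) y (FiberBundle.extend F u y)) x v := by
  rw [curvatureTensor, curvature, mlieBracket_extend (mem_frameDomain x), map_zero, sub_zero,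
    FiberBundle.extend_apply_self, FiberBundle.extend_apply_self]

lemma curvatureTensor_swap (x : N) (u v w : TangentSpace 𝓘(ℝ, F) x) :
    curvatureTensor cov x u v w = -curvatureTensor cov x v u w := by
  rw [curvatureTensor_extend, curvatureTensor_extend, neg_sub]

variable [T2Space N]

lemma curvatureTensor_add_left (hcov : cov.ContMDiffCovariantDerivative ∞) (x : N)
    (u u' v w : TangentSpace 𝓘(ℝ, F) x) :
    curvatureTensor cov x (u + u') v w =
      curvatureTensor cov x u v w + curvatureTensor cov x u' v w := by
  simp only [curvatureTensor_eq_sum hcov, ← Finset.sum_add_distrib, ← smul_add, map_add, mul_add,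
    add_smul]

lemma curvatureTensor_smul_smul_self (hcov : cov.ContMDiffCovariantDerivative ∞) (x : N) (a b : ℝ)
    (u w : TangentSpace 𝓘(ℝ, F) x) : curvatureTensor cov x (a • u) (b • u) w = 0 := by
  have hself : curvatureTensor cov x u u w = 0 := by
    have hswap := curvatureTensor_swap (cov := cov) x u u w
    rwa [eq_neg_iff_add_eq_zero, ← two_smul ℝ, smul_eq_zero_iff_right two_ne_zero] at hswap
  have hsmul : curvatureTensor cov x (a • u) (b • u) w =
      (a * b) • curvatureTensor cov x u u w := by
    simp only [curvatureTensor_eq_sum hcov, Finset.smul_sum, smul_smul, map_smul, smul_eq_mul]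
    refine Finset.sum_congr rfl fun i _ ↦ Finset.sum_congr rfl fun j _ ↦
      Finset.sum_congr rfl fun k _ ↦ ?_
    congr 1
    ring
  rw [hsmul, hself, smul_zero]

lemma curvatureTensor_bianchi (hcov : cov.ContMDiffCovariantDerivative ∞)
    (htorsion : cov.torsion = 0) (x : N) (u v w : TangentSpace 𝓘(ℝ, F) x) :
    curvatureTensor cov x u v w + curvatureTensor cov x v w u + curvatureTensor cov x w u v =
      0 := by
  have hcomm (a b c : TangentSpace 𝓘(ℝ, F) x) :
      cov (fun y ↦ cov (FiberBundle.extend F a) y (FiberBundle.extend F b y)) x c =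
        cov (fun y ↦ cov (FiberBundle.extend F b) y (FiberBundle.extend F a y)) x c := by
    congr 1
    refine cov_congr cov ((smoothNear_extend b).cov_apply hcov (smoothNear_extend a)) ?_
    filter_upwards [frameDomain_mem_nhds (mem_frameDomain (F := F) x)] with y hy
    exact cov_comm htorsion (smoothNear_extend_of_mem hy a) (smoothNear_extend_of_mem hy b)
      (mlieBracket_extend hy a b)
  rw [curvatureTensor_extend, curvatureTensor_extend, curvatureTensor_extend, hcomm w v u,
    hcomm u w v, hcomm v u w]
  abel

variable [RiemannianBundle (fun x : N ↦ TangentSpace 𝓘(ℝ, F) x)]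
  [IsContMDiffRiemannianBundle 𝓘(ℝ, F) ∞ F (fun x : N ↦ TangentSpace 𝓘(ℝ, F) x)]

lemma mvfderiv_mvfderiv_inner (hcov : cov.ContMDiffCovariantDerivative ∞)
    (hmetric : CovariantDerivative.IsMetricCompatible (F := F)
      (V := fun x : N ↦ TangentSpace 𝓘(ℝ, F) x) cov)
    {x : N} {X Y Z : ∀ y : N, TangentSpace 𝓘(ℝ, F) y}
    (hX : SmoothNear X x) (hY : SmoothNear Y x) (hZ : SmoothNear Z x)
    (v : TangentSpace 𝓘(ℝ, F) x) :
    mvfderiv 𝓘(ℝ, F) (fun y ↦ mvfderiv 𝓘(ℝ, F) (fun y ↦ inner ℝ (Y y) (Z y)) y (X y)) x v =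
      inner ℝ (cov (fun y ↦ cov Y y (X y)) x v) (Z x) + inner ℝ (cov Y x (X x)) (cov Z x v) +
        (inner ℝ (cov Y x v) (cov Z x (X x)) +
          inner ℝ (Y x) (cov (fun y ↦ cov Z y (X y)) x v)) := by
  have hYX := hY.cov_apply hcov hX
  have hZX := hZ.cov_apply hcov hX
  have hfirst : ∀ᶠ y in 𝓝 x, mvfderiv 𝓘(ℝ, F) (fun y ↦ inner ℝ (Y y) (Z y)) y (X y) =
      inner ℝ (cov Y y (X y)) (Z y) + inner ℝ (Y y) (cov Z y (X y)) := by
    filter_upwards [hY.eventually, hZ.eventually] with y hYy hZy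
    exact mvfderiv_inner hmetric hYy hZy _
  rw [mvfderiv_congr hfirst, (hYX.smoothFnNear_inner hZ).mvfderiv_add (hY.smoothFnNear_inner hZX),
    mvfderiv_inner hmetric hYX hZ, mvfderiv_inner hmetric hY hZX]

lemma inner_curvatureTensor_skew (hcov : cov.ContMDiffCovariantDerivative ∞)
    (hmetric : CovariantDerivative.IsMetricCompatible (F := F)
      (V := fun x : N ↦ TangentSpace 𝓘(ℝ, F) x) cov) (x : N) (u v w z : TangentSpace 𝓘(ℝ, F) x) :
    inner ℝ (curvatureTensor cov x u v w) z = -inner ℝ (curvatureTensor cov x u v z) w := by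
  have hu := smoothNear_extend u
  have hv := smoothNear_extend v
  have hw := smoothNear_extend w
  have hz := smoothNear_extend z
  -- Second derivatives of the function `⟪w, z⟫` along the commuting fields `u`, `v` commute.
  have hbracket := (hw.smoothFnNear_inner hz).mvfderiv_mlieBracket hu hv
  rw [mlieBracket_extend (mem_frameDomain x), map_zero,
    mvfderiv_mvfderiv_inner hcov hmetric hu hw hz, mvfderiv_mvfderiv_inner hcov hmetric hv hw hz]
    at hbracket
  simp only [FiberBundle.extend_apply_self] at hbracket
  rw [curvatureTensor_extend, curvatureTensor_extend, inner_sub_left, inner_sub_left,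
    real_inner_comm w, real_inner_comm w]
  linarith

variable {J : ∀ x : N, TangentSpace 𝓘(ℝ, F) x →L[ℝ] TangentSpace 𝓘(ℝ, F) x}

lemma curvatureTensor_complexStructure (hN : IsKaehler cov J) (x : N)
    (u v w : TangentSpace 𝓘(ℝ, F) x) :
    curvatureTensor cov x u v (J x w) = J x (curvatureTensor cov x u v w) := by
  have hu := smoothNear_extend u
  have hv := smoothNear_extend v
  have hw := smoothNear_extend w
  have hsecond (s t : TangentSpace 𝓘(ℝ, F) x) :
      cov (fun y ↦ cov (fun y ↦ J y (FiberBundle.extend F w y)) y (FiberBundle.extend F t y)) x s =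
        J x (cov (fun y ↦ cov (FiberBundle.extend F w) y (FiberBundle.extend F t y)) x s) := by
    have hwt := hw.cov_apply hN.smooth_cov (smoothNear_extend t)
    rw [← hN.J_parallel x _ hwt, cov_congr cov (hwt.complexStructure hN)]
    filter_upwards [hw.eventually] with y hwy using hN.J_parallel y _ hwy _
  have hfield := curvature_eq hN.smooth_cov hu hv (hw.complexStructure hN)
  rw [curvature, mlieBracket_extend (mem_frameDomain x)] at hfield
  simp only [FiberBundle.extend_apply_self, map_zero, sub_zero, hsecond] at hfield
  rw [← hfield, curvatureTensor_extend, map_sub]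

lemma isKaehlerCurvatureForm_curvatureTensor (hN : IsKaehler cov J) (x : N) :
    IsKaehlerCurvatureForm (J x).toLinearMap
      fun u v w z ↦ inner ℝ (curvatureTensor cov x u v w) z where
  add_first u u' v w z := by rw [curvatureTensor_add_left hN.smooth_cov, inner_add_left]
  skew_left u v w z := by rw [curvatureTensor_swap, inner_neg_left]
  skew_right := inner_curvatureTensor_skew hN.smooth_cov hN.metric x
  bianchi u v w z := by
    rw [← inner_add_left, ← inner_add_left,
      curvatureTensor_bianchi hN.smooth_cov hN.torsion_free, inner_zero_left]
  J_right u v w z := by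
    change inner ℝ (curvatureTensor cov x u v (J x w)) (J x z) = _
    rw [curvatureTensor_complexStructure hN, hN.J_orthogonal]

lemma inner_curvatureTensor_eq_complexSpaceForm (hN : IsKaehler cov J) {μ : ℝ}
    (hμ : HasConstantHolomorphicCurvature cov J μ) (x : N) (u v w z : TangentSpace 𝓘(ℝ, F) x) :
    inner ℝ (curvatureTensor cov x u v w) z =
      μ / 4 * complexSpaceForm (J x).toLinearMap u v w z := by
  refine (isKaehlerCurvatureForm_curvatureTensor hN x).eq_complexSpaceForm (hN.J_sq x)
    (hN.J_orthogonal x) (fun v ↦ ?_) u v w z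
  have hv := smoothNear_extend v
  have hJv := hv.complexStructure hN
  have hfield := hμ x _ hv
  rw [curvature_eq hN.smooth_cov hv hJv hJv] at hfield
  simp only [FiberBundle.extend_apply_self] at hfield
  exact hfield

lemma inner_curvatureTensor_of_totallyReal (hN : IsKaehler cov J) {μ : ℝ}
    (hμ : HasConstantHolomorphicCurvature cov J μ) {x : N} {u v w : TangentSpace 𝓘(ℝ, F) x}
    (huv : inner ℝ (J x u) v = 0) (huw : inner ℝ (J x u) w = 0) (hvw : inner ℝ (J x v) w = 0)
    (z : TangentSpace 𝓘(ℝ, F) x) :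
    inner ℝ (curvatureTensor cov x u v w) z =
      μ / 4 * (inner ℝ v w * inner ℝ u z - inner ℝ u w * inner ℝ v z) := by
  rw [inner_curvatureTensor_eq_complexSpaceForm hN hμ,
    complexSpaceForm_of_totallyReal huv huw hvw]

end CurvatureSymmetries

section GramCoefficients

variable {κ : Type*} [Fintype κ] [DecidableEq κ]

/-- The coefficients, with respect to a linearly independent family `u`, of the orthogonal
projection of `w` to the span of `u`. They are given by Cramer's rule for the Gram matrix of `u`,
which makes their smooth dependence on `u` and `w` evident. -/
def gramCoeff {V : Type*} [NormedAddCommGroup V] [InnerProductSpace ℝ V] (u : κ → V) (w : V)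
    (a : κ) : ℝ :=
  (Matrix.gram ℝ u).det⁻¹ * (Matrix.gram ℝ u).cramer (fun b ↦ inner ℝ (u b) w) a

lemma inner_sum_gramCoeff {V : Type*} [NormedAddCommGroup V] [InnerProductSpace ℝ V] {u : κ → V}
    (hu : LinearIndependent ℝ u) (w : V) (b : κ) :
    inner ℝ (u b) (∑ a, gramCoeff u w a • u a) = inner ℝ (u b) w := by
  have hdet : (Matrix.gram ℝ u).det ≠ 0 := (Matrix.posDef_gram_of_linearIndependent hu).det_pos.ne'
  have hcramer := congr_fun
    (Matrix.mulVec_cramer (Matrix.gram ℝ u) fun b ↦ inner ℝ (u b) w) b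
  simp only [Matrix.mulVec, dotProduct, Pi.smul_apply, smul_eq_mul, Matrix.gram_apply] at hcramer
  simp only [inner_sum, inner_smul_right, gramCoeff, mul_assoc, ← Finset.mul_sum]
  simp only [mul_comm _ (inner ℝ (u b) _)]
  rw [hcramer, inv_mul_cancel_left₀ hdet]

variable {E : Type*} [NormedAddCommGroup E] [NormedSpace ℝ E]
  {M : Type*} [TopologicalSpace M] [ChartedSpace E M]
  {F : Type*} [NormedAddCommGroup F] [NormedSpace ℝ F]
  {N : Type*} [TopologicalSpace N] [ChartedSpace F N] [IsManifold 𝓘(ℝ, F) ∞ N]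
  [RiemannianBundle (fun x : N ↦ TangentSpace 𝓘(ℝ, F) x)]
  [IsContMDiffRiemannianBundle 𝓘(ℝ, F) ∞ F (fun x : N ↦ TangentSpace 𝓘(ℝ, F) x)]
  {ι : M → N} {p : M}

lemma SmoothAlongNear.smoothFnNear_gramCoeff
    {U : κ → ∀ q : M, TangentSpace 𝓘(ℝ, F) (ι q)} {V : ∀ q : M, TangentSpace 𝓘(ℝ, F) (ι q)}
    (hV : SmoothAlongNear (E := E) ι V p) (hU : ∀ a, SmoothAlongNear (E := E) ι (U a) p)
    (hlin : LinearIndependent ℝ fun a ↦ U a p) (a : κ) :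
    SmoothFnNear E (fun q ↦ gramCoeff (fun b ↦ U b q) (V q) a) p := by
  have hgram (b c) := (hU b).smoothFnNear_inner (hU c)
  refine .mul (.inv (.det hgram) (Matrix.posDef_gram_of_linearIndependent hlin).det_pos.ne') ?_
  simp only [Matrix.cramer_apply]
  refine .det fun b c ↦ ?_
  obtain rfl | hc := eq_or_ne c a
  · simpa using (hU b).smoothFnNear_inner hV
  · simpa [Matrix.updateCol_apply, hc] using hgram b c

end GramCoefficients

section ImmersedFrame

variable {E : Type*} [NormedAddCommGroup E] [NormedSpace ℝ E] [FiniteDimensional ℝ E]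
  {M : Type*} [TopologicalSpace M] [ChartedSpace E M] [IsManifold 𝓘(ℝ, E) ∞ M]
  {F : Type*} [NormedAddCommGroup F] [NormedSpace ℝ F]
  {N : Type*} [TopologicalSpace N] [ChartedSpace F N]
  {ι : M → N} {p q : M}

lemma linearIndependent_push_frame (hι : IsSubmanifold E F ι) (hq : q ∈ frameDomain E p) :
    LinearIndependent ℝ fun a ↦ push (F := F) ι (frame (F := E) p a) q := by
  have hframe : LinearIndependent ℝ fun a ↦ frame (F := E) p a q := by
    rw [Fintype.linearIndependent_iff]
    intro c hc a
    have hcoeff := congr(frameCoeff p a q $hc)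
    simpa [map_sum, frameCoeff_frame hq] using hcoeff
  exact hframe.map' (mfderiv 𝓘(ℝ, E) 𝓘(ℝ, F) ι q).toLinearMap
    (LinearMap.ker_eq_bot.2 (hι.injective q))

end ImmersedFrame

section Projections

variable {E : Type*} [NormedAddCommGroup E] [NormedSpace ℝ E]
  {M : Type*} [TopologicalSpace M] [ChartedSpace E M]
  {F : Type*} [NormedAddCommGroup F] [NormedSpace ℝ F]
  {N : Type*} [TopologicalSpace N] [ChartedSpace F N]
  [RiemannianBundle (fun x : N ↦ TangentSpace 𝓘(ℝ, F) x)]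
  {ι : M → N} {p : M}

lemma mem_tangentSubspace_orthogonal_iff {w : TangentSpace 𝓘(ℝ, F) (ι p)} :
    w ∈ (tangentSubspace E ι p)ᗮ ↔ ∀ v, inner ℝ (mfderiv 𝓘(ℝ, E) 𝓘(ℝ, F) ι p v) w = 0 := by
  rw [Submodule.mem_orthogonal]
  constructor
  · exact fun h v ↦ h _ ⟨v, rfl⟩
  · rintro h _ ⟨v, rfl⟩
    exact h v

variable [FiniteDimensional ℝ E]

lemma normalPart_mem_orthogonal (w : TangentSpace 𝓘(ℝ, F) (ι p)) :
    normalPart E ι p w ∈ (tangentSubspace E ι p)ᗮ :=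
  (tangentSubspace E ι p).sub_starProjection_mem_orthogonal w

lemma inner_mfderiv_normalPart (v : TangentSpace 𝓘(ℝ, E) p) (w : TangentSpace 𝓘(ℝ, F) (ι p)) :
    inner ℝ (mfderiv 𝓘(ℝ, E) 𝓘(ℝ, F) ι p v) (normalPart E ι p w) = 0 :=
  mem_tangentSubspace_orthogonal_iff.1 (normalPart_mem_orthogonal w) v

lemma inner_normalPart_of_mem_orthogonal {s : TangentSpace 𝓘(ℝ, F) (ι p)}
    (hs : s ∈ (tangentSubspace E ι p)ᗮ) (w : TangentSpace 𝓘(ℝ, F) (ι p)) :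
    inner ℝ s (normalPart E ι p w) = inner ℝ s w := by
  rw [normalPart, inner_sub_right, Submodule.inner_left_of_mem_orthogonal
    ((tangentSubspace E ι p).starProjection_apply_mem w) hs, sub_zero]

lemma normalPart_add (w w' : TangentSpace 𝓘(ℝ, F) (ι p)) :
    normalPart E ι p (w + w') = normalPart E ι p w + normalPart E ι p w' := by
  simp only [normalPart, map_add]
  abel

lemma normalPart_smul (c : ℝ) (w : TangentSpace 𝓘(ℝ, F) (ι p)) :
    normalPart E ι p (c • w) = c • normalPart E ι p w := by
  simp only [normalPart, map_smul, smul_sub]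

lemma normalPart_neg (w : TangentSpace 𝓘(ℝ, F) (ι p)) :
    normalPart E ι p (-w) = -normalPart E ι p w := by
  rw [← neg_one_smul ℝ, normalPart_smul, neg_one_smul]

lemma normalPart_zero : normalPart E ι p (0 : TangentSpace 𝓘(ℝ, F) (ι p)) = 0 := by
  simp [normalPart]

lemma normalPart_sub (w w' : TangentSpace 𝓘(ℝ, F) (ι p)) :
    normalPart E ι p (w - w') = normalPart E ι p w - normalPart E ι p w' := by
  rw [sub_eq_add_neg, normalPart_add, normalPart_neg, sub_eq_add_neg]

lemma tangentPart_add (w w' : TangentSpace 𝓘(ℝ, F) (ι p)) :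
    tangentPart E ι p (w + w') = tangentPart E ι p w + tangentPart E ι p w' := by
  simp only [tangentPart, map_add]

lemma tangentPart_smul (c : ℝ) (w : TangentSpace 𝓘(ℝ, F) (ι p)) :
    tangentPart E ι p (c • w) = c • tangentPart E ι p w := by
  simp only [tangentPart, map_smul]

variable (hι : IsSubmanifold E F ι)

include hι

lemma mfderiv_tangentPart (w : TangentSpace 𝓘(ℝ, F) (ι p)) :
    mfderiv 𝓘(ℝ, E) 𝓘(ℝ, F) ι p (tangentPart E ι p w) =
      (tangentSubspace E ι p).starProjection w := by
  obtain ⟨v, hv⟩ := (tangentSubspace E ι p).starProjection_apply_mem w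
  have htangent : tangentPart E ι p w = v := by
    unfold tangentPart
    rw [← hv]
    exact LinearMap.leftInverse_apply_of_inj (LinearMap.ker_eq_bot.2 (hι.injective p)) v
  rw [htangent]
  exact hv

lemma mfderiv_tangentPart_add_normalPart (w : TangentSpace 𝓘(ℝ, F) (ι p)) :
    mfderiv 𝓘(ℝ, E) 𝓘(ℝ, F) ι p (tangentPart E ι p w) + normalPart E ι p w = w := by
  rw [mfderiv_tangentPart hι, normalPart]
  abel

lemma normalPart_eq (w : TangentSpace 𝓘(ℝ, F) (ι p)) :
    normalPart E ι p w = w - mfderiv 𝓘(ℝ, E) 𝓘(ℝ, F) ι p (tangentPart E ι p w) := by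
  rw [mfderiv_tangentPart hι, normalPart]

lemma tangentPart_add_of_mem_orthogonal (v : TangentSpace 𝓘(ℝ, E) p)
    {s : TangentSpace 𝓘(ℝ, F) (ι p)} (hs : s ∈ (tangentSubspace E ι p)ᗮ) :
    tangentPart E ι p (mfderiv 𝓘(ℝ, E) 𝓘(ℝ, F) ι p v + s) = v := by
  apply hι.injective p
  rw [mfderiv_tangentPart hι]
  refine Submodule.eq_starProjection_of_mem_of_inner_eq_zero ⟨v, rfl⟩ ?_
  intro w hw
  rw [add_sub_cancel_left, real_inner_comm]
  exact (Submodule.mem_orthogonal _ _).1 hs w hw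

lemma tangentPart_mfderiv (v : TangentSpace 𝓘(ℝ, E) p) :
    tangentPart E ι p (mfderiv 𝓘(ℝ, E) 𝓘(ℝ, F) ι p v) = v := by
  simpa using tangentPart_add_of_mem_orthogonal hι v (Submodule.zero_mem _)

lemma normalPart_mfderiv (v : TangentSpace 𝓘(ℝ, E) p) :
    normalPart E ι p (mfderiv 𝓘(ℝ, E) 𝓘(ℝ, F) ι p v) = 0 := by
  rw [normalPart_eq hι, tangentPart_mfderiv hι, sub_self]

lemma tangentPart_of_mem_orthogonal {s : TangentSpace 𝓘(ℝ, F) (ι p)}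
    (hs : s ∈ (tangentSubspace E ι p)ᗮ) : tangentPart E ι p s = 0 := by
  simpa using tangentPart_add_of_mem_orthogonal hι 0 hs

lemma normalPart_of_mem_orthogonal {s : TangentSpace 𝓘(ℝ, F) (ι p)}
    (hs : s ∈ (tangentSubspace E ι p)ᗮ) : normalPart E ι p s = s := by
  rw [normalPart_eq hι, tangentPart_of_mem_orthogonal hι hs, map_zero, sub_zero]

variable [IsManifold 𝓘(ℝ, E) ∞ M]

lemma tangentPart_eq_sum_frame {q : M} (hq : q ∈ frameDomain E p)
    (w : TangentSpace 𝓘(ℝ, F) (ι q)) :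
    tangentPart E ι q w = ∑ a, gramCoeff (fun b ↦ push ι (frame p b) q) w a • frame p a q := by
  set c := gramCoeff (fun b ↦ push ι (frame (F := E) p b) q) w
  have hpush : mfderiv 𝓘(ℝ, E) 𝓘(ℝ, F) ι q (∑ a, c a • frame p a q) =
      ∑ a, c a • push ι (frame p a) q := by
    simp only [map_sum, map_smul, push]
  have hframe (b : Fin (Module.finrank ℝ E)) :
      inner ℝ (push ι (frame p b) q) (w - ∑ a, c a • push ι (frame p a) q) = 0 := by
    rw [inner_sub_right, sub_eq_zero]
    have hlin := linearIndependent_push_frame hι hq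
    exact (inner_sum_gramCoeff (V := TangentSpace 𝓘(ℝ, F) (ι q)) hlin w b).symm
  have hnormal : w - ∑ a, c a • push ι (frame p a) q ∈ (tangentSubspace E ι q)ᗮ := by
    refine mem_tangentSubspace_orthogonal_iff.2 fun v ↦ ?_
    rw [map_eq_sum_frame hq (mfderiv 𝓘(ℝ, E) 𝓘(ℝ, F) ι q) v, sum_inner]
    refine Finset.sum_eq_zero fun b _ ↦ (real_inner_smul_left _ _ _).trans ?_
    exact mul_eq_zero_of_right _ (hframe b)
  have htangent := tangentPart_add_of_mem_orthogonal hι (∑ a, c a • frame p a q) hnormal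
  rwa [hpush, add_sub_cancel] at htangent

variable [IsManifold 𝓘(ℝ, F) ∞ N]
  [IsContMDiffRiemannianBundle 𝓘(ℝ, F) ∞ F (fun x : N ↦ TangentSpace 𝓘(ℝ, F) x)]

lemma SmoothAlongNear.smoothNear_tangentPart {V : ∀ q : M, TangentSpace 𝓘(ℝ, F) (ι q)}
    (hV : SmoothAlongNear (E := E) ι V p) :
    SmoothNear (fun q ↦ tangentPart E ι q (V q)) p := by
  have hdom := mem_frameDomain (F := E) p
  have hframe := smoothNear_frame hdom
  have hcoeff := hV.smoothFnNear_gramCoeff (fun a ↦ (hframe a).push hι.smooth)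
    (linearIndependent_push_frame hι hdom)
  refine (SmoothNear.sum Finset.univ fun a _ ↦ (hframe a).smul (hcoeff a)).congr ?_
  filter_upwards [frameDomain_mem_nhds hdom] with q hq using tangentPart_eq_sum_frame hι hq _

variable [FiniteDimensional ℝ F]

lemma SmoothAlongNear.smoothAlongNear_normalPart {V : ∀ q : M, TangentSpace 𝓘(ℝ, F) (ι q)}
    (hV : SmoothAlongNear (E := E) ι V p) :
    SmoothAlongNear (E := E) ι (fun q ↦ normalPart E ι q (V q)) p := by
  simp only [normalPart_eq hι]
  exact hV.sub hι.smooth ((hV.smoothNear_tangentPart hι).push hι.smooth)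

end Projections

lemma push_extend_self {E : Type*} [NormedAddCommGroup E] [NormedSpace ℝ E]
    {M : Type*} [TopologicalSpace M] [ChartedSpace E M] [IsManifold 𝓘(ℝ, E) ∞ M]
    {F : Type*} [NormedAddCommGroup F] [NormedSpace ℝ F]
    {N : Type*} [TopologicalSpace N] [ChartedSpace F N]
    (ι : M → N) {p : M} (v : TangentSpace 𝓘(ℝ, E) p) :
    push ι (FiberBundle.extend E v) p = mfderiv 𝓘(ℝ, E) 𝓘(ℝ, F) ι p v := by
  rw [push, FiberBundle.extend_apply_self]

section SecondForm

variable {E : Type*} [NormedAddCommGroup E] [NormedSpace ℝ E] [FiniteDimensional ℝ E]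
  {M : Type*} [TopologicalSpace M] [ChartedSpace E M] [IsManifold 𝓘(ℝ, E) ∞ M]
  {F : Type*} [NormedAddCommGroup F] [NormedSpace ℝ F]
  {N : Type*} [TopologicalSpace N] [ChartedSpace F N] [IsManifold 𝓘(ℝ, F) ∞ N]
  [RiemannianBundle (fun x : N ↦ TangentSpace 𝓘(ℝ, F) x)]

/-- The second fundamental form as a bilinear form on the tangent space at `p`, obtained from
`secondFundamentalForm` by extending `w` to a vector field. -/
def secondForm (cov : CovariantDerivative 𝓘(ℝ, F) F (fun x : N ↦ TangentSpace 𝓘(ℝ, F) x))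
    (ι : M → N) (p : M) (v w : TangentSpace 𝓘(ℝ, E) p) : TangentSpace 𝓘(ℝ, F) (ι p) :=
  normalPart E ι p (covAlong cov ι (push ι (FiberBundle.extend E w)) p v)

variable {cov : CovariantDerivative 𝓘(ℝ, F) F (fun x : N ↦ TangentSpace 𝓘(ℝ, F) x)}
  {ι : M → N} {p : M} {X Y Z : ∀ q : M, TangentSpace 𝓘(ℝ, E) q}

lemma secondForm_mem_orthogonal (v w : TangentSpace 𝓘(ℝ, E) p) :
    secondForm cov ι p v w ∈ (tangentSubspace E ι p)ᗮ :=
  normalPart_mem_orthogonal _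

lemma inner_secondForm_mfderiv (u v w : TangentSpace 𝓘(ℝ, E) p) :
    inner ℝ (secondForm cov ι p v w) (mfderiv 𝓘(ℝ, E) 𝓘(ℝ, F) ι p u) = 0 := by
  rw [real_inner_comm]
  exact inner_mfderiv_normalPart _ _

variable [FiniteDimensional ℝ F]

lemma secondForm_add_left (hι : IsSubmanifold E F ι) (u v w : TangentSpace 𝓘(ℝ, E) p) :
    secondForm cov ι p (u + v) w = secondForm cov ι p u w + secondForm cov ι p v w := by
  rw [secondForm, covAlong_vec_add cov hι.smooth ((smoothNear_extend w).push hι.smooth),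
    normalPart_add]
  rfl

lemma secondForm_smul_left (hι : IsSubmanifold E F ι) (c : ℝ) (v w : TangentSpace 𝓘(ℝ, E) p) :
    secondForm cov ι p (c • v) w = c • secondForm cov ι p v w := by
  rw [secondForm, covAlong_vec_smul cov hι.smooth ((smoothNear_extend w).push hι.smooth),
    normalPart_smul]
  rfl

lemma secondFundamentalForm_comm (htorsion : cov.torsion = 0) (hι : IsSubmanifold E F ι)
    (hX : SmoothNear X p) (hY : SmoothNear Y p) :
    secondFundamentalForm cov ι X Y p = secondFundamentalForm cov ι Y X p := by
  rw [← sub_eq_zero, secondFundamentalForm, secondFundamentalForm, ← normalPart_sub,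
    covAlong_push_sub htorsion hι.smooth hX hY, normalPart_mfderiv hι]

lemma secondForm_comm (htorsion : cov.torsion = 0) (hι : IsSubmanifold E F ι)
    (v w : TangentSpace 𝓘(ℝ, E) p) : secondForm cov ι p v w = secondForm cov ι p w v := by
  have hfields := secondFundamentalForm_comm htorsion hι (smoothNear_extend v)
    (smoothNear_extend w)
  simpa only [secondFundamentalForm, secondForm, FiberBundle.extend_apply_self] using hfields

-- By symmetry `σ(v, Y)` is tensorial in `Y` as well, so `Y` may be replaced by any extension of its
-- value at `p`.
lemma normalPart_covAlong_push (htorsion : cov.torsion = 0) (hι : IsSubmanifold E F ι)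
    (hY : SmoothNear Y p) (v : TangentSpace 𝓘(ℝ, E) p) :
    normalPart E ι p (covAlong cov ι (push ι Y) p v) = secondForm cov ι p v (Y p) := by
  have hfields := secondFundamentalForm_comm htorsion hι (smoothNear_extend v) hY
  simp only [secondFundamentalForm, FiberBundle.extend_apply_self] at hfields
  rw [hfields, ← secondForm, secondForm_comm htorsion hι]

lemma secondFundamentalForm_eq (htorsion : cov.torsion = 0) (hι : IsSubmanifold E F ι)
    (X : ∀ q : M, TangentSpace 𝓘(ℝ, E) q) (hY : SmoothNear Y p) :
    secondFundamentalForm cov ι X Y p = secondForm cov ι p (X p) (Y p) :=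
  normalPart_covAlong_push htorsion hι hY _

lemma covAlong_push (htorsion : cov.torsion = 0) (hι : IsSubmanifold E F ι)
    (hY : SmoothNear Y p) (v : TangentSpace 𝓘(ℝ, E) p) :
    covAlong cov ι (push ι Y) p v =
      mfderiv 𝓘(ℝ, E) 𝓘(ℝ, F) ι p (inducedConnection cov ι Y p v) +
        secondForm cov ι p v (Y p) := by
  rw [← normalPart_covAlong_push htorsion hι hY, inducedConnection,
    mfderiv_tangentPart_add_normalPart hι]

section GaussEquation

variable [IsContMDiffRiemannianBundle 𝓘(ℝ, F) ∞ F (fun x : N ↦ TangentSpace 𝓘(ℝ, F) x)]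

lemma inner_covAlong_of_smoothNormalNear (hmetric : CovariantDerivative.IsMetricCompatible (F := F)
      (V := fun x : N ↦ TangentSpace 𝓘(ℝ, F) x) cov) (htorsion : cov.torsion = 0)
    (hι : IsSubmanifold E F ι) {ξ : ∀ q : M, TangentSpace 𝓘(ℝ, F) (ι q)}
    (hξ : SmoothNormalNear E ι ξ p) (v w : TangentSpace 𝓘(ℝ, E) p) :
    inner ℝ (covAlong cov ι ξ p v) (mfderiv 𝓘(ℝ, E) 𝓘(ℝ, F) ι p w) =
      -inner ℝ (ξ p) (secondForm cov ι p v w) := by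
  have hw := smoothNear_extend w
  have hderiv := mvfderiv_inner_along hmetric hι.smooth hξ.1 (hw.push hι.smooth) v
  have hnormal : ∀ᶠ q in 𝓝 p,
      inner ℝ (ξ q) (push ι (FiberBundle.extend E w) q) = (fun _ ↦ (0 : ℝ)) q := by
    filter_upwards [hξ.2] with q hq
    rw [real_inner_comm]
    exact mem_tangentSubspace_orthogonal_iff.1 hq _
  rw [mvfderiv_congr hnormal, mvfderiv_const, covAlong_push htorsion hι hw, push_extend_self,
    FiberBundle.extend_apply_self, inner_add_right, real_inner_comm _ (ξ p),
    mem_tangentSubspace_orthogonal_iff.1 hξ.2.self_of_nhds, zero_add] at hderiv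
  exact eq_neg_of_add_eq_zero_left hderiv.symm

variable [T2Space N]

lemma SmoothNear.inducedConnection (hcov : cov.ContMDiffCovariantDerivative ∞)
    (hι : IsSubmanifold E F ι) (hX : SmoothNear X p) (hY : SmoothNear Y p) :
    SmoothNear (fun q ↦ KaehlerSubmanifold.inducedConnection cov ι Y q (X q)) p :=
  ((hY.push hι.smooth).covAlong hcov hι.smooth hX).smoothNear_tangentPart hι

lemma SmoothNear.tangentCurvature (hcov : cov.ContMDiffCovariantDerivative ∞)
    (hι : IsSubmanifold E F ι) (hX : SmoothNear X p) (hY : SmoothNear Y p) (hZ : SmoothNear Z p) :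
    SmoothNear (KaehlerSubmanifold.tangentCurvature cov ι X Y Z) p :=
  ((hX.inducedConnection hcov hι (hY.inducedConnection hcov hι hZ)).sub
    (hY.inducedConnection hcov hι (hX.inducedConnection hcov hι hZ))).sub
    ((hX.mlieBracket hY).inducedConnection hcov hι hZ)

lemma smoothNormalNear_secondForm (hcov : cov.ContMDiffCovariantDerivative ∞)
    (htorsion : cov.torsion = 0) (hι : IsSubmanifold E F ι)
    (hX : SmoothNear X p) (hY : SmoothNear Y p) :
    SmoothNormalNear E ι (fun q ↦ secondForm cov ι q (X q) (Y q)) p := by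
  refine ⟨SmoothAlongNear.congr (((hY.push hι.smooth).covAlong hcov hι.smooth
    hX).smoothAlongNear_normalPart hι) ?_, .of_forall fun q ↦ secondForm_mem_orthogonal _ _⟩
  filter_upwards [hY.eventually] with q hq using (normalPart_covAlong_push htorsion hι hq _).symm

lemma covAlong_covAlong_push (hcov : cov.ContMDiffCovariantDerivative ∞)
    (htorsion : cov.torsion = 0) (hι : IsSubmanifold E F ι) (hX : SmoothNear X p)
    (hZ : SmoothNear Z p) (v : TangentSpace 𝓘(ℝ, E) p) :
    covAlong cov ι (fun q ↦ covAlong cov ι (push ι Z) q (X q)) p v =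
      covAlong cov ι (push ι fun q ↦ inducedConnection cov ι Z q (X q)) p v +
        covAlong cov ι (fun q ↦ secondForm cov ι q (X q) (Z q)) p v := by
  rw [← covAlong_add cov hι.smooth ((SmoothNear.inducedConnection hcov hι hX hZ).push hι.smooth)
    (smoothNormalNear_secondForm hcov htorsion hι hX hZ).1]
  refine covAlong_congr cov ?_ v
  filter_upwards [hZ.eventually] with q hq using covAlong_push htorsion hι hq _

lemma inner_tangentCurvature (hcov : cov.ContMDiffCovariantDerivative ∞)
    (hmetric : CovariantDerivative.IsMetricCompatible (F := F)
      (V := fun x : N ↦ TangentSpace 𝓘(ℝ, F) x) cov) (htorsion : cov.torsion = 0)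
    (hι : IsSubmanifold E F ι) (hX : SmoothNear X p) (hY : SmoothNear Y p) (hZ : SmoothNear Z p)
    (w : TangentSpace 𝓘(ℝ, E) p) :
    inner ℝ (mfderiv 𝓘(ℝ, E) 𝓘(ℝ, F) ι p (tangentCurvature cov ι X Y Z p))
        (mfderiv 𝓘(ℝ, E) 𝓘(ℝ, F) ι p w) =
      inner ℝ (curvatureTensor cov (ι p) (push ι X p) (push ι Y p) (push ι Z p))
          (mfderiv 𝓘(ℝ, E) 𝓘(ℝ, F) ι p w) +
        inner ℝ (secondForm cov ι p (Y p) (Z p)) (secondForm cov ι p (X p) w) -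
        inner ℝ (secondForm cov ι p (X p) (Z p)) (secondForm cov ι p (Y p) w) := by
  have hsecond {A : ∀ q : M, TangentSpace 𝓘(ℝ, E) q} (hA : SmoothNear A p)
      (v : TangentSpace 𝓘(ℝ, E) p) :
      inner ℝ (covAlong cov ι (fun q ↦ covAlong cov ι (push ι Z) q (A q)) p v)
          (mfderiv 𝓘(ℝ, E) 𝓘(ℝ, F) ι p w) =
        inner ℝ (mfderiv 𝓘(ℝ, E) 𝓘(ℝ, F) ι p (inducedConnection cov ι
            (fun q ↦ inducedConnection cov ι Z q (A q)) p v)) (mfderiv 𝓘(ℝ, E) 𝓘(ℝ, F) ι p w) -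
          inner ℝ (secondForm cov ι p (A p) (Z p)) (secondForm cov ι p v w) := by
    rw [covAlong_covAlong_push hcov htorsion hι hA hZ, inner_add_left,
      inner_covAlong_of_smoothNormalNear hmetric htorsion hι
        (smoothNormalNear_secondForm hcov htorsion hι hA hZ),
      covAlong_push htorsion hι (SmoothNear.inducedConnection hcov hι hA hZ), inner_add_left,
      inner_secondForm_mfderiv, add_zero, sub_eq_add_neg]
  rw [← curvature_covAlong hcov hι.smooth hX hY (hZ.push hι.smooth), curvature, inner_sub_left,
    inner_sub_left, hsecond hY, hsecond hX, tangentCurvature, curvature, map_sub, map_sub,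
    inner_sub_left, inner_sub_left, covAlong_push htorsion hι hZ, inner_add_left,
    inner_secondForm_mfderiv]
  ring

lemma isFlat_of_finrank_le_one (hcov : cov.ContMDiffCovariantDerivative ∞)
    (hmetric : CovariantDerivative.IsMetricCompatible (F := F)
      (V := fun x : N ↦ TangentSpace 𝓘(ℝ, F) x) cov) (htorsion : cov.torsion = 0)
    (hι : IsSubmanifold E F ι) (hE : Module.finrank ℝ E ≤ 1) : IsFlat E cov ι := by
  intro p X Y Z hX hY hZ
  obtain ⟨e, he⟩ : ∃ e : TangentSpace 𝓘(ℝ, E) p, ∀ w : TangentSpace 𝓘(ℝ, E) p,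
      ∃ c : ℝ, c • e = w := (finrank_le_one_iff (K := ℝ) (V := E)).1 hE
  obtain ⟨a, ha⟩ := he (X p)
  obtain ⟨b, hb⟩ := he (Y p)
  have hgauss := inner_tangentCurvature hcov hmetric htorsion hι hX hY hZ
    (tangentCurvature cov ι X Y Z p)
  rw [push, push, ← ha, ← hb, map_smul, map_smul, curvatureTensor_smul_smul_self hcov,
    inner_zero_left, secondForm_smul_left hι, secondForm_smul_left hι, secondForm_smul_left hι,
    secondForm_smul_left hι] at hgauss
  simp only [real_inner_smul_left, real_inner_smul_right] at hgauss
  have hzero : mfderiv 𝓘(ℝ, E) 𝓘(ℝ, F) ι p (tangentCurvature cov ι X Y Z p) = 0 :=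
    inner_self_eq_zero (𝕜 := ℝ).1 (hgauss.trans (by ring))
  exact hι.injective p (hzero.trans (map_zero _).symm)

end GaussEquation

end SecondForm

section TotallyReal

variable {E : Type*} [NormedAddCommGroup E] [NormedSpace ℝ E]
  {M : Type*} [TopologicalSpace M] [ChartedSpace E M]
  {F : Type*} [NormedAddCommGroup F] [NormedSpace ℝ F]
  {N : Type*} [TopologicalSpace N] [ChartedSpace F N]
  [RiemannianBundle (fun x : N ↦ TangentSpace 𝓘(ℝ, F) x)]
  {J : ∀ x : N, TangentSpace 𝓘(ℝ, F) x →L[ℝ] TangentSpace 𝓘(ℝ, F) x}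
  {ι : M → N} {p : M} {X Y Z : ∀ q : M, TangentSpace 𝓘(ℝ, E) q}

lemma IsTotallyReal.mem_orthogonal (hreal : IsTotallyReal E J ι) (v : TangentSpace 𝓘(ℝ, E) p) :
    J (ι p) (mfderiv 𝓘(ℝ, E) 𝓘(ℝ, F) ι p v) ∈ (tangentSubspace E ι p)ᗮ :=
  hreal p _ ⟨v, rfl⟩

lemma IsTotallyReal.inner_mfderiv (hreal : IsTotallyReal E J ι) (v w : TangentSpace 𝓘(ℝ, E) p) :
    inner ℝ (J (ι p) (mfderiv 𝓘(ℝ, E) 𝓘(ℝ, F) ι p v)) (mfderiv 𝓘(ℝ, E) 𝓘(ℝ, F) ι p w) = 0 := by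
  rw [real_inner_comm]
  exact mem_tangentSubspace_orthogonal_iff.1 (hreal.mem_orthogonal v) w

variable [FiniteDimensional ℝ F] [IsManifold 𝓘(ℝ, F) ∞ N]
  {cov : CovariantDerivative 𝓘(ℝ, F) F (fun x : N ↦ TangentSpace 𝓘(ℝ, F) x)}

section CubicForm

variable [FiniteDimensional ℝ E] [IsManifold 𝓘(ℝ, E) ∞ M]

/-- The cubic form `⟨σ(u, v), J w⟩` of a totally real submanifold. -/
def cubicForm (cov : CovariantDerivative 𝓘(ℝ, F) F (fun x : N ↦ TangentSpace 𝓘(ℝ, F) x))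
    (J : ∀ x : N, TangentSpace 𝓘(ℝ, F) x →L[ℝ] TangentSpace 𝓘(ℝ, F) x) (ι : M → N) (p : M)
    (u v w : TangentSpace 𝓘(ℝ, E) p) : ℝ :=
  inner ℝ (secondForm cov ι p u v) (J (ι p) (mfderiv 𝓘(ℝ, E) 𝓘(ℝ, F) ι p w))

lemma cubicForm_add_left (hι : IsSubmanifold E F ι) (u u' v w : TangentSpace 𝓘(ℝ, E) p) :
    cubicForm cov J ι p (u + u') v w = cubicForm cov J ι p u v w + cubicForm cov J ι p u' v w := by
  rw [cubicForm, secondForm_add_left hι, inner_add_left, cubicForm, cubicForm]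

lemma cubicForm_smul_left (hι : IsSubmanifold E F ι) (c : ℝ) (u v w : TangentSpace 𝓘(ℝ, E) p) :
    cubicForm cov J ι p (c • u) v w = c * cubicForm cov J ι p u v w := by
  rw [cubicForm, secondForm_smul_left hι, real_inner_smul_left, cubicForm]

lemma cubicForm_swap_left (htorsion : cov.torsion = 0) (hι : IsSubmanifold E F ι)
    (u v w : TangentSpace 𝓘(ℝ, E) p) : cubicForm cov J ι p u v w = cubicForm cov J ι p v u w := by
  rw [cubicForm, secondForm_comm htorsion hι, cubicForm]

end CubicForm

variable [IsContMDiffRiemannianBundle 𝓘(ℝ, F) ∞ F (fun x : N ↦ TangentSpace 𝓘(ℝ, F) x)]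
  (hN : IsKaehler cov J) (hι : IsSubmanifold E F ι)

include hN

lemma IsKaehler.inner_complexStructure_left (x : N) (v w : TangentSpace 𝓘(ℝ, F) x) :
    inner ℝ (J x v) w = -inner ℝ v (J x w) := by
  rw [← hN.J_orthogonal, hN.J_sq, inner_neg_left]

include hι

lemma smoothNormalNear_complexStructure_push [IsManifold 𝓘(ℝ, E) ∞ M]
    (hreal : IsTotallyReal E J ι) (hX : SmoothNear X p) :
    SmoothNormalNear E ι (fun q ↦ J (ι q) (push ι X q)) p :=
  ⟨(hX.push hι.smooth).complexStructure hN hι.smooth, .of_forall fun _ ↦ hreal.mem_orthogonal _⟩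

variable [FiniteDimensional ℝ E]

lemma normalF_complexStructure_mfderiv (v : TangentSpace 𝓘(ℝ, E) p) :
    normalF E J ι p (J (ι p) (mfderiv 𝓘(ℝ, E) 𝓘(ℝ, F) ι p v)) = 0 := by
  rw [normalF, hN.J_sq, normalPart_neg, normalPart_mfderiv hι, neg_zero]

variable [IsManifold 𝓘(ℝ, E) ∞ M]

lemma covAlong_complexStructure_push (hX : SmoothNear X p) (v : TangentSpace 𝓘(ℝ, E) p) :
    covAlong cov ι (fun q ↦ J (ι q) (push ι X q)) p v =
      J (ι p) (mfderiv 𝓘(ℝ, E) 𝓘(ℝ, F) ι p (inducedConnection cov ι X p v)) +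
        J (ι p) (secondForm cov ι p v (X p)) := by
  rw [covAlong_complexStructure hN hι.smooth (hX.push hι.smooth),
    covAlong_push hN.torsion_free hι hX, map_add]

variable (hreal : IsTotallyReal E J ι)

include hreal

lemma cubicForm_swap_right (u v w : TangentSpace 𝓘(ℝ, E) p) :
    cubicForm cov J ι p u v w = cubicForm cov J ι p u w v := by
  have hw := smoothNear_extend w
  have hweingarten := inner_covAlong_of_smoothNormalNear hN.metric hN.torsion_free hι
    (smoothNormalNear_complexStructure_push hN hι hreal hw) u v
  rw [covAlong_complexStructure_push hN hι hw, push_extend_self, FiberBundle.extend_apply_self,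
    inner_add_left, hreal.inner_mfderiv, zero_add, hN.inner_complexStructure_left, neg_inj,
    real_inner_comm (secondForm cov ι p u v)] at hweingarten
  exact hweingarten.symm

lemma normalConnection_complexStructure_push_eq_add (hX : SmoothNear X p)
    (v : TangentSpace 𝓘(ℝ, E) p) :
    normalConnection cov ι (fun q ↦ J (ι q) (push ι X q)) p v =
      J (ι p) (mfderiv 𝓘(ℝ, E) 𝓘(ℝ, F) ι p (inducedConnection cov ι X p v)) +
        normalF E J ι p (secondForm cov ι p v (X p)) := by
  rw [normalConnection, covAlong_complexStructure_push hN hι hX, normalPart_add,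
    normalPart_of_mem_orthogonal hι (hreal.mem_orthogonal _), normalF]

lemma shapeOperator_complexStructure_push (hX : SmoothNear X p) (v : TangentSpace 𝓘(ℝ, E) p) :
    shapeOperator cov ι (fun q ↦ J (ι q) (push ι X q)) p v =
      -tangentPart E ι p (J (ι p) (secondForm cov ι p v (X p))) := by
  rw [shapeOperator, covAlong_complexStructure_push hN hι hX, tangentPart_add,
    tangentPart_of_mem_orthogonal hι (hreal.mem_orthogonal _), zero_add]

variable (hf : HasParallelF E cov J ι)

include hf

-- Differentiating `f(JW) = 0` gives `f(fσ(v, w)) = 0`, and `f` is skew-adjoint.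
lemma normalF_secondForm (v w : TangentSpace 𝓘(ℝ, E) p) :
    normalF E J ι p (secondForm cov ι p v w) = 0 := by
  have hw := smoothNear_extend w
  set s := secondForm cov ι p v w
  have hs : s ∈ (tangentSubspace E ι p)ᗮ := secondForm_mem_orthogonal v w
  have hsq : normalF E J ι p (normalF E J ι p s) = 0 := by
    have hparallel := hf p _ (smoothNormalNear_complexStructure_push hN hι hreal hw) v
    have hJw : (fun q ↦ normalF E J ι q (J (ι q) (push ι (FiberBundle.extend E w) q))) =
        fun _ ↦ 0 :=
      funext fun q ↦ normalF_complexStructure_mfderiv hN hι _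
    rw [hJw, normalConnection, covAlong_zero cov hι.smooth, normalPart_zero,
      normalConnection_complexStructure_push_eq_add hN hι hreal hw, FiberBundle.extend_apply_self,
      normalF, map_add, normalPart_add, ← normalF, normalF_complexStructure_mfderiv hN hι,
      zero_add] at hparallel
    exact hparallel.symm
  rw [← inner_self_eq_zero (𝕜 := ℝ)]
  calc inner ℝ (normalF E J ι p s) (normalF E J ι p s)
      = inner ℝ (normalF E J ι p s) (J (ι p) s) :=
        inner_normalPart_of_mem_orthogonal (normalPart_mem_orthogonal _) _
    _ = -inner ℝ s (J (ι p) (normalF E J ι p s)) := by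
        rw [real_inner_comm, hN.inner_complexStructure_left]
    _ = -inner ℝ s (normalF E J ι p (normalF E J ι p s)) := by
        rw [← inner_normalPart_of_mem_orthogonal hs, ← normalF]
    _ = 0 := by rw [hsq, inner_zero_right, neg_zero]

lemma mfderiv_tangentPart_complexStructure (v w : TangentSpace 𝓘(ℝ, E) p) :
    mfderiv 𝓘(ℝ, E) 𝓘(ℝ, F) ι p (tangentPart E ι p (J (ι p) (secondForm cov ι p v w))) =
      J (ι p) (secondForm cov ι p v w) := by
  conv_rhs => rw [← mfderiv_tangentPart_add_normalPart hι (J (ι p) (secondForm cov ι p v w)),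
    ← normalF, normalF_secondForm hN hι hreal hf, add_zero]

lemma mfderiv_shapeOperator_complexStructure_push (hX : SmoothNear X p)
    (v : TangentSpace 𝓘(ℝ, E) p) :
    mfderiv 𝓘(ℝ, E) 𝓘(ℝ, F) ι p (shapeOperator cov ι (fun q ↦ J (ι q) (push ι X q)) p v) =
      -J (ι p) (secondForm cov ι p v (X p)) := by
  rw [shapeOperator_complexStructure_push hN hι hreal hX, map_neg,
    mfderiv_tangentPart_complexStructure hN hι hreal hf]

lemma inner_shapeOperator_shapeOperator (hX : SmoothNear X p) (hY : SmoothNear Y p)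
    (v w : TangentSpace 𝓘(ℝ, E) p) :
    inner ℝ (mfderiv 𝓘(ℝ, E) 𝓘(ℝ, F) ι p
        (shapeOperator cov ι (fun q ↦ J (ι q) (push ι X q)) p
          (shapeOperator cov ι (fun q ↦ J (ι q) (push ι Y q)) p v)))
        (mfderiv 𝓘(ℝ, E) 𝓘(ℝ, F) ι p w) =
      inner ℝ (secondForm cov ι p (Y p) v) (secondForm cov ι p (X p) w) := by
  set u := shapeOperator cov ι (fun q ↦ J (ι q) (push ι Y q)) p v with hu
  rw [mfderiv_shapeOperator_complexStructure_push hN hι hreal hf hX, inner_neg_left,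
    hN.inner_complexStructure_left, neg_neg, ← cubicForm, cubicForm_swap_left hN.torsion_free hι,
    cubicForm_swap_right hN hι hreal, cubicForm, hu,
    mfderiv_shapeOperator_complexStructure_push hN hι hreal hf hY, map_neg, hN.J_sq, neg_neg,
    real_inner_comm, secondForm_comm hN.torsion_free hι v]

lemma inner_secondForm_secondForm_swap (hcomm : HasCommutativeSecondForms E cov ι)
    (u v w z : TangentSpace 𝓘(ℝ, E) p) :
    inner ℝ (secondForm cov ι p u v) (secondForm cov ι p w z) =
      inner ℝ (secondForm cov ι p w v) (secondForm cov ι p u z) := by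
  have hu := smoothNear_extend u
  have hw := smoothNear_extend w
  have hshape := hcomm p _ _ (smoothNormalNear_complexStructure_push hN hι hreal hw)
    (smoothNormalNear_complexStructure_push hN hι hreal hu) v
  have hinner := congr(inner ℝ (mfderiv 𝓘(ℝ, E) 𝓘(ℝ, F) ι p $hshape)
    (mfderiv 𝓘(ℝ, E) 𝓘(ℝ, F) ι p z))
  simpa only [inner_shapeOperator_shapeOperator hN hι hreal hf hw hu,
    inner_shapeOperator_shapeOperator hN hι hreal hf hu hw, FiberBundle.extend_apply_self]
    using hinner

variable [T2Space N]
  {μ : ℝ} (hμ : HasConstantHolomorphicCurvature cov J μ)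
  (hcomm : HasCommutativeSecondForms E cov ι)

include hμ hcomm

lemma tangentCurvature_eq (hX : SmoothNear X p) (hY : SmoothNear Y p) (hZ : SmoothNear Z p) :
    tangentCurvature cov ι X Y Z p = (μ / 4) •
      (inner ℝ (push (F := F) ι Y p) (push (F := F) ι Z p) • X p -
        inner ℝ (push (F := F) ι X p) (push (F := F) ι Z p) • Y p) := by
  set V := (μ / 4) • (inner ℝ (push (F := F) ι Y p) (push (F := F) ι Z p) • X p -
    inner ℝ (push (F := F) ι X p) (push (F := F) ι Z p) • Y p) with hV
  have hpush (A B : ∀ q : M, TangentSpace 𝓘(ℝ, E) q) :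
      inner ℝ (J (ι p) (push ι A p)) (push ι B p) = 0 :=
    hreal.inner_mfderiv _ _
  have horthogonal (w : TangentSpace 𝓘(ℝ, E) p) :
      inner ℝ (mfderiv 𝓘(ℝ, E) 𝓘(ℝ, F) ι p (tangentCurvature cov ι X Y Z p - V))
        (mfderiv 𝓘(ℝ, E) 𝓘(ℝ, F) ι p w) = 0 := by
    rw [map_sub, inner_sub_left, inner_tangentCurvature hN.smooth_cov hN.metric hN.torsion_free hι
      hX hY hZ w, inner_secondForm_secondForm_swap hN hι hreal hf hcomm (Y p),
      inner_curvatureTensor_of_totallyReal hN hμ (hpush X Y) (hpush X Z) (hpush Y Z), hV,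
      map_smul, map_sub, map_smul, map_smul, inner_smul_left, inner_sub_left, inner_smul_left,
      inner_smul_left]
    simp only [conj_trivial, push]
    ring
  apply hι.injective p
  rw [← sub_eq_zero, ← map_sub, ← inner_self_eq_zero (𝕜 := ℝ)]
  exact horthogonal _

end TotallyReal

section TrilinearForm

lemma eq_zero_of_apply_self_self_self_eq_zero {V : Type*} [Add V] {C : V → V → V → ℝ}
    (hadd : ∀ u u' v w, C (u + u') v w = C u v w + C u' v w)
    (hleft : ∀ u v w, C u v w = C v u w) (hright : ∀ u v w, C u v w = C u w v)
    (hdiag : ∀ v, C v v v = 0) (u v w : V) : C u v w = 0 := by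
  have hadd_mid (u v v' w : V) : C u (v + v') w = C u v w + C u v' w := by
    rw [hleft, hadd, hleft v, hleft v']
  have hadd_right (u v w w' : V) : C u v (w + w') = C u v w + C u v w' := by
    rw [hright, hadd_mid, hright u w, hright u w']
  have hpair (u v : V) : C u u v = 0 := by
    have huv := hdiag (u + v)
    have huvv := hdiag (u + (v + v))
    have huvu : C u v u = C u u v := hright u v u
    have hvuu : C v u u = C u u v := (hleft v u u).trans huvu
    have hvuv : C v u v = C u v v := hleft v u v
    have hvvu : C v v u = C u v v := (hright v v u).trans hvuv
    simp only [hadd, hadd_mid, hadd_right, hdiag, huvu, hvuu, hvuv, hvvu] at huv huvv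
    linarith
  have huv := hpair (u + v) w
  simp only [hadd, hadd_mid, hpair, hleft v u] at huv
  linarith

variable {V : Type*} [AddCommGroup V] [Module ℝ V] {B : LinearMap.BilinForm ℝ V}
  {C : V → V → V → ℝ}

-- The identity with `x ⊥ y` and `w = y` gives `C x y y = 0`; exchanging `x` and `y` and then taking
-- `w = x` leaves `C y y y * B x x = 0`.
lemma apply_self_self_self_eq_zero_of_semiparallel (hV : 1 < Module.finrank ℝ V) (hB : B.IsSymm)
    (hdefinite : ∀ v, B v v = 0 → v = 0)
    (hleft : ∀ u v w, C u v w = C v u w) (hright : ∀ u v w, C u v w = C u w v)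
    (hC : ∀ x y w, C y y y * B x w - C y y x * B y w =
      2 * (B y y * C x y w - B x y * C y y w)) (y : V) : C y y y = 0 := by
  have : FiniteDimensional ℝ V := Module.finite_of_finrank_pos (zero_lt_one.trans hV)
  have horthogonal {x y : V} (hy : y ≠ 0) (hxy : B x y = 0) : C x y y = 0 := by
    have hyyx : C y y x = C x y y := (hright y y x).trans (hleft y x y)
    have hidentity := hC x y y
    rw [hxy, hyyx] at hidentity
    exact (mul_eq_zero.1 (by linarith : B y y * C x y y = 0)).resolve_left (mt (hdefinite y) hy)
  have hker : LinearMap.ker (B y) ≠ ⊥ :=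
    LinearMap.ker_ne_bot_of_finrank_lt ((Module.finrank_self ℝ).trans_lt hV)
  obtain ⟨x, hyx, hx⟩ := (Submodule.ne_bot_iff _).1 hker
  rw [LinearMap.mem_ker] at hyx
  have hxy : B x y = 0 := (hB.eq y x).symm.trans hyx
  have hidentity := hC x y x
  rw [hleft x y x, horthogonal hx hyx, hxy, hyx] at hidentity
  exact (mul_eq_zero.1 (by linarith : C y y y * B x x = 0)).resolve_right (mt (hdefinite x) hx)

end TrilinearForm

section Semiparallel

variable {E : Type*} [NormedAddCommGroup E] [NormedSpace ℝ E] [FiniteDimensional ℝ E]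
  {M : Type*} [TopologicalSpace M] [ChartedSpace E M]
  {F : Type*} [NormedAddCommGroup F] [NormedSpace ℝ F]
  {N : Type*} [TopologicalSpace N] [ChartedSpace F N] [IsManifold 𝓘(ℝ, F) ∞ N]
  [RiemannianBundle (fun x : N ↦ TangentSpace 𝓘(ℝ, F) x)]
  {cov : CovariantDerivative 𝓘(ℝ, F) F (fun x : N ↦ TangentSpace 𝓘(ℝ, F) x)}
  {ι : M → N} {p : M}

lemma normalCurvature_congr (X Y : ∀ q : M, TangentSpace 𝓘(ℝ, E) q)
    {ξ η : ∀ q : M, TangentSpace 𝓘(ℝ, F) (ι q)} (hξ : ∀ᶠ q in 𝓝 p, ξ q = η q) :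
    normalCurvature cov ι X Y ξ p = normalCurvature cov ι X Y η p := by
  have hconnection (A : ∀ q : M, TangentSpace 𝓘(ℝ, E) q) : ∀ᶠ q in 𝓝 p,
      normalConnection cov ι ξ q (A q) = normalConnection cov ι η q (A q) := by
    filter_upwards [hξ.eventually_nhds] with q hq
    rw [normalConnection, normalConnection, covAlong_congr cov hq]
  simp only [normalCurvature, curvature]
  rw [normalConnection, normalConnection, normalConnection, covAlong_congr cov (hconnection Y),
    covAlong_congr cov (hconnection X), covAlong_congr cov hξ]
  rfl

variable [FiniteDimensional ℝ F] [IsManifold 𝓘(ℝ, E) ∞ M]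
  [IsContMDiffRiemannianBundle 𝓘(ℝ, F) ∞ F (fun x : N ↦ TangentSpace 𝓘(ℝ, F) x)]
  {J : ∀ x : N, TangentSpace 𝓘(ℝ, F) x →L[ℝ] TangentSpace 𝓘(ℝ, F) x}
  {X Y Z U : ∀ q : M, TangentSpace 𝓘(ℝ, E) q}
  (hN : IsKaehler cov J) (hι : IsSubmanifold E F ι) (hreal : IsTotallyReal E J ι)
  (hf : HasParallelF E cov J ι)

include hN hι hreal hf

lemma normalConnection_complexStructure_push (hX : SmoothNear X p) (v : TangentSpace 𝓘(ℝ, E) p) :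
    normalConnection cov ι (fun q ↦ J (ι q) (push ι X q)) p v =
      J (ι p) (mfderiv 𝓘(ℝ, E) 𝓘(ℝ, F) ι p (inducedConnection cov ι X p v)) := by
  rw [normalConnection_complexStructure_push_eq_add hN hι hreal hX,
    normalF_secondForm hN hι hreal hf, add_zero]

variable [T2Space N]

lemma normalCurvature_complexStructure_push (hX : SmoothNear X p) (hY : SmoothNear Y p)
    (hZ : SmoothNear Z p) :
    normalCurvature cov ι X Y (fun q ↦ J (ι q) (push ι Z q)) p =
      J (ι p) (mfderiv 𝓘(ℝ, E) 𝓘(ℝ, F) ι p (tangentCurvature cov ι X Y Z p)) := by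
  have hiterated {A : ∀ q : M, TangentSpace 𝓘(ℝ, E) q} (hA : SmoothNear A p)
      (v : TangentSpace 𝓘(ℝ, E) p) :
      normalConnection cov ι
          (fun q ↦ normalConnection cov ι (fun q ↦ J (ι q) (push ι Z q)) q (A q)) p v =
        J (ι p) (mfderiv 𝓘(ℝ, E) 𝓘(ℝ, F) ι p
          (inducedConnection cov ι (fun q ↦ inducedConnection cov ι Z q (A q)) p v)) := by
    rw [← normalConnection_complexStructure_push hN hι hreal hf
      (SmoothNear.inducedConnection hN.smooth_cov hι hA hZ), normalConnection, normalConnection]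
    congr 1
    refine covAlong_congr cov ?_ v
    filter_upwards [hZ.eventually] with q hq
    exact normalConnection_complexStructure_push hN hι hreal hf hq _
  rw [normalCurvature, curvature, hiterated hY, hiterated hX,
    normalConnection_complexStructure_push hN hι hreal hf hZ, tangentCurvature, curvature]
  simp only [map_sub]

variable {μ : ℝ} (hμ : HasConstantHolomorphicCurvature cov J μ)
  (hcomm : HasCommutativeSecondForms E cov ι)

include hμ hcomm

-- `σ(Z, U) = JT` for the tangent field `T = -Jσ(Z, U)`, so that `R^⊥(X, Y)σ(Z, U) = J R(X, Y)T`.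
lemma normalCurvature_secondFundamentalForm (hX : SmoothNear X p) (hY : SmoothNear Y p)
    (hZ : SmoothNear Z p) (hU : SmoothNear U p) :
    normalCurvature cov ι X Y (secondFundamentalForm cov ι Z U) p =
      (μ / 4) • (cubicForm cov J ι p (Z p) (U p) (Y p) • J (ι p) (push ι X p) -
        cubicForm cov J ι p (Z p) (U p) (X p) • J (ι p) (push ι Y p)) := by
  set S : ∀ q : M, TangentSpace 𝓘(ℝ, F) (ι q) := fun q ↦ secondForm cov ι q (Z q) (U q)
  set T : ∀ q : M, TangentSpace 𝓘(ℝ, E) q := fun q ↦ tangentPart E ι q ((-1 : ℝ) • J (ι q) (S q))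
  have hS : SmoothAlongNear (E := E) ι S p :=
    (smoothNormalNear_secondForm hN.smooth_cov hN.torsion_free hι hZ hU).1
  have hT : SmoothNear T p :=
    ((hS.complexStructure hN hι.smooth).smul hι.smooth (.const (-1))).smoothNear_tangentPart hι
  have hpush (q : M) : push ι T q = -J (ι q) (S q) := by
    rw [push]
    simp only [T]
    rw [tangentPart_smul, map_smul, neg_one_smul,
      mfderiv_tangentPart_complexStructure hN hι hreal hf]
  have hinner (w : TangentSpace 𝓘(ℝ, E) p) :
      inner ℝ (mfderiv 𝓘(ℝ, E) 𝓘(ℝ, F) ι p w) (push ι T p) =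
        cubicForm cov J ι p (Z p) (U p) w := by
    rw [hpush, inner_neg_right, real_inner_comm, hN.inner_complexStructure_left, neg_neg,
      cubicForm]
  have hsecond : ∀ᶠ q in 𝓝 p, secondFundamentalForm cov ι Z U q = J (ι q) (push ι T q) := by
    filter_upwards [hU.eventually] with q hq
    rw [secondFundamentalForm_eq hN.torsion_free hι Z hq, hpush, map_neg, hN.J_sq, neg_neg]
  rw [normalCurvature_congr X Y hsecond,
    normalCurvature_complexStructure_push hN hι hreal hf hX hY hT,
    tangentCurvature_eq hN hι hreal hf hμ hcomm hX hY hT]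
  simp only [map_smul, map_sub, push] at hinner ⊢
  rw [hinner, hinner]

lemma cubicForm_semiparallel_identity (hsemi : IsSemiparallel E cov ι) (hμ0 : μ ≠ 0)
    (x y w : TangentSpace 𝓘(ℝ, E) p) :
    let d := mfderiv 𝓘(ℝ, E) 𝓘(ℝ, F) ι p
    cubicForm cov J ι p y y y * inner ℝ (d x) (d w) -
        cubicForm cov J ι p y y x * inner ℝ (d y) (d w) =
      2 * (inner ℝ (d y) (d y) * cubicForm cov J ι p x y w -
        inner ℝ (d x) (d y) * cubicForm cov J ι p y y w) := by
  intro d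
  have hx := smoothNear_extend x
  have hy := smoothNear_extend y
  have hcurvature : tangentCurvature cov ι (FiberBundle.extend E x) (FiberBundle.extend E y)
      (FiberBundle.extend E y) p =
        (μ / 4 * inner ℝ (d y) (d y)) • x + (-(μ / 4 * inner ℝ (d x) (d y))) • y := by
    rw [tangentCurvature_eq hN hι hreal hf hμ hcomm hx hy hy]
    simp only [push_extend_self, FiberBundle.extend_apply_self]
    module
  have hfields := hsemi p _ _ _ _ hx hy hy hy
  rw [normalCurvature_secondFundamentalForm hN hι hreal hf hμ hcomm hx hy hy hy,
    secondFundamentalForm_eq hN.torsion_free hι _ hy,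
    secondFundamentalForm_eq hN.torsion_free hι _ (hx.tangentCurvature hN.smooth_cov hι hy hy),
    secondForm_comm hN.torsion_free hι (FiberBundle.extend E y p), hcurvature] at hfields
  simp only [push_extend_self, FiberBundle.extend_apply_self] at hfields
  have hinner := congr(inner ℝ $hfields (J (ι p) (d w)))
  rw [inner_sub_left, inner_sub_left, real_inner_smul_left, inner_sub_left, real_inner_smul_left,
    real_inner_smul_left, hN.J_orthogonal, hN.J_orthogonal, inner_zero_left, ← cubicForm,
    cubicForm_add_left hι, cubicForm_smul_left hι, cubicForm_smul_left hι] at hinner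
  apply mul_left_cancel₀ (div_ne_zero hμ0 four_ne_zero)
  linarith

lemma secondForm_eq_zero (hsemi : IsSemiparallel E cov ι) (hμ0 : μ ≠ 0)
    (hE : 1 < Module.finrank ℝ E) (v w : TangentSpace 𝓘(ℝ, E) p) :
    secondForm cov ι p v w = 0 := by
  let d := mfderiv 𝓘(ℝ, E) 𝓘(ℝ, F) ι p
  let B : LinearMap.BilinForm ℝ (TangentSpace 𝓘(ℝ, E) p) :=
    (innerₗ (TangentSpace 𝓘(ℝ, F) (ι p))).compl₁₂ d.toLinearMap d.toLinearMap
  have hdefinite (u : TangentSpace 𝓘(ℝ, E) p) (hu : B u u = 0) : u = 0 :=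
    hι.injective p ((inner_self_eq_zero (𝕜 := ℝ).1 hu).trans (map_zero d).symm)
  have hleft := cubicForm_swap_left (J := J) (p := p) hN.torsion_free hι
  have hright := cubicForm_swap_right (p := p) hN hι hreal
  have hdiag := apply_self_self_self_eq_zero_of_semiparallel (B := B) hE
    ⟨fun u u' ↦ real_inner_comm (d u') (d u)⟩ hdefinite hleft hright
    (cubicForm_semiparallel_identity hN hι hreal hf hμ hcomm hsemi hμ0)
  have hcubic := eq_zero_of_apply_self_self_self_eq_zero (cubicForm_add_left hι) hleft hright hdiag
    v w (tangentPart E ι p (J (ι p) (secondForm cov ι p v w)))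
  rwa [cubicForm, mfderiv_tangentPart_complexStructure hN hι hreal hf, hN.J_sq, inner_neg_right,
    neg_eq_zero, inner_self_eq_zero] at hcubic

lemma isTotallyGeodesic_of_holomorphicCurvature_ne_zero (hsemi : IsSemiparallel E cov ι)
    (hμ0 : μ ≠ 0) (hE : 1 < Module.finrank ℝ E) : IsTotallyGeodesic E cov ι := by
  intro p X Y _ hY
  rw [secondFundamentalForm_eq hN.torsion_free hι X hY,
    secondForm_eq_zero hN hι hreal hf hμ hcomm hsemi hμ0 hE]

lemma isFlat_of_holomorphicCurvature_eq_zero (hμ0 : μ = 0) : IsFlat E cov ι := by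
  intro p X Y Z hX hY hZ
  rw [tangentCurvature_eq hN hι hreal hf hμ hcomm hX hY hZ, hμ0, zero_div, zero_smul]

end Semiparallel

end KaehlerSubmanifold

end

open KaehlerSubmanifold in
theorem proposition2_general {E : Type*} [NormedAddCommGroup E] [NormedSpace ℝ E]
    [FiniteDimensional ℝ E] {M : Type*} [TopologicalSpace M] [ChartedSpace E M]
    [IsManifold 𝓘(ℝ, E) ∞ M]
    {F : Type*} [NormedAddCommGroup F] [NormedSpace ℝ F] [FiniteDimensional ℝ F]
    {N : Type*} [TopologicalSpace N] [T2Space N] [ChartedSpace F N] [IsManifold 𝓘(ℝ, F) ∞ N]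
    [RiemannianBundle (fun x : N ↦ TangentSpace 𝓘(ℝ, F) x)]
    [IsContMDiffRiemannianBundle 𝓘(ℝ, F) ∞ F (fun x : N ↦ TangentSpace 𝓘(ℝ, F) x)]
    {cov : CovariantDerivative 𝓘(ℝ, F) F (fun x : N ↦ TangentSpace 𝓘(ℝ, F) x)}
    {J : ∀ x : N, TangentSpace 𝓘(ℝ, F) x →L[ℝ] TangentSpace 𝓘(ℝ, F) x} {μ : ℝ} {ι : M → N}
    (hN : IsKaehler cov J) (hμ : HasConstantHolomorphicCurvature cov J μ)
    (hι : IsSubmanifold E F ι) (hreal : IsTotallyReal E J ι) (hsemi : IsSemiparallel E cov ι)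
    (hcomm : HasCommutativeSecondForms E cov ι) (hf : HasParallelF E cov J ι) :
    IsTotallyGeodesic E cov ι ∨ IsFlat E cov ι := by
  rcases le_or_gt (Module.finrank ℝ E) 1 with hE | hE
  · exact .inr (isFlat_of_finrank_le_one hN.smooth_cov hN.metric hN.torsion_free hι hE)
  · rcases eq_or_ne μ 0 with hμ0 | hμ0
    · exact .inr (isFlat_of_holomorphicCurvature_eq_zero hN hι hreal hf hμ hcomm hμ0)
    · exact .inl (isTotallyGeodesic_of_holomorphicCurvature_ne_zero hN hι hreal hf hμ hcomm hsemi
        hμ0 hE)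

theorem proposition2 {n m : ℕ} (hn : 1 < n)
    {M : Type*} [TopologicalSpace M] [T2Space M]
    [ChartedSpace (EuclideanSpace ℝ (Fin n)) M] [IsManifold (𝓡 n) ∞ M]
    {N : Type*} [TopologicalSpace N] [T2Space N]
    [ChartedSpace (EuclideanSpace ℝ (Fin (2 * m))) N] [IsManifold (𝓡 (2 * m)) ∞ N]
    [RiemannianBundle (fun x : N ↦ TangentSpace (𝓡 (2 * m)) x)]
    [IsContMDiffRiemannianBundle (𝓡 (2 * m)) ∞ (EuclideanSpace ℝ (Fin (2 * m)))
      (fun x : N ↦ TangentSpace (𝓡 (2 * m)) x)]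
    (cov : CovariantDerivative (𝓡 (2 * m)) (EuclideanSpace ℝ (Fin (2 * m)))
      (fun x : N ↦ TangentSpace (𝓡 (2 * m)) x))
    (J : ∀ x : N, TangentSpace (𝓡 (2 * m)) x →L[ℝ] TangentSpace (𝓡 (2 * m)) x)
    (μ : ℝ)
    (hN : KaehlerSubmanifold.IsKaehler cov J)
    (hμ : KaehlerSubmanifold.HasConstantHolomorphicCurvature cov J μ)
    (ι : M → N)
    (hι : KaehlerSubmanifold.IsSubmanifold (EuclideanSpace ℝ (Fin n))
      (EuclideanSpace ℝ (Fin (2 * m))) ι)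
    (hreal : KaehlerSubmanifold.IsTotallyReal (EuclideanSpace ℝ (Fin n)) J ι)
    (hsemi : KaehlerSubmanifold.IsSemiparallel (EuclideanSpace ℝ (Fin n)) cov ι)
    (hcomm : KaehlerSubmanifold.HasCommutativeSecondForms (EuclideanSpace ℝ (Fin n)) cov ι)
    (hf : KaehlerSubmanifold.HasParallelF (EuclideanSpace ℝ (Fin n)) cov J ι) :
    KaehlerSubmanifold.IsTotallyGeodesic (EuclideanSpace ℝ (Fin n)) cov ι ∨
      KaehlerSubmanifold.IsFlat (EuclideanSpace ℝ (Fin n)) cov ι :=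
  proposition2_general hN hμ hι hreal hsemi hcomm hf
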